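/- Setting. Let $N,d,k\ge 1$. For each mode $i\in\{1,\dots,N\}$ let $A_i,Q_i\in\mathbb R^{d\times d}$, $B_i\in\mathbb R^{d\times k}$, $R_i\in\mathbb R^{k\times k}$ with $Q_i\succ0$ and $R_i\succ 0$. Let $(\omega(t))_{t\ge0}$ be a time-homogeneous Markov chain on $\{1,\dots,N\}$ with transition probabilities $p_{ij}$ and initial distribution $\pi$, where $\pi_i>0$ for all $i$, and let $x_0$ be a random vector in $\mathbb R^d$, independent of the chain, with finite second moments and $\mathbb E[x_0x_0^T]\succ0$. For $K=(K_1,\dots,K_N)$ with $K_i\in\mathbb R^{k\times d}$ consider the closed loop $x_{t+1}=\Gamma_{\omega(t)}x_t$, $\Gamma_i=A_i-B_iK_i$, that is, $x_{t+1}=A_{\omega(t)}x_t+B_{\omega(t)}u_t$ with $u_t=-K_{\omega(t)}x_t$, and the cost $$C(K)=\mathbb E\Big[\sum_{t\ge0}x_t^TQ_{\omega(t)}x_t+u_t^TR_{\omega(t)}u_t\Big].$$ Let $\mathbb K$ be the set of all $K$ for which the closed loop is mean-square stable: $\mathbb E[x_tx_t^T]\to0$ for every deterministic initial state and every initial mode.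 Assume $\mathbb K\ne\emptyset$. Notation. For tuples of matrices, products, transposes and inverses are taken componentwise; $\langle V,S\rangle=\sum_i\operatorname{tr}(V_i^TS_i)$, $\|V\|_2=\langle V,V\rangle^{1/2}$, $\|V\|_{\max}=\max_i\|V_i\|$ with $\|\cdot\|$ the maximal singular value, and $\Lambda_{\min}(V)=\min_i\sigma_{\min}(V_i)$ with $\sigma_{\min}$ the minimal singular value. Gradient and Hessian are taken with respect to $\langle\cdot,\cdot\rangle$, and $\|\nabla^2C(K)\|$ is the operator norm with respect to $\|\cdot\|_2$. Put $\mathcal E_i(V)=\sum_jp_{ij}V_j$ and $\mathcal E(V)=(\mathcal E_1(V),\dots,\mathcal E_N(V))$, and for $K\in\mathbb K$ let $P^K$ be the solution of $P_i=Q_i+K_i^TR_iK_i+\Gamma_i^T\mathcal E_i(P)\Gamma_i$ for all $i$, let $\mathbf X^K_i=\sum_{t\ge0}\mathbb E[x_tx_t^T\mathbf 1_{\{\omega(t)=i\}}]$, $\Psi^K=R+B^T\mathcal E(P^K)B$ and $L^K=\Psi^KK-B^T\mathcal E(P^K)A$. Put $\mu=\min_i\pi_i\cdot\sigma_{\min}(\mathbb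 E[x_0x_0^T])$, and $\mathbb K_\alpha=\{K\in\mathbb K: C(K)\le\alpha\}$ for $\alpha\in\mathbb R$. Claim. For every $K\in\mathbb K$ the cost $C(K)$ is finite, $P^K$ exists and is unique, $C(K)=\mathbb E\big[x_0^T(\sum_i\pi_iP^K_i)x_0\big]$, the series $\mathbf X^K$ converges, and $C$ is twice continuously differentiable at $K$. There is a unique $K^*\in\mathbb K$ that minimizes $C$ over $\mathbb K$, and $\mu>0$. Moreover: 1. (Coercivity) For every sequence $(K^l)$ in $\mathbb K$ such that $\|K^l\|_2\to\infty$, or such that $K^l$ converges to a point of the boundary $\partial\mathbb K$, one has $C(K^l)\to+\infty$. 2. (Almost smoothness) For all $K,K'\in\mathbb K$, with $\Delta K=K-K'$, $$C(K')-C(K)=\sum_i\Big(-2\operatorname{tr}\big(\mathbf X_i^{K'}\Delta K_i^TL_i^K\big)+\operatorname{tr}\big(\mathbf X_i^{K'}\Delta K_i^T\Psi_i^K\Delta K_i\big)\Big)=-2\langle\Delta K^TL^K,\mathbf X^{K'}\rangle+\langle\Delta K^T\Psi^K\Delta K,\mathbf X^{K'}\rangle .$$ 3. (Gradient dominance) For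 every $K\in\mathbb K$, $$C(K)-C(K^*)\le\|\mathbf X^{K^*}\|_{\max}\langle(\Psi^K)^{-1}L^K,L^K\rangle\le\frac{\|\mathbf X^{K^*}\|_{\max}}{\Lambda_{\min}(R)}\|L^K\|_2^2\le\frac{\|\mathbf X^{K^*}\|_{\max}}{4\mu^2\Lambda_{\min}(R)}\|\nabla C(K)\|_2^2 .$$ 4. (Compact sublevel sets) $\mathbb K_\alpha$ is compact for every $\alpha\ge C(K^*)$. 5. (Smoothness on sublevel sets) For every $\alpha\in\mathbb R$ put $$\xi=\frac1{\Lambda_{\min}(Q)}\Big(\frac{1+\|B\|_{\max}^2}{\mu}\alpha+\|R\|_{\max}\Big)-1,\qquad L=2\Big(\|R\|_{\max}+\|B\|_{\max}^2\Big(1+\frac{2\xi}{\|B\|_{\max}}\Big)\frac{\alpha}{\mu}\Big)\frac{\alpha}{\Lambda_{\min}(Q)},$$ where $\|B\|_{\max}^2(1+2\xi/\|B\|_{\max})$ is read as $0$ if $B=0$. Then $\|\nabla^2C(K)\|\le L$ for every $K\in\mathbb K_\alpha$, and for all $K,K'$ with $tK+(1-t)K'\in\mathbb K_\alpha$ for every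 $t\in[0,1]$, $$C(K')\le C(K)+\langle\nabla C(K),K'-K\rangle+\frac L2\|K'-K\|_2^2 .$$ -/

import Mathlib

open Filter Topology MeasureTheory ProbabilityTheory
open scoped Matrix ENNReal Gradient

noncomputable section

namespace MJLS

/-- The maximal singular value (spectral norm) of a real matrix. -/
def specNorm {m n : ℕ} (M : Matrix (Fin m) (Fin n) ℝ) : ℝ :=
  ‖(Matrix.toEuclideanLin M).toContinuousLinearMap‖

/-- The minimal singular value of a square matrix. -/
def sigmaMin {n : ℕ} (M : Matrix (Fin n) (Fin n) ℝ) : ℝ :=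
  ⨅ j : Fin n, (Matrix.toEuclideanLin M).singularValues (j : ℕ)

/-- `‖V‖_max`, the maximum over the modes of the spectral norms. -/
def normMax {N m n : ℕ} (V : Fin N → Matrix (Fin m) (Fin n) ℝ) : ℝ :=
  ⨆ i, specNorm (V i)

/-- `Λ_min(V)`, the minimum over the modes of the minimal singular values. -/
def lamMin {N n : ℕ} (V : Fin N → Matrix (Fin n) (Fin n) ℝ) : ℝ :=
  ⨅ i, sigmaMin (V i)

/-- The inner product `⟨V, S⟩ = ∑ i, tr (V iᵀ S i)` of two tuples of matrices. -/
def tupleInner {N m n : ℕ} (V S : Fin N → Matrix (Fin m) (Fin n) ℝ) : ℝ :=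
  ∑ i, ((V i)ᵀ * S i).trace

/-- The space of policies `K = (K_1, …, K_N)`, `K_i` a `k × d` matrix. As a Euclidean space over
the entries, its norm is `‖K‖_2 = (∑ i, tr (K iᵀ K i))^(1/2)` and its inner product is
`∑ i, tr (K iᵀ K' i)`. -/
abbrev Policy (N k d : ℕ) : Type := EuclideanSpace ℝ (Fin N × Fin k × Fin d)

/-- The gain matrix `K_i` of mode `i`. -/
def Policy.mat {N k d : ℕ} (K : Policy N k d) (i : Fin N) : Matrix (Fin k) (Fin d) ℝ :=
  Matrix.of fun a b => K (i, a, b)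

/-- A process with values in `Fin N` that is a time-homogeneous Markov chain with initial
distribution `π` and transition matrix `p`. The last field is the Markov property
`Pr(ω(t+1) = j | ω(t) = i, ω(t-1) = …, …, ω(0) = …) = p i j`, multiplied out. -/
structure IsMarkovChain {N : ℕ} {Ω : Type*} [MeasurableSpace Ω] (Pr : Measure Ω)
    (ω : ℕ → Ω → Fin N) (π : Fin N → ℝ) (p : Matrix (Fin N) (Fin N) ℝ) : Prop where
  measurable : ∀ t, Measurable (ω t)
  initial : ∀ i, Pr.real {a | ω 0 a = i} = π i
  step : ∀ (t : ℕ) (w : ℕ → Fin N),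
    Pr.real {a | ∀ s ≤ t + 1, ω s a = w s} =
      Pr.real {a | ∀ s ≤ t, ω s a = w s} * p (w t) (w (t + 1))

end MJLS

/-- A Markovian jump linear quadratic control problem with `N` modes, state space `ℝ^d` and input
space `ℝ^k`, on a probability space `(Ω, Pr)`: the system `x_{t+1} = A_{ω(t)} x_t + B_{ω(t)} u_t`,
the Markov chain `ω` with initial distribution `π` and transition matrix `p`, the random initial
state `x0`, independent of the chain, and the cost matrices `Q` and `R`. -/
structure MJLS (N d k : ℕ) (Ω : Type*) [MeasurableSpace Ω] where
  A : Fin N → Matrix (Fin d) (Fin d) ℝ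
  B : Fin N → Matrix (Fin d) (Fin k) ℝ
  Q : Fin N → Matrix (Fin d) (Fin d) ℝ
  R : Fin N → Matrix (Fin k) (Fin k) ℝ
  p : Matrix (Fin N) (Fin N) ℝ
  π : Fin N → ℝ
  Pr : Measure Ω
  ω : ℕ → Ω → Fin N
  x0 : Ω → Fin d → ℝ
  isProbabilityMeasure : IsProbabilityMeasure Pr
  p_nonneg : ∀ i j, 0 ≤ p i j
  p_sum : ∀ i, ∑ j, p i j = 1
  π_sum : ∑ i, π i = 1
  π_pos : ∀ i, 0 < π i
  Q_posDef : ∀ i, (Q i).PosDef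
  R_posDef : ∀ i, (R i).PosDef
  chain : MJLS.IsMarkovChain Pr ω π p
  x0_measurable : Measurable x0
  x0_indep : IndepFun x0 (fun a t => ω t a) Pr
  x0_memLp : ∀ α, MemLp (fun a => x0 a α) 2 Pr
  x0_cov_posDef : (Matrix.of fun α β => ∫ a, x0 a α * x0 a β ∂Pr).PosDef

namespace MJLS

variable {N d k : ℕ} {Ω : Type*} [MeasurableSpace Ω] (M : MJLS N d k Ω) (K : Policy N k d)

/-- `E[x_0 x_0ᵀ]`. -/
def cov0 : Matrix (Fin d) (Fin d) ℝ :=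
  Matrix.of fun α β => ∫ a, M.x0 a α * M.x0 a β ∂M.Pr

/-- The closed-loop matrix `Γ_i = A_i - B_i K_i`. -/
def Γ (i : Fin N) : Matrix (Fin d) (Fin d) ℝ := M.A i - M.B i * K.mat i

/-- The closed-loop trajectory under `u_t = -K_{ω(t)} x_t` from the initial state `x`, along the
sample path `a` of the chain. -/
def state (x : Fin d → ℝ) (a : Ω) : ℕ → Fin d → ℝ
  | 0 => x
  | t + 1 => M.Γ K (M.ω t a) *ᵥ state x a t

/-- The control action `u_t = -K_{ω(t)} x_t`. -/
def control (x : Fin d → ℝ) (a : Ω) (t : ℕ) : Fin k → ℝ :=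
  -(K.mat (M.ω t a) *ᵥ M.state K x a t)

/-- The stage cost `x_tᵀ Q_{ω(t)} x_t + u_tᵀ R_{ω(t)} u_t`. -/
def stageCost (x : Fin d → ℝ) (a : Ω) (t : ℕ) : ℝ :=
  M.state K x a t ⬝ᵥ (M.Q (M.ω t a) *ᵥ M.state K x a t) +
    M.control K x a t ⬝ᵥ (M.R (M.ω t a) *ᵥ M.control K x a t)

/-- The cost `E[∑_t x_tᵀ Q_{ω(t)} x_t + u_tᵀ R_{ω(t)} u_t]`, with values in `[0, ∞]`
(every stage cost is nonnegative). -/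
def extCost : ℝ≥0∞ :=
  ∫⁻ a, ∑' t, ENNReal.ofReal (M.stageCost K (M.x0 a) a t) ∂M.Pr

/-- The real-valued cost `C(K)`. -/
def cost : ℝ := (M.extCost K).toReal

/-- Mean-square stability of the closed loop: for every deterministic initial state `x` and every
initial mode `i`, `E[x_t x_tᵀ] → 0`. Starting the chain in mode `i` is conditioning on
`ω(0) = i`, an event of probability `π i > 0`. -/
def IsMSS : Prop :=
  ∀ (x : Fin d → ℝ) (i : Fin N) (α β : Fin d),
    Tendsto (fun t => ∫ a, M.state K x a t α * M.state K x a t β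
      ∂(ProbabilityTheory.cond M.Pr {a | M.ω 0 a = i})) atTop (𝓝 0)

/-- The set `𝕂` of policies that stabilize the system in the mean-square sense. -/
def stabSet : Set (Policy N k d) := {K | M.IsMSS K}

/-- The sublevel set `𝕂_α`. -/
def sublevel (α : ℝ) : Set (Policy N k d) := {K | K ∈ M.stabSet ∧ M.cost K ≤ α}

/-- `K` is an optimal policy: a minimizer of the cost over `𝕂`. -/
def IsOptimal : Prop := K ∈ M.stabSet ∧ ∀ K' ∈ M.stabSet, M.cost K ≤ M.cost K'

/-- `E_i(V) = ∑_j p_ij V_j`. -/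
def opE (V : Fin N → Matrix (Fin d) (Fin d) ℝ) (i : Fin N) : Matrix (Fin d) (Fin d) ℝ :=
  ∑ j, M.p i j • V j

/-- `P` solves the coupled Lyapunov equations
`P_i = Q_i + K_iᵀ R_i K_i + (A_i - B_i K_i)ᵀ E_i(P) (A_i - B_i K_i)`. -/
def IsLyapunov (P : Fin N → Matrix (Fin d) (Fin d) ℝ) : Prop :=
  ∀ i, P i = M.Q i + (K.mat i)ᵀ * M.R i * K.mat i + (M.Γ K i)ᵀ * M.opE P i * M.Γ K i

/-- `P^K`, the solution of the coupled Lyapunov equations. -/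
def PK : Fin N → Matrix (Fin d) (Fin d) ℝ := Classical.epsilon (M.IsLyapunov K)

/-- `X_i(t) = E[x_t x_tᵀ 1_{ω(t) = i}]`. -/
def corr (t : ℕ) (i : Fin N) : Matrix (Fin d) (Fin d) ℝ :=
  Matrix.of fun α β => ∫ a, {a | M.ω t a = i}.indicator
    (fun a => M.state K (M.x0 a) a t α * M.state K (M.x0 a) a t β) a ∂M.Pr

/-- `𝐗^K = ∑_t X(t)`. -/
def XK (i : Fin N) : Matrix (Fin d) (Fin d) ℝ :=
  Matrix.of fun α β => ∑' t, M.corr K t i α β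

/-- `Ψ = R + Bᵀ E(P^K) B`. -/
def Psi (i : Fin N) : Matrix (Fin k) (Fin k) ℝ :=
  M.R i + (M.B i)ᵀ * M.opE (M.PK K) i * M.B i

/-- `L^K_i = (R_i + B_iᵀ E_i(P^K) B_i) K_i - B_iᵀ E_i(P^K) A_i`. -/
def LK (i : Fin N) : Matrix (Fin k) (Fin d) ℝ :=
  M.Psi K i * K.mat i - (M.B i)ᵀ * M.opE (M.PK K) i * M.A i

/-- `μ = min_i π_i · σ_min(E[x_0 x_0ᵀ])`. -/
def mu : ℝ := (⨅ i, M.π i) * sigmaMin M.cov0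

/-- The constant `ξ` of the sublevel set `𝕂_α`. -/
def xi (α : ℝ) : ℝ :=
  1 / lamMin M.Q * ((1 + normMax M.B ^ 2) / M.mu * α + normMax M.R) - 1

/-- The smoothness constant `L` of the sublevel set `𝕂_α`. The factor `‖B‖² (1 + 2 ξ / ‖B‖)` is
`‖B‖² + 2 ξ ‖B‖`, also when `B = 0`. -/
def smoothConst (α : ℝ) : ℝ :=
  2 * (normMax M.R + normMax M.B ^ 2 * (1 + 2 * M.xi α / normMax M.B) * (α / M.mu)) *
    (α / lamMin M.Q)

end MJLS

end

/-! Write `X(t)` for the tuple of correlations `E[x_t x_tᵀ 1_{ω(t)=i}]`. Independence of `x0` and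
the Markov property give `X(t+1) = opTadj K (X(t))`, where `opTadj K` is linear and preserves
positive semidefiniteness (`IsInitialState.wcorr_succ`, `corr_eq`). Its adjoint `opT K` is the
operator in the Lyapunov equations (`pair_opT`). Mean-square stability means that the powers of
`opTadj K` tend to zero (`isMSS_iff`, `IsMSS.tendsto`). Then `1 - opT K` and `1 - opTadj K` are
invertible, so that `P^K = (1 - opT K)⁻¹ W` and `𝐗^K = (1 - opTadj K)⁻¹ X(0)` with `W` the stage
cost matrices, and the cost is `⟨W, 𝐗^K⟩ = ⟨P^K, X(0)⟩`.

Conversely, finite cost forces stability, because `X(0) ≥ μ` and `W ≥ Q > 0`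
(`isMSS_of_extCost_ne_top`). The partial sums of the cost are continuous in `K`, so sublevel sets
are closed. The stage at time `0` alone costs at least `μ Λ_min(R) ‖K‖²`, so they are bounded.
Compactness, coercivity and existence of a minimizer follow.

Inserting `P^K` into the Lyapunov expression of `K'` leaves a residual quadratic in `K - K'`; paired
with `𝐗^{K'}` it is the exact cost difference (`IsMSS.cost_sub_cost`). Completing the square in it
gives gradient dominance, its first-order part gives the gradient `2 L^K 𝐗^K`, and at an optimum
`L^K = 0` while the quadratic part is positive definite, whence uniqueness.

For the Hessian, the exact difference along a line is expanded to second order. The variation of `𝐗`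
is transferred by duality to the solution `P` of a Lyapunov equation with source `EᵀL + LᵀE`,
formally the derivative of `P^K` in direction `E` (`IsMSS.hessian_quadForm`). That source is bounded
by `ξ Q ≤ ξ W`, so a comparison principle gives `|P| ≤ ξ P^K ≤ ξ α/μ`, which yields the constant
`L`. -/

section LinearAlgebra

/-! ### Quadratic forms, singular values and traces of real matrices. -/

open Matrix

theorem dotProduct_sq_le {n : ℕ} (v w : Fin n → ℝ) : (v ⬝ᵥ w) ^ 2 ≤ (v ⬝ᵥ v) * (w ⬝ᵥ w) := by
  have := Finset.sum_mul_sq_le_sq_mul_sq Finset.univ v w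
  simpa [dotProduct, pow_two] using this

theorem dotProduct_self_nonneg_real {n : ℕ} (v : Fin n → ℝ) : 0 ≤ v ⬝ᵥ v :=
  Finset.sum_nonneg fun i _ => mul_self_nonneg (v i)

theorem dotProduct_self_eq_norm_sq {n : ℕ} (v : Fin n → ℝ) :
    v ⬝ᵥ v = ‖WithLp.toLp 2 v‖ ^ 2 := by
  rw [EuclideanSpace.norm_sq_eq]
  simp [dotProduct, pow_two]

theorem toEuclideanLin_toLp {m n : ℕ} (M : Matrix (Fin m) (Fin n) ℝ) (v : Fin n → ℝ) :
    Matrix.toEuclideanLin M (WithLp.toLp 2 v) = WithLp.toLp 2 (M *ᵥ v) := by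
  simp

theorem mulVec_dot_mulVec_le {m n : ℕ} (M : Matrix (Fin m) (Fin n) ℝ) (v : Fin n → ℝ) :
    (M *ᵥ v) ⬝ᵥ (M *ᵥ v) ≤ MJLS.specNorm M ^ 2 * (v ⬝ᵥ v) := by
  rw [dotProduct_self_eq_norm_sq, dotProduct_self_eq_norm_sq, ← mul_pow]
  gcongr
  have := (Matrix.toEuclideanLin M).toContinuousLinearMap.le_opNorm (WithLp.toLp 2 v)
  simpa [MJLS.specNorm] using this

theorem specNorm_nonneg {m n : ℕ} (M : Matrix (Fin m) (Fin n) ℝ) : 0 ≤ MJLS.specNorm M :=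
  norm_nonneg _

theorem dot_mulVec_le_specNorm {n : ℕ} (M : Matrix (Fin n) (Fin n) ℝ) (v : Fin n → ℝ) :
    v ⬝ᵥ M *ᵥ v ≤ MJLS.specNorm M * (v ⬝ᵥ v) := by
  have h1 := dotProduct_sq_le v (M *ᵥ v)
  have h2 := mulVec_dot_mulVec_le M v
  have h3 := dotProduct_self_nonneg_real v
  refine le_of_sq_le_sq ?_ (mul_nonneg (specNorm_nonneg M) h3)
  nlinarith

theorem specNorm_le_normMax {N m n : ℕ} (V : Fin N → Matrix (Fin m) (Fin n) ℝ) (i : Fin N) :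
    MJLS.specNorm (V i) ≤ MJLS.normMax V :=
  le_ciSup (f := fun i => MJLS.specNorm (V i)) (Set.finite_range _).bddAbove i

theorem normMax_nonneg {N m n : ℕ} (V : Fin N → Matrix (Fin m) (Fin n) ℝ) :
    0 ≤ MJLS.normMax V :=
  Real.iSup_nonneg fun _ => specNorm_nonneg _

theorem mulVec_dot_mulVec_le_normMax {N m n : ℕ} (V : Fin N → Matrix (Fin m) (Fin n) ℝ)
    (i : Fin N) (v : Fin n → ℝ) :
    (V i *ᵥ v) ⬝ᵥ (V i *ᵥ v) ≤ MJLS.normMax V ^ 2 * (v ⬝ᵥ v) := by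
  refine (mulVec_dot_mulVec_le (V i) v).trans ?_
  have := specNorm_nonneg (V i)
  have := specNorm_le_normMax V i
  have := dotProduct_self_nonneg_real v
  gcongr

theorem dot_mulVec_le_normMax {N n : ℕ} (V : Fin N → Matrix (Fin n) (Fin n) ℝ) (i : Fin N)
    (v : Fin n → ℝ) : v ⬝ᵥ V i *ᵥ v ≤ MJLS.normMax V * (v ⬝ᵥ v) :=
  (dot_mulVec_le_specNorm (V i) v).trans <|
    mul_le_mul_of_nonneg_right (specNorm_le_normMax V i) (dotProduct_self_nonneg_real v)

/-- Expand `v` in an orthonormal eigenbasis of `TᵀT`, whose eigenvalues are the squared singular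
values. -/
theorem sigmaMin_sq_mul_le {n : ℕ} (M : Matrix (Fin n) (Fin n) ℝ) (v : Fin n → ℝ) :
    MJLS.sigmaMin M ^ 2 * (v ⬝ᵥ v) ≤ (M *ᵥ v) ⬝ᵥ (M *ᵥ v) := by
  set T := Matrix.toEuclideanLin M with hT
  have hn : Module.finrank ℝ (EuclideanSpace ℝ (Fin n)) = n := by simp
  set x : EuclideanSpace ℝ (Fin n) := WithLp.toLp 2 v
  have hS := T.isSymmetric_adjoint_comp_self
  let b := hS.eigenvectorBasis hn
  have e1 : (M *ᵥ v) ⬝ᵥ (M *ᵥ v) = inner ℝ x ((LinearMap.adjoint T ∘ₗ T) x) := by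
    rw [LinearMap.comp_apply, LinearMap.adjoint_inner_right, real_inner_self_eq_norm_sq,
      dotProduct_self_eq_norm_sq, hT, toEuclideanLin_toLp]
  rw [e1, ← b.sum_inner_mul_inner x, dotProduct_self_eq_norm_sq, ← real_inner_self_eq_norm_sq,
    ← b.sum_inner_mul_inner x x, Finset.mul_sum]
  refine Finset.sum_le_sum fun j _ => ?_
  have e2 : inner ℝ (b j) ((LinearMap.adjoint T ∘ₗ T) x)
      = T.singularValues j ^ 2 * inner ℝ (b j) x := by
    rw [T.sq_singularValues_fin hn, ← hS (b j) x, hS.apply_eigenvectorBasis hn j]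
    simp [inner_smul_left, b]
  rw [e2]
  have e3 : MJLS.sigmaMin M ≤ T.singularValues j :=
    ciInf_le (f := fun j : Fin n => T.singularValues (j : ℕ)) (Set.finite_range _).bddBelow j
  have e4 : 0 ≤ MJLS.sigmaMin M := Real.iInf_nonneg fun j => T.singularValues_nonneg j
  have e5 : inner ℝ x (b j) = inner ℝ (b j) x := real_inner_comm _ _
  rw [e5]
  have := mul_self_nonneg (inner ℝ (b j) x)
  have : MJLS.sigmaMin M ^ 2 ≤ T.singularValues j ^ 2 := by gcongr
  nlinarith

theorem sigmaMin_nonneg {n : ℕ} (M : Matrix (Fin n) (Fin n) ℝ) : 0 ≤ MJLS.sigmaMin M :=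
  Real.iInf_nonneg fun j => LinearMap.singularValues_nonneg _ j

theorem sigmaMin_pos {n : ℕ} [NeZero n] {M : Matrix (Fin n) (Fin n) ℝ} (hM : M.PosDef) :
    0 < MJLS.sigmaMin M := by
  obtain ⟨j, hj⟩ := exists_eq_ciInf_of_finite
    (f := fun j : Fin n => (Matrix.toEuclideanLin M).singularValues (j : ℕ))
  rw [MJLS.sigmaMin, ← hj]
  refine (LinearMap.injective_iff_forall_lt_finrank_singularValues_pos _).1 ?_ j (by simp)
  rw [injective_iff_map_eq_zero]
  intro x hx
  by_contra h
  have := hM.dotProduct_mulVec_pos (x := x.ofLp) (by simpa using h)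
  have h2 : M *ᵥ x.ofLp = 0 := by
    have := congrArg WithLp.ofLp hx
    simpa using this
  simp [h2] at this

/-- On a unit eigenvector with eigenvalue `l ≥ 0` the bound `sigmaMin_sq_mul_le` reads `sigmaMin M ^
2 ≤ l ^ 2`; so every eigenvalue is at least `sigmaMin M`. -/
theorem sigmaMin_mul_le_of_posSemidef {n : ℕ} {M : Matrix (Fin n) (Fin n) ℝ}
    (hM : M.PosSemidef) (v : Fin n → ℝ) :
    MJLS.sigmaMin M * (v ⬝ᵥ v) ≤ v ⬝ᵥ M *ᵥ v := by
  have hn : Module.finrank ℝ (EuclideanSpace ℝ (Fin n)) = n := by simp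
  set T := Matrix.toEuclideanLin M with hT
  have hS : T.IsSymmetric := Matrix.isSymmetric_toEuclideanLin_iff.2 hM.1
  let b := hS.eigenvectorBasis hn
  set x : EuclideanSpace ℝ (Fin n) := WithLp.toLp 2 v with hx
  have e1 : v ⬝ᵥ M *ᵥ v = inner ℝ x (T x) := by
    rw [hT, hx, toEuclideanLin_toLp, EuclideanSpace.inner_toLp_toLp]
    simp [dotProduct_comm]
  rw [e1, ← b.sum_inner_mul_inner x, dotProduct_self_eq_norm_sq, ← real_inner_self_eq_norm_sq,
    ← b.sum_inner_mul_inner x x, Finset.mul_sum]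
  refine Finset.sum_le_sum fun j _ => ?_
  set l := hS.eigenvalues hn j
  have hb : T (b j) = l • b j := hS.apply_eigenvectorBasis hn j
  have hvec : M *ᵥ (b j).ofLp = l • (b j).ofLp := by
    have := congrArg WithLp.ofLp hb
    simpa [hT] using this
  have hone : (b j).ofLp ⬝ᵥ (b j).ofLp = 1 := by
    rw [dotProduct_self_eq_norm_sq]; simp
  have hl0 : 0 ≤ l := by
    have := hM.dotProduct_mulVec_nonneg (b j).ofLp
    simpa [hvec, hone] using this
  have hl : MJLS.sigmaMin M ≤ l := by
    have := sigmaMin_sq_mul_le M (b j).ofLp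
    rw [hvec, smul_dotProduct, dotProduct_smul, hone] at this
    refine le_of_sq_le_sq ?_ hl0
    simpa [pow_two] using this
  have e2 : inner ℝ (b j) (T x) = l * inner ℝ (b j) x := by
    rw [← hS (b j) x, hb]; simp [inner_smul_left]
  have e5 : inner ℝ x (b j) = inner ℝ (b j) x := real_inner_comm _ _
  rw [e2, e5]
  nlinarith [mul_self_nonneg (inner ℝ (b j) x)]

theorem lamMin_mul_le {N n : ℕ} {V : Fin N → Matrix (Fin n) (Fin n) ℝ}
    (hV : ∀ i, (V i).PosDef) (i : Fin N) (v : Fin n → ℝ) :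
    MJLS.lamMin V * (v ⬝ᵥ v) ≤ v ⬝ᵥ V i *ᵥ v := by
  refine le_trans ?_ (sigmaMin_mul_le_of_posSemidef (hV i).posSemidef v)
  refine mul_le_mul_of_nonneg_right ?_ (dotProduct_self_nonneg_real v)
  exact ciInf_le (f := fun i => MJLS.sigmaMin (V i)) (Set.finite_range _).bddBelow i

theorem lamMin_pos {N n : ℕ} [NeZero N] [NeZero n] {V : Fin N → Matrix (Fin n) (Fin n) ℝ}
    (hV : ∀ i, (V i).PosDef) : 0 < MJLS.lamMin V := by
  obtain ⟨j, hj⟩ := exists_eq_ciInf_of_finite (f := fun i => MJLS.sigmaMin (V i))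
  rw [MJLS.lamMin, ← hj]
  exact sigmaMin_pos (hV j)

/-- The trace of a product with a positive semidefinite matrix only sees the quadratic form. -/
theorem trace_mul_nonneg_of_posSemidef {n : ℕ} {H X : Matrix (Fin n) (Fin n) ℝ}
    (hH : ∀ v, 0 ≤ v ⬝ᵥ H *ᵥ v) (hX : X.PosSemidef) : 0 ≤ (H * X).trace := by
  obtain ⟨C, rfl⟩ : ∃ C : Matrix (Fin n) (Fin n) ℝ, X = Cᴴ * C := by
    open scoped MatrixOrder in
    exact CStarAlgebra.nonneg_iff_eq_star_mul_self.1 hX.nonneg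
  -- With `X = Cᴴ C` the trace becomes that of `C H Cᴴ`, whose diagonal entries are values of the
  -- form `H` at the rows of `C`. Symmetry of `H` plays no role.
  rw [← mul_assoc, trace_mul_comm, ← mul_assoc]
  refine Finset.sum_nonneg fun j _ => ?_
  have := hH (C j)
  rw [dotProduct_mulVec] at this
  exact this

theorem trace_mul_le_trace_mul {n : ℕ} {G H X : Matrix (Fin n) (Fin n) ℝ}
    (h : ∀ v, v ⬝ᵥ G *ᵥ v ≤ v ⬝ᵥ H *ᵥ v) (hX : X.PosSemidef) :
    (G * X).trace ≤ (H * X).trace := by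
  have := trace_mul_nonneg_of_posSemidef (H := H - G) (X := X)
    (fun v => by rw [sub_mulVec, dotProduct_sub]; linarith [h v]) hX
  rw [sub_mul, trace_sub] at this
  linarith

/-- Cauchy–Schwarz says `v vᵀ ≤ (v ⬝ᵥ v) • 1` as forms; pair this with `X`. -/
theorem dot_mulVec_le_trace {n : ℕ} {X : Matrix (Fin n) (Fin n) ℝ} (hX : X.PosSemidef)
    (v : Fin n → ℝ) : v ⬝ᵥ X *ᵥ v ≤ X.trace * (v ⬝ᵥ v) := by
  have h := trace_mul_le_trace_mul (G := vecMulVec v v) (H := (v ⬝ᵥ v) • 1) (X := X)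
    (fun w => by
      have := dotProduct_sq_le v w
      simp only [vecMulVec_mulVec, smul_mulVec, one_mulVec, dotProduct_smul, smul_eq_mul,
        MulOpposite.smul_eq_mul_unop, MulOpposite.unop_op]
      rw [dotProduct_comm w v]
      nlinarith) hX
  rw [smul_mul_assoc, one_mul, trace_smul, smul_eq_mul, vecMulVec_mul, trace_vecMulVec,
    dotProduct_comm v (v ᵥ* X), ← dotProduct_mulVec] at h
  linarith

theorem abs_apply_le_trace {n : ℕ} {X : Matrix (Fin n) (Fin n) ℝ} (hX : X.PosSemidef)
    (α β : Fin n) : |X α β| ≤ X.trace := by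
  have hd : ∀ a, 0 ≤ X a a := fun a => hX.diag_nonneg
  have ht : ∀ a, X a a ≤ X.trace := fun a =>
    Finset.single_le_sum (f := fun a => X a a) (fun a _ => hd a) (Finset.mem_univ a)
  have hs : X β α = X α β := by simpa using hX.1.apply α β
  -- The form at `e_α + s e_β`; the values `s = ±1` bound `|X α β|` by the mean of `X α α` and `X β
  -- β`.
  have q : ∀ s : ℝ, 0 ≤ X α α + 2 * s * X α β + s ^ 2 * X β β := by
    intro s
    have := hX.dotProduct_mulVec_nonneg (Pi.single α 1 + s • Pi.single β 1)
    simp only [star_trivial, mulVec_add, mulVec_smul, dotProduct_add, add_dotProduct,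
      smul_dotProduct, dotProduct_smul, mulVec_single_one, single_one_dotProduct, smul_eq_mul,
      col_apply, hs] at this
    linarith
  have h1 := q 1
  have h2 := q (-1)
  have := ht α
  have := ht β
  rw [abs_le]
  constructor <;> linarith

/-- A symmetric matrix whose quadratic form is bounded by `c` is bounded by `c` as a bilinear
form. -/
theorem abs_dot_mulVec_le_of_symm {n : ℕ} {H : Matrix (Fin n) (Fin n) ℝ} (hH : Hᵀ = H) {c : ℝ}
    (hc : ∀ v, |v ⬝ᵥ H *ᵥ v| ≤ c * (v ⬝ᵥ v)) (u w : Fin n → ℝ) :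
    |u ⬝ᵥ H *ᵥ w| ≤ c * (u ⬝ᵥ u + w ⬝ᵥ w) / 2 := by
  have hs : w ⬝ᵥ H *ᵥ u = u ⬝ᵥ H *ᵥ w := by
    rw [dotProduct_mulVec, ← mulVec_transpose, hH, dotProduct_comm]
  -- Polarization: `4 u ⬝ᵥ H w` is the difference of the form at `u + w` and at `u - w`.
  have h1 := abs_le.1 (hc (u + w))
  have h2 := abs_le.1 (hc (u - w))
  simp only [mulVec_add, mulVec_sub, dotProduct_add, dotProduct_sub, add_dotProduct,
    sub_dotProduct, hs, dotProduct_comm w u] at h1 h2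
  rw [abs_le]
  constructor <;> linarith

theorem transpose_mul_mul_quadForm {m n : ℕ} (E : Matrix (Fin m) (Fin n) ℝ)
    (H : Matrix (Fin m) (Fin m) ℝ) (v : Fin n → ℝ) :
    v ⬝ᵥ (Eᵀ * H * E) *ᵥ v = (E *ᵥ v) ⬝ᵥ H *ᵥ (E *ᵥ v) := by
  rw [← mulVec_mulVec, ← mulVec_mulVec, dotProduct_mulVec, vecMul_transpose]

theorem posSemidef_of_quadForm {n : ℕ} {H : Matrix (Fin n) (Fin n) ℝ} (hH : Hᵀ = H)
    (h : ∀ v, 0 ≤ v ⬝ᵥ H *ᵥ v) : H.PosSemidef :=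
  .of_dotProduct_mulVec_nonneg (by simpa [IsHermitian] using hH) (by simpa using h)

theorem Matrix.PosSemidef.quadForm_nonneg {n : ℕ} {H : Matrix (Fin n) (Fin n) ℝ}
    (h : H.PosSemidef) (v : Fin n → ℝ) : 0 ≤ v ⬝ᵥ H *ᵥ v := by
  simpa using h.dotProduct_mulVec_nonneg v

theorem Matrix.PosSemidef.transpose_eq {n : ℕ} {H : Matrix (Fin n) (Fin n) ℝ}
    (h : H.PosSemidef) : Hᵀ = H := by
  simpa [IsHermitian] using h.1

theorem dot_vecMulVec_mulVec {n : ℕ} (x v : Fin n → ℝ) :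
    v ⬝ᵥ vecMulVec x x *ᵥ v = (x ⬝ᵥ v) ^ 2 := by
  simp only [vecMulVec_mulVec, dotProduct_smul, MulOpposite.smul_eq_mul_unop,
    MulOpposite.unop_op, dotProduct_comm v x]
  ring

theorem posSemidef_vecMulVec {n : ℕ} (x : Fin n → ℝ) : (vecMulVec x x).PosSemidef :=
  posSemidef_of_quadForm (by ext a b; simp [vecMulVec_apply, mul_comm])
    fun v => by rw [dot_vecMulVec_mulVec]; positivity

theorem trace_mul_vecMulVec {n : ℕ} (H : Matrix (Fin n) (Fin n) ℝ) (x : Fin n → ℝ) :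
    (H * vecMulVec x x).trace = x ⬝ᵥ H *ᵥ x := by
  rw [mul_vecMulVec, trace_vecMulVec, dotProduct_comm]

end LinearAlgebra

noncomputable section

namespace MJLS

open Matrix

/-! ### Functionals of finitely many steps of a Markov chain. -/

section Chain

variable {N : ℕ} {Ω : Type*} {ω : ℕ → Ω → Fin N}

/-- A function of sample paths of a chain that depends only on the times up to `t`. -/
def DependsUpTo (t : ℕ) (h : (ℕ → Fin N) → ℝ) : Prop :=
  ∀ w w' : ℕ → Fin N, (∀ s ≤ t, w s = w' s) → h w = h w'

/-- The path that follows `v` up to time `t` and stays constant afterwards. -/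
def constPathAfter (t : ℕ) (v : Fin (t + 1) → Fin N) (s : ℕ) : Fin N :=
  v ⟨min s t, by omega⟩

/-- The event that the chain follows the path `w` up to time `t`. -/
def pathEvent (ω : ℕ → Ω → Fin N) (t : ℕ) (w : ℕ → Fin N) : Set Ω :=
  {a | ∀ s ≤ t, ω s a = w s}

/-- There are finitely many paths up to time `t`, and exactly one of their events contains the
sample `a`. This reduces measurability, integrability and the Markov property to indicators of path
events. -/
theorem DependsUpTo.eq_sum {t : ℕ} {h : (ℕ → Fin N) → ℝ} (hh : DependsUpTo t h) (a : Ω) :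
    h (fun s => ω s a) =
      ∑ v, h (constPathAfter t v) * (pathEvent ω t (constPathAfter t v)).indicator 1 a := by
  rw [Finset.sum_eq_single (fun s : Fin (t + 1) => ω s a)]
  · have hm : ∀ s ≤ t, ω s a = constPathAfter t (fun s : Fin (t + 1) => ω s a) s := by
      intro s hs
      simp [constPathAfter, min_eq_left hs]
    rw [Set.indicator_of_mem (show a ∈ pathEvent ω t _ from hm), Pi.one_apply, mul_one]
    exact hh _ _ hm
  · intro v _ hv
    rw [Set.indicator_of_notMem, mul_zero]
    intro hm
    apply hv
    ext s
    have := hm s (by omega)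
    rw [this]
    simp only [constPathAfter]
    congr 3
    ext
    simp only
    omega
  · simp

variable [MeasurableSpace Ω] {Pr : Measure Ω} {π : Fin N → ℝ} {p : Matrix (Fin N) (Fin N) ℝ}

theorem measurableSet_pathEvent (hω : ∀ t, Measurable (ω t)) (t : ℕ) (w : ℕ → Fin N) :
    MeasurableSet (pathEvent ω t w) := by
  have : pathEvent ω t w = ⋂ s, ⋂ _ : s ≤ t, ω s ⁻¹' {w s} := by
    ext a; simp [pathEvent]
  rw [this]
  exact .iInter fun s => .iInter fun _ => hω s (measurableSet_singleton _)

theorem DependsUpTo.integrable [IsFiniteMeasure Pr] (hω : ∀ t, Measurable (ω t)) {t : ℕ}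
    {h : (ℕ → Fin N) → ℝ} (hh : DependsUpTo t h) :
    Integrable (fun a => h (fun s => ω s a)) Pr := by
  simp_rw [hh.eq_sum]
  refine integrable_finsetSum _ fun v _ => Integrable.const_mul ?_ _
  exact (integrable_const (1 : ℝ)).indicator (measurableSet_pathEvent hω t _)

/-- The Markov property for path events, extended by linearity to all functions of the past. -/
theorem IsMarkovChain.integral_step [IsFiniteMeasure Pr] (hc : IsMarkovChain Pr ω π p) {t : ℕ}
    {h : (ℕ → Fin N) → ℝ} (hh : DependsUpTo t h) (j : Fin N) :
    ∫ a, h (fun s => ω s a) * (if ω (t + 1) a = j then 1 else 0) ∂Pr =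
      ∫ a, h (fun s => ω s a) * p (ω t a) j ∂Pr := by
  -- A path event together with the next mode is a path event one step longer, the kind of event
  -- that `step` evaluates.
  have hset : ∀ v, pathEvent ω t (constPathAfter t v) ∩ {a | ω (t + 1) a = j} =
      pathEvent ω (t + 1) (Function.update (constPathAfter t v) (t + 1) j) := by
    intro v
    ext a
    simp only [pathEvent, Set.mem_inter_iff, Set.mem_ofPred_eq]
    constructor
    · rintro ⟨h1, h2⟩ s hs
      rcases Nat.lt_or_ge t s with hts | hts
      · obtain rfl : s = t + 1 := by omega
        simpa using h2
      · rw [Function.update_of_ne (by omega)]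
        exact h1 s hts
    · intro h1
      refine ⟨fun s hs => ?_, by simpa using h1 (t + 1) le_rfl⟩
      have := h1 s (by omega)
      rwa [Function.update_of_ne (by omega)] at this
  have e1 : ∀ a, h (fun s => ω s a) * (if ω (t + 1) a = j then 1 else 0) =
      ∑ v, h (constPathAfter t v) * (pathEvent ω (t + 1)
        (Function.update (constPathAfter t v) (t + 1) j)).indicator 1 a := by
    intro a
    rw [hh.eq_sum, Finset.sum_mul]
    refine Finset.sum_congr rfl fun v _ => ?_
    rw [← hset, Set.inter_indicator_one, Pi.mul_apply, mul_assoc]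
    simp [Set.indicator]
  have e2 : ∀ a, h (fun s => ω s a) * p (ω t a) j =
      ∑ v, h (constPathAfter t v) * p (constPathAfter t v t) j *
        (pathEvent ω t (constPathAfter t v)).indicator 1 a := by
    intro a
    exact DependsUpTo.eq_sum (h := fun w => h w * p (w t) j)
      (fun w w' hw => by dsimp only; rw [hh w w' hw, hw t le_rfl]) a
  simp_rw [e1, e2]
  have hm := hc.measurable
  rw [integral_finsetSum, integral_finsetSum]
  · refine Finset.sum_congr rfl fun v _ => ?_
    rw [integral_const_mul, integral_const_mul,
      integral_indicator_one (measurableSet_pathEvent hm _ _),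
      integral_indicator_one (measurableSet_pathEvent hm _ _)]
    have := hc.step t (Function.update (constPathAfter t v) (t + 1) j)
    rw [Function.update_self, Function.update_of_ne (by omega)] at this
    have e3 : {a | ∀ s ≤ t, ω s a = Function.update (constPathAfter t v) (t + 1) j s} =
        pathEvent ω t (constPathAfter t v) := by
      ext a
      refine forall₂_congr fun s hs => ?_
      rw [Function.update_of_ne (by omega)]
    rw [e3] at this
    rw [pathEvent, this]
    ring
  · exact fun v _ => ((integrable_const (1 : ℝ)).indicator
      (measurableSet_pathEvent hm _ _)).const_mul _
  · exact fun v _ => ((integrable_const (1 : ℝ)).indicator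
      (measurableSet_pathEvent hm _ _)).const_mul _

theorem DependsUpTo.measurable {t : ℕ} {h : (ℕ → Fin N) → ℝ} (hh : DependsUpTo t h) :
    Measurable h := by
  have : h = fun w => ∑ v, h (constPathAfter t v) *
      (pathEvent (fun s (w : ℕ → Fin N) => w s) t (constPathAfter t v)).indicator 1 w :=
    funext fun w => DependsUpTo.eq_sum (ω := fun s (w : ℕ → Fin N) => w s) hh w
  rw [this]
  refine Finset.measurable_sum _ fun v _ => Measurable.const_mul ?_ _
  exact measurable_one.indicator (measurableSet_pathEvent (fun t => measurable_pi_apply t) t _)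

theorem DependsUpTo.mul {t : ℕ} {f g : (ℕ → Fin N) → ℝ} (hf : DependsUpTo t f)
    (hg : DependsUpTo t g) : DependsUpTo t fun w => f w * g w :=
  fun w w' h => by dsimp only; rw [hf w w' h, hg w w' h]

theorem DependsUpTo.of_apply {t s : ℕ} (hs : s ≤ t) (f : Fin N → ℝ) :
    DependsUpTo t fun w => f (w s) :=
  fun w w' h => by dsimp only; rw [h s hs]

end Chain

/-! ### Propagation of the correlations and the series for the cost. -/

section Correlation

variable {N d k : ℕ} {Ω : Type*} [MeasurableSpace Ω] (M : MJLS N d k Ω) (K : Policy N k d)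

/-- The transition matrix of the closed loop from time `0` to time `t` along the path `w`. -/
def trans (w : ℕ → Fin N) : ℕ → Matrix (Fin d) (Fin d) ℝ
  | 0 => 1
  | t + 1 => M.Γ K (w t) * trans w t

theorem state_eq_trans (x : Fin d → ℝ) (a : Ω) (t : ℕ) :
    M.state K x a t = M.trans K (fun s => M.ω s a) t *ᵥ x := by
  induction t with
  | zero => simp [state, trans]
  | succ t ih => rw [state, trans, ih, mulVec_mulVec]

theorem trans_congr {w w' : ℕ → Fin N} {t : ℕ} (h : ∀ s < t, w s = w' s) :
    M.trans K w t = M.trans K w' t := by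
  induction t with
  | zero => rfl
  | succ t ih => rw [trans, trans, ih fun s hs => h s (by omega), h t (by omega)]

theorem dependsUpTo_trans (t : ℕ) (α γ : Fin d) :
    DependsUpTo t fun w => M.trans K w t α γ :=
  fun w w' h => by
    dsimp only
    rw [M.trans_congr K (w := w) (w' := w') fun s hs => h s (by omega)]

/-- The state at time `t + 1` involves the modes only up to time `t`. This lets the Markov property
be applied to the mode at `t + 1`. -/
theorem dependsUpTo_trans_succ (t : ℕ) (α γ : Fin d) :
    DependsUpTo t fun w => M.trans K w (t + 1) α γ :=
  fun w w' h => by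
    dsimp only
    rw [M.trans_congr K (w := w) (w' := w') fun s hs => h s (by omega)]

/-- A random initial state that is independent of the chain and has finite second moments. -/
structure IsInitialState (z : Ω → Fin d → ℝ) : Prop where
  measurable : Measurable z
  indep : IndepFun z (fun a t => M.ω t a) M.Pr
  memLp : ∀ α, MemLp (fun a => z a α) 2 M.Pr

theorem isInitialState_x0 : M.IsInitialState M.x0 :=
  ⟨M.x0_measurable, M.x0_indep, M.x0_memLp⟩

theorem isInitialState_const (x : Fin d → ℝ) : M.IsInitialState fun _ => x :=
  have := M.isProbabilityMeasure
  ⟨measurable_const, indepFun_const_left _ _, fun α => memLp_const (x α)⟩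

variable {M} {z : Ω → Fin d → ℝ}

theorem IsInitialState.integrable_mul (hz : M.IsInitialState z) (γ δ : Fin d) :
    Integrable (fun a => z a γ * z a δ) M.Pr :=
  (hz.memLp γ).integrable_mul (hz.memLp δ)

theorem IsInitialState.indepFun (hz : M.IsInitialState z) {t : ℕ} {h : (ℕ → Fin N) → ℝ}
    (hh : DependsUpTo t h) (γ δ : Fin d) :
    IndepFun (fun a => h (fun s => M.ω s a)) (fun a => z a γ * z a δ) M.Pr :=
  hz.indep.symm.comp (φ := h) (ψ := fun x : Fin d → ℝ => x γ * x δ) hh.measurable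
    ((measurable_pi_apply γ).mul (measurable_pi_apply δ))

theorem IsInitialState.integrable (hz : M.IsInitialState z) {t : ℕ} {h : (ℕ → Fin N) → ℝ}
    (hh : DependsUpTo t h) (γ δ : Fin d) :
    Integrable (fun a => h (fun s => M.ω s a) * (z a γ * z a δ)) M.Pr :=
  have := M.isProbabilityMeasure
  (hz.indepFun hh γ δ).integrable_mul (hh.integrable M.chain.measurable) (hz.integrable_mul γ δ)

theorem IsInitialState.integral_mul (hz : M.IsInitialState z) {t : ℕ} {h : (ℕ → Fin N) → ℝ}
    (hh : DependsUpTo t h) (γ δ : Fin d) :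
    ∫ a, h (fun s => M.ω s a) * (z a γ * z a δ) ∂M.Pr =
      (∫ a, h (fun s => M.ω s a) ∂M.Pr) * ∫ a, z a γ * z a δ ∂M.Pr :=
  have := M.isProbabilityMeasure
  (hz.indepFun hh γ δ).integral_mul_eq_mul_integral
    (hh.integrable M.chain.measurable).aestronglyMeasurable
    (hz.integrable_mul γ δ).aestronglyMeasurable

/-- Separates the factors that depend on the chain from those that depend on the initial state, so
that independence applies. -/
theorem state_mul_state (x : Fin d → ℝ) (a : Ω) (t : ℕ) (α β : Fin d) :
    M.state K x a t α * M.state K x a t β = ∑ γ, ∑ δ,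
      M.trans K (fun s => M.ω s a) t α γ * M.trans K (fun s => M.ω s a) t β δ *
        (x γ * x δ) := by
  rw [state_eq_trans, mulVec, mulVec, dotProduct, dotProduct, Finset.sum_mul_sum]
  exact Finset.sum_congr rfl fun γ _ => Finset.sum_congr rfl fun δ _ => by ring

theorem IsInitialState.integrable_state (hz : M.IsInitialState z) {t : ℕ}
    {h : (ℕ → Fin N) → ℝ} (hh : DependsUpTo t h) (α β : Fin d) :
    Integrable (fun a => h (fun s => M.ω s a) *
      (M.state K (z a) a t α * M.state K (z a) a t β)) M.Pr := by
  simp_rw [state_mul_state, Finset.mul_sum]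
  refine integrable_finsetSum _ fun γ _ => integrable_finsetSum _ fun δ _ => ?_
  refine (hz.integrable (hh.mul ((M.dependsUpTo_trans K t α γ).mul
    (M.dependsUpTo_trans K t β δ))) γ δ).congr (.of_forall fun a => ?_)
  dsimp only; ring

theorem IsInitialState.integral_step (hz : M.IsInitialState z) {t : ℕ} {h : (ℕ → Fin N) → ℝ}
    (hh : DependsUpTo t h) (j : Fin N) (γ δ : Fin d) :
    ∫ a, h (fun s => M.ω s a) * (if M.ω (t + 1) a = j then 1 else 0) * (z a γ * z a δ) ∂M.Pr =
      ∫ a, h (fun s => M.ω s a) * M.p (M.ω t a) j * (z a γ * z a δ) ∂M.Pr := by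
  have := M.isProbabilityMeasure
  have h1 : DependsUpTo (t + 1) fun w : ℕ → Fin N => h w * (if w (t + 1) = j then 1 else 0) :=
    fun w w' hw => by dsimp only; rw [hh w w' fun s hs => hw s (by omega), hw (t + 1) le_rfl]
  have h2 : DependsUpTo t fun w : ℕ → Fin N => h w * M.p (w t) j :=
    hh.mul (.of_apply le_rfl fun i => M.p i j)
  rw [hz.integral_mul h1, hz.integral_mul h2, M.chain.integral_step hh]

variable (M)

/-- `E[c(ω(0)) x_t x_tᵀ 1_{ω(t) = j}]` for the closed-loop trajectory started in `z`. -/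
def wcorr (c : Fin N → ℝ) (z : Ω → Fin d → ℝ) (t : ℕ) (j : Fin N) : Matrix (Fin d) (Fin d) ℝ :=
  of fun α β => ∫ a, c (M.ω 0 a) * (if M.ω t a = j then 1 else 0) *
    (M.state K (z a) a t α * M.state K (z a) a t β) ∂M.Pr

/-- The operator `S ↦ (∑ i, p_ij Γ_i S_i Γ_iᵀ)_j` that propagates the correlations. -/
def opTadj : Module.End ℝ (Fin N → Matrix (Fin d) (Fin d) ℝ) where
  toFun S j := ∑ i, M.p i j • (M.Γ K i * S i * (M.Γ K i)ᵀ)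
  map_add' S S' := by
    ext1 j
    simp [mul_add, add_mul, Finset.sum_add_distrib]
  map_smul' c S := by
    ext1 j
    simp [Finset.smul_sum, smul_comm c]

theorem opTadj_apply (S : Fin N → Matrix (Fin d) (Fin d) ℝ) (j : Fin N) :
    M.opTadj K S j = ∑ i, M.p i j • (M.Γ K i * S i * (M.Γ K i)ᵀ) := rfl

variable {M}

theorem IsInitialState.wcorr_zero (hz : M.IsInitialState z) (c : Fin N → ℝ) (j : Fin N) :
    M.wcorr K c z 0 j = (c j * M.π j) • of fun α β => ∫ a, z a α * z a β ∂M.Pr := by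
  have := M.isProbabilityMeasure
  ext α β
  have h1 : DependsUpTo 0 fun w : ℕ → Fin N => c (w 0) * (if w 0 = j then 1 else 0) :=
    .of_apply le_rfl fun i => c i * (if i = j then 1 else 0)
  have := hz.integral_mul h1 α β
  simp only [wcorr, of_apply, state, Matrix.smul_apply, smul_eq_mul]
  rw [this]
  congr 1
  have e : ∀ a, c (M.ω 0 a) * (if M.ω 0 a = j then 1 else 0) =
      c j * {a | M.ω 0 a = j}.indicator 1 a := by
    intro a
    by_cases h : M.ω 0 a = j <;> simp [h]
  simp_rw [e]
  have hm : MeasurableSet {a | M.ω 0 a = j} := M.chain.measurable 0 (measurableSet_singleton j)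
  rw [integral_const_mul, integral_indicator_one hm, M.chain.initial]

/-- Since `x_{t+1}` is determined by the initial state and the modes up to `t`, the indicator of
`ω(t+1) = j` may be replaced by `p (ω t) j`; splitting according to the value of `ω t` then produces
the operator. -/
theorem IsInitialState.wcorr_succ (hz : M.IsInitialState z) (c : Fin N → ℝ) (t : ℕ) :
    M.wcorr K c z (t + 1) = M.opTadj K (M.wcorr K c z t) := by
  ext j α β
  have hdep : ∀ γ δ, DependsUpTo t fun w : ℕ → Fin N =>
      c (w 0) * (M.trans K w (t + 1) α γ * M.trans K w (t + 1) β δ) := fun γ δ =>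
    (DependsUpTo.of_apply (Nat.zero_le t) c).mul
      ((M.dependsUpTo_trans_succ K t α γ).mul (M.dependsUpTo_trans_succ K t β δ))
  have hind : DependsUpTo (t + 1) fun w : ℕ → Fin N => if w (t + 1) = j then (1 : ℝ) else 0 :=
    .of_apply le_rfl fun i => if i = j then (1 : ℝ) else 0
  have hmono : ∀ {h : (ℕ → Fin N) → ℝ}, DependsUpTo t h → DependsUpTo (t + 1) h :=
    fun hh w w' hw => hh w w' fun s hs => hw s (by omega)
  have e1 : M.wcorr K c z (t + 1) j α β = ∫ a, c (M.ω 0 a) * M.p (M.ω t a) j *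
      (M.state K (z a) a (t + 1) α * M.state K (z a) a (t + 1) β) ∂M.Pr := by
    simp only [wcorr, of_apply, state_mul_state, Finset.mul_sum]
    rw [integral_finsetSum, integral_finsetSum]
    · refine Finset.sum_congr rfl fun γ _ => ?_
      rw [integral_finsetSum, integral_finsetSum]
      · refine Finset.sum_congr rfl fun δ _ => ?_
        have := hz.integral_step (hdep γ δ) j γ δ
        convert this using 3 <;> ring
      · intro δ _
        refine (hz.integrable ((hdep γ δ).mul (.of_apply le_rfl fun i => M.p i j)) γ δ).congr
          (.of_forall fun a => ?_)
        dsimp only; ring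
      · intro δ _
        refine (hz.integrable ((hmono (hdep γ δ)).mul hind) γ δ).congr (.of_forall fun a => ?_)
        dsimp only; ring
    · intro γ _
      refine integrable_finsetSum _ fun δ _ => ?_
      refine (hz.integrable ((hdep γ δ).mul (.of_apply le_rfl fun i => M.p i j)) γ δ).congr
        (.of_forall fun a => ?_)
      dsimp only; ring
    · intro γ _
      refine integrable_finsetSum _ fun δ _ => ?_
      refine (hz.integrable ((hmono (hdep γ δ)).mul hind) γ δ).congr (.of_forall fun a => ?_)
      dsimp only; ring
  have hci : ∀ i, DependsUpTo t fun w : ℕ → Fin N => c (w 0) * (if w t = i then 1 else 0) :=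
    fun i => (DependsUpTo.of_apply (Nat.zero_le t) c).mul
      (.of_apply le_rfl fun l => if l = i then (1 : ℝ) else 0)
  have e2 : ∀ a, c (M.ω 0 a) * M.p (M.ω t a) j *
      (M.state K (z a) a (t + 1) α * M.state K (z a) a (t + 1) β) =
      ∑ i, ∑ γ, ∑ δ, M.p i j * M.Γ K i α γ * M.Γ K i β δ *
        (c (M.ω 0 a) * (if M.ω t a = i then 1 else 0) *
          (M.state K (z a) a t γ * M.state K (z a) a t δ)) := by
    intro a
    rw [Finset.sum_eq_single (M.ω t a)]
    · rw [state, mulVec, mulVec, dotProduct, dotProduct, Finset.sum_mul_sum, Finset.mul_sum]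
      refine Finset.sum_congr rfl fun γ _ => ?_
      rw [Finset.mul_sum]
      refine Finset.sum_congr rfl fun δ _ => ?_
      simp only [if_true]
      ring
    · intro i _ hi
      simp [Ne.symm hi]
    · simp
  have hint : ∀ i γ δ, Integrable (fun a => M.p i j * M.Γ K i α γ * M.Γ K i β δ *
        (c (M.ω 0 a) * (if M.ω t a = i then 1 else 0) *
          (M.state K (z a) a t γ * M.state K (z a) a t δ))) M.Pr := fun i γ δ =>
    (hz.integrable_state K (hci i) γ δ).const_mul _
  rw [e1]
  simp_rw [e2]
  rw [integral_finsetSum _ fun i _ => integrable_finsetSum _ fun γ _ =>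
    integrable_finsetSum _ fun δ _ => hint i γ δ, opTadj_apply, Matrix.sum_apply]
  refine Finset.sum_congr rfl fun i _ => ?_
  rw [integral_finsetSum _ fun γ _ => integrable_finsetSum _ fun δ _ => hint i γ δ]
  simp only [Matrix.smul_apply, smul_eq_mul, mul_apply, transpose_apply, Finset.sum_mul,
    Finset.mul_sum]
  rw [Finset.sum_comm (γ := Fin d)]
  refine Finset.sum_congr rfl fun γ _ => ?_
  rw [integral_finsetSum _ fun δ _ => hint i γ δ]
  refine Finset.sum_congr rfl fun δ _ => ?_
  rw [integral_const_mul, wcorr, of_apply]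
  ring

/-- The weight `c = 1` yields the correlations started from `x0`. The weight `Pi.single i 1` with a
constant `z` yields `π i` times the correlations conditioned on `ω 0 = i`. -/
theorem IsInitialState.wcorr_eq (hz : M.IsInitialState z) (c : Fin N → ℝ) (t : ℕ) :
    M.wcorr K c z t = (M.opTadj K ^ t)
      fun j => (c j * M.π j) • of fun α β => ∫ a, z a α * z a β ∂M.Pr := by
  induction t with
  | zero => exact funext fun j => hz.wcorr_zero K c j
  | succ t ih => rw [hz.wcorr_succ, ih, pow_succ', Module.End.mul_apply]

variable (M)

/-- `X(0) = (π_i E[x_0 x_0ᵀ])_i`. -/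
def X0 (i : Fin N) : Matrix (Fin d) (Fin d) ℝ := M.π i • M.cov0

theorem corr_eq (t : ℕ) : M.corr K t = (M.opTadj K ^ t) M.X0 := by
  have h := M.isInitialState_x0.wcorr_eq K 1 t
  simp only [Pi.one_apply, one_mul] at h
  rw [show M.X0 = fun j => M.π j • of fun α β => ∫ a, M.x0 a α * M.x0 a β ∂M.Pr from rfl, ← h]
  ext i α β
  simp only [corr, wcorr, of_apply, Pi.one_apply, one_mul]
  refine integral_congr_ae (.of_forall fun a => ?_)
  by_cases h : M.ω t a = i <;> simp [h]

theorem isMSS_iff : M.IsMSS K ↔ ∀ (x : Fin d → ℝ) (i : Fin N) (α β : Fin d),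
    Tendsto (fun t => ∑ j, (M.opTadj K ^ t) (Pi.single i (vecMulVec x x)) j α β) atTop (𝓝 0) := by
  have hP := M.isProbabilityMeasure
  have key : ∀ x i α β t, ∫ a, M.state K x a t α * M.state K x a t β
      ∂(ProbabilityTheory.cond M.Pr {a | M.ω 0 a = i}) =
        ∑ j, (M.opTadj K ^ t) (Pi.single i (vecMulVec x x)) j α β := by
    intro x i α β t
    have hm : MeasurableSet {a | M.ω 0 a = i} :=
      M.chain.measurable 0 (measurableSet_singleton i)
    have h := (M.isInitialState_const x).wcorr_eq K (Pi.single i 1) t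
    have e : (fun j => ((Pi.single i 1 : Fin N → ℝ) j * M.π j) • of fun α β =>
        ∫ _, x α * x β ∂M.Pr) = M.π i • Pi.single i (vecMulVec x x) := by
      ext j α β
      by_cases hj : j = i
      · subst hj; simp [vecMulVec_apply]
      · simp [hj]
    rw [e, map_smul] at h
    have h2 : ∀ j, ∫ a, (Pi.single i 1 : Fin N → ℝ) (M.ω 0 a) *
        (if M.ω t a = j then 1 else 0) * (M.state K x a t α * M.state K x a t β) ∂M.Pr =
        M.π i * (M.opTadj K ^ t) (Pi.single i (vecMulVec x x)) j α β := fun j =>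
      congrFun (congrFun (congrFun h j) α) β
    have h3 : ∀ j, Integrable (fun a => (Pi.single i 1 : Fin N → ℝ) (M.ω 0 a) *
        (if M.ω t a = j then 1 else 0) * (M.state K x a t α * M.state K x a t β)) M.Pr := fun j =>
      (M.isInitialState_const x).integrable_state K
        ((DependsUpTo.of_apply (Nat.zero_le t) (Pi.single i 1)).mul
          (.of_apply le_rfl fun l => if l = j then (1 : ℝ) else 0)) α β
    -- The weight cuts out the event `ω 0 = i`, and the indicators of `ω t = j` add up to one.
    have h4 : ∫ a in {a | M.ω 0 a = i}, M.state K x a t α * M.state K x a t β ∂M.Pr =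
        ∑ j, ∫ a, (Pi.single i 1 : Fin N → ℝ) (M.ω 0 a) *
        (if M.ω t a = j then 1 else 0) * (M.state K x a t α * M.state K x a t β) ∂M.Pr := by
      rw [← integral_finsetSum _ fun j _ => h3 j, ← integral_indicator hm]
      refine integral_congr_ae (.of_forall fun a => ?_)
      dsimp only
      rw [← Finset.sum_mul, ← Finset.mul_sum]
      by_cases ha : M.ω 0 a = i
      · simp [ha]
      · simp [ha]
    rw [ProbabilityTheory.cond, integral_smul_measure, h4]
    simp_rw [h2]
    rw [← Finset.mul_sum, ENNReal.toReal_inv, ← Measure.real, M.chain.initial, smul_eq_mul,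
      ← mul_assoc, inv_mul_cancel₀ (M.π_pos i).ne', one_mul]
  simp_rw [IsMSS, key]

/-- `W_i = Q_i + K_iᵀ R_i K_i`, the matrix of the stage cost in mode `i`. -/
def stageMat (i : Fin N) : Matrix (Fin d) (Fin d) ℝ := M.Q i + (K.mat i)ᵀ * M.R i * K.mat i

/-- The bilinear pairing `∑ i, tr (P i * S i)`. -/
def pair (P S : Fin N → Matrix (Fin d) (Fin d) ℝ) : ℝ := ∑ i, (P i * S i).trace

theorem stageCost_eq (x : Fin d → ℝ) (a : Ω) (t : ℕ) : M.stageCost K x a t =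
    M.state K x a t ⬝ᵥ M.stageMat K (M.ω t a) *ᵥ M.state K x a t := by
  rw [stageCost, control, stageMat, add_mulVec, dotProduct_add, transpose_mul_mul_quadForm]
  simp [mulVec_neg]

theorem Q_le_stageMat (i : Fin N) (v : Fin d → ℝ) :
    v ⬝ᵥ M.Q i *ᵥ v ≤ v ⬝ᵥ M.stageMat K i *ᵥ v := by
  rw [stageMat, add_mulVec, dotProduct_add, transpose_mul_mul_quadForm]
  linarith [(M.R_posDef i).posSemidef.quadForm_nonneg (K.mat i *ᵥ v)]

theorem stageCost_nonneg (x : Fin d → ℝ) (a : Ω) (t : ℕ) : 0 ≤ M.stageCost K x a t := by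
  rw [stageCost_eq]
  exact ((M.Q_posDef _).posSemidef.quadForm_nonneg _).trans (M.Q_le_stageMat K _ _)

theorem stageCost_eq_sum (x : Fin d → ℝ) (a : Ω) (t : ℕ) : M.stageCost K x a t =
    ∑ i, ∑ α, ∑ β, M.stageMat K i α β * ((if M.ω t a = i then 1 else 0) *
      (M.state K x a t α * M.state K x a t β)) := by
  rw [stageCost_eq, Finset.sum_eq_single (M.ω t a)]
  · simp only [dotProduct, mulVec, Finset.mul_sum, if_true]
    exact Finset.sum_congr rfl fun α _ => Finset.sum_congr rfl fun β _ => by ring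
  · intro i _ hi
    simp [Ne.symm hi]
  · simp

theorem integrable_indicator_state (i : Fin N) (t : ℕ) (α β : Fin d) :
    Integrable (fun a => (if M.ω t a = i then 1 else 0) *
      (M.state K (M.x0 a) a t α * M.state K (M.x0 a) a t β)) M.Pr :=
  M.isInitialState_x0.integrable_state K
    (.of_apply le_rfl fun l => if l = i then (1 : ℝ) else 0) α β

theorem integrable_stageCost (t : ℕ) :
    Integrable (fun a => M.stageCost K (M.x0 a) a t) M.Pr := by
  simp_rw [stageCost_eq_sum]
  exact integrable_finsetSum _ fun i _ => integrable_finsetSum _ fun α _ =>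
    integrable_finsetSum _ fun β _ => (M.integrable_indicator_state K i t α β).const_mul _

theorem corr_symm (t : ℕ) (i : Fin N) (α β : Fin d) : M.corr K t i α β = M.corr K t i β α := by
  simp only [corr, of_apply, mul_comm]

theorem integral_stageCost (t : ℕ) :
    ∫ a, M.stageCost K (M.x0 a) a t ∂M.Pr = pair (M.stageMat K) (M.corr K t) := by
  have hint := fun i α β => (M.integrable_indicator_state K i t α β).const_mul
    (M.stageMat K i α β)
  simp_rw [stageCost_eq_sum]
  rw [integral_finsetSum _ fun i _ => integrable_finsetSum _ fun α _ =>
    integrable_finsetSum _ fun β _ => hint i α β, pair]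
  refine Finset.sum_congr rfl fun i _ => ?_
  rw [integral_finsetSum _ fun α _ => integrable_finsetSum _ fun β _ => hint i α β, trace]
  refine Finset.sum_congr rfl fun α _ => ?_
  rw [integral_finsetSum _ fun β _ => hint i α β, diag_apply, mul_apply]
  refine Finset.sum_congr rfl fun β _ => ?_
  rw [integral_const_mul, corr_symm, corr, of_apply]
  congr 1
  refine integral_congr_ae (.of_forall fun a => ?_)
  by_cases h : M.ω t a = i <;> simp [h]

theorem aemeasurable_stageCost (t : ℕ) : AEMeasurable (fun a => M.stageCost K (M.x0 a) a t) M.Pr :=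
  (M.integrable_stageCost K t).aestronglyMeasurable.aemeasurable

/-- Tonelli, as stage costs are nonnegative. The formula is valid without stability, hence serves
also to deduce stability from finite cost. -/
theorem extCost_eq : M.extCost K =
    ∑' t, ENNReal.ofReal (pair (M.stageMat K) ((M.opTadj K ^ t) M.X0)) := by
  rw [extCost, lintegral_tsum fun t => (M.aemeasurable_stageCost K t).ennreal_ofReal]
  refine tsum_congr fun t => ?_
  rw [← ofReal_integral_eq_lintegral_ofReal (M.integrable_stageCost K t)
    (.of_forall fun a => M.stageCost_nonneg K _ a t), integral_stageCost, corr_eq]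

end Correlation

end MJLS

end

noncomputable section

namespace MJLS

open Matrix

/-! ### The Lyapunov operator, its adjoint, and mean-square stability. -/

section Operators

variable {N d k : ℕ} {Ω : Type*} [MeasurableSpace Ω] (M : MJLS N d k Ω) (K : Policy N k d)

theorem pair_nonneg {H S : Fin N → Matrix (Fin d) (Fin d) ℝ}
    (hH : ∀ i v, 0 ≤ v ⬝ᵥ H i *ᵥ v) (hS : ∀ i, (S i).PosSemidef) : 0 ≤ pair H S :=
  Finset.sum_nonneg fun i _ => trace_mul_nonneg_of_posSemidef (hH i) (hS i)

theorem pair_le_pair {G H S : Fin N → Matrix (Fin d) (Fin d) ℝ}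
    (h : ∀ i v, v ⬝ᵥ G i *ᵥ v ≤ v ⬝ᵥ H i *ᵥ v) (hS : ∀ i, (S i).PosSemidef) :
    pair G S ≤ pair H S :=
  Finset.sum_le_sum fun i _ => trace_mul_le_trace_mul (h i) (hS i)

theorem pair_comm (P S : Fin N → Matrix (Fin d) (Fin d) ℝ) : pair P S = pair S P :=
  Finset.sum_congr rfl fun _ _ => trace_mul_comm _ _

theorem pair_add_left (P P' S : Fin N → Matrix (Fin d) (Fin d) ℝ) :
    pair (P + P') S = pair P S + pair P' S := by
  simp [pair, add_mul, Finset.sum_add_distrib]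

theorem pair_sub_left (P P' S : Fin N → Matrix (Fin d) (Fin d) ℝ) :
    pair (P - P') S = pair P S - pair P' S := by
  simp [pair, sub_mul]

theorem pair_smul_left (c : ℝ) (P S : Fin N → Matrix (Fin d) (Fin d) ℝ) :
    pair (c • P) S = c * pair P S := by
  simp [pair, Finset.mul_sum]

theorem pair_add_right (P S S' : Fin N → Matrix (Fin d) (Fin d) ℝ) :
    pair P (S + S') = pair P S + pair P S' := by
  simp [pair, mul_add, Finset.sum_add_distrib]

theorem pair_single (P : Fin N → Matrix (Fin d) (Fin d) ℝ) (i : Fin N)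
    (S : Matrix (Fin d) (Fin d) ℝ) : pair P (Pi.single i S) = (P i * S).trace := by
  rw [pair, Finset.sum_eq_single i]
  · simp
  · intro j _ hj; simp [hj]
  · simp

theorem pair_single_vecMulVec (P : Fin N → Matrix (Fin d) (Fin d) ℝ) (i : Fin N)
    (v : Fin d → ℝ) : pair P (Pi.single i (vecMulVec v v)) = v ⬝ᵥ P i *ᵥ v := by
  rw [pair_single, trace_mul_vecMulVec]

theorem pair_transpose {P S : Fin N → Matrix (Fin d) (Fin d) ℝ} (hS : ∀ i, (S i)ᵀ = S i) :
    pair (fun i => (P i)ᵀ) S = pair P S := by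
  refine Finset.sum_congr rfl fun i _ => ?_
  rw [← trace_transpose, transpose_mul, transpose_transpose, hS, trace_mul_comm]

theorem pair_one (S : Fin N → Matrix (Fin d) (Fin d) ℝ) : pair 1 S = ∑ i, (S i).trace := by
  simp [pair]

theorem tendsto_pair {ι : Type*} {l : Filter ι} {S : ι → Fin N → Matrix (Fin d) (Fin d) ℝ}
    {S₀ : Fin N → Matrix (Fin d) (Fin d) ℝ} (P : Fin N → Matrix (Fin d) (Fin d) ℝ)
    (h : ∀ i α β, Tendsto (fun t => S t i α β) l (𝓝 (S₀ i α β))) :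
    Tendsto (fun t => pair P (S t)) l (𝓝 (pair P S₀)) := by
  simp only [pair, trace, diag_apply, mul_apply]
  exact tendsto_finsetSum _ fun i _ => tendsto_finsetSum _ fun α _ =>
    tendsto_finsetSum _ fun β _ => (h i β α).const_mul _

/-- The operator `P ↦ (Γ_iᵀ E_i(P) Γ_i)_i`, adjoint to `opTadj`. -/
def opT : Module.End ℝ (Fin N → Matrix (Fin d) (Fin d) ℝ) where
  toFun P i := (M.Γ K i)ᵀ * M.opE P i * M.Γ K i
  map_add' P P' := by
    ext1 i
    simp [opE, Finset.sum_add_distrib, mul_add, add_mul]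
  map_smul' c P := by
    ext1 i
    simp only [opE, Pi.smul_apply, RingHom.id_apply, smul_comm _ c, ← Finset.smul_sum,
      Matrix.mul_smul, Matrix.smul_mul]

theorem opT_apply (P : Fin N → Matrix (Fin d) (Fin d) ℝ) (i : Fin N) :
    M.opT K P i = (M.Γ K i)ᵀ * M.opE P i * M.Γ K i := rfl

theorem pair_opT (P S : Fin N → Matrix (Fin d) (Fin d) ℝ) :
    pair (M.opT K P) S = pair P (M.opTadj K S) := by
  simp only [pair, opT_apply, opTadj_apply, opE, Finset.mul_sum, Finset.sum_mul, trace_sum]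
  rw [Finset.sum_comm]
  refine Finset.sum_congr rfl fun j _ => Finset.sum_congr rfl fun i _ => ?_
  simp only [Matrix.mul_smul, Matrix.smul_mul, trace_smul]
  congr 1
  rw [mul_assoc, mul_assoc, trace_mul_comm, mul_assoc, mul_assoc]

theorem opTadj_posSemidef {S : Fin N → Matrix (Fin d) (Fin d) ℝ} (hS : ∀ i, (S i).PosSemidef)
    (j : Fin N) : (M.opTadj K S j).PosSemidef := by
  rw [opTadj_apply]
  refine posSemidef_sum _ fun i _ => PosSemidef.smul ?_ (M.p_nonneg i j)
  simpa using (hS i).mul_mul_conjTranspose_same (M.Γ K i)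

theorem opTadj_pow_posSemidef {S : Fin N → Matrix (Fin d) (Fin d) ℝ}
    (hS : ∀ i, (S i).PosSemidef) (t : ℕ) (j : Fin N) :
    ((M.opTadj K ^ t) S j).PosSemidef := by
  induction t generalizing j with
  | zero => exact hS j
  | succ t ih =>
    rw [pow_succ', Module.End.mul_apply]
    exact M.opTadj_posSemidef K ih j

/-- `D` dominates the (not necessarily symmetric) tuple `S` as a bilinear form. -/
def Dominates (D S : Fin N → Matrix (Fin d) (Fin d) ℝ) : Prop :=
  ∀ i u v, |u ⬝ᵥ S i *ᵥ v| ≤ (u ⬝ᵥ D i *ᵥ u + v ⬝ᵥ D i *ᵥ v) / 2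

theorem dot_opTadj (S : Fin N → Matrix (Fin d) (Fin d) ℝ) (j : Fin N) (u v : Fin d → ℝ) :
    u ⬝ᵥ M.opTadj K S j *ᵥ v =
      ∑ i, M.p i j * (((M.Γ K i)ᵀ *ᵥ u) ⬝ᵥ S i *ᵥ ((M.Γ K i)ᵀ *ᵥ v)) := by
  rw [opTadj_apply, sum_mulVec, dotProduct_sum]
  refine Finset.sum_congr rfl fun i _ => ?_
  rw [smul_mulVec, dotProduct_smul, smul_eq_mul, ← mulVec_mulVec, ← mulVec_mulVec,
    dotProduct_mulVec, mulVec_transpose, mulVec_transpose]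

/-- Congruence by `Γ_iᵀ` and sums with nonnegative weights both preserve the domination. The
bilinear version is used because a general tuple `S` is not symmetric. -/
theorem Dominates.opTadj {D S : Fin N → Matrix (Fin d) (Fin d) ℝ} (h : Dominates D S) :
    Dominates (M.opTadj K D) (M.opTadj K S) := by
  intro j u v
  rw [dot_opTadj, dot_opTadj, dot_opTadj, ← Finset.sum_add_distrib, Finset.sum_div]
  refine (Finset.abs_sum_le_sum_abs _ _).trans (Finset.sum_le_sum fun i _ => ?_)
  rw [abs_mul, abs_of_nonneg (M.p_nonneg i j), ← mul_add, mul_div_assoc]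
  exact mul_le_mul_of_nonneg_left (h i _ _) (M.p_nonneg i j)

theorem Dominates.opTadj_pow {D S : Fin N → Matrix (Fin d) (Fin d) ℝ} (h : Dominates D S)
    (t : ℕ) : Dominates ((M.opTadj K ^ t) D) ((M.opTadj K ^ t) S) := by
  induction t with
  | zero => exact h
  | succ t ih =>
    rw [pow_succ', Module.End.mul_apply, Module.End.mul_apply]
    exact ih.opTadj M K

theorem abs_dot_mulVec_le_sum {n : ℕ} (S : Matrix (Fin n) (Fin n) ℝ) (u v : Fin n → ℝ) :
    |u ⬝ᵥ S *ᵥ v| ≤ (∑ α, ∑ β, |S α β|) * ((u ⬝ᵥ u + v ⬝ᵥ v) / 2) := by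
  have hle : ∀ (w : Fin n → ℝ) α, w α ^ 2 ≤ w ⬝ᵥ w := fun w α => by
    rw [pow_two]
    exact Finset.single_le_sum (f := fun α => w α * w α) (fun α _ => mul_self_nonneg _)
      (Finset.mem_univ α)
  simp only [dotProduct, mulVec, Finset.mul_sum, Finset.sum_mul]
  refine (Finset.abs_sum_le_sum_abs _ _).trans (Finset.sum_le_sum fun α _ => ?_)
  refine (Finset.abs_sum_le_sum_abs _ _).trans (Finset.sum_le_sum fun β _ => ?_)
  have e : |u α * (S α β * v β)| = |S α β| * (|u α| * |v β|) := by
    rw [abs_mul, abs_mul]; ring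
  rw [e]
  refine mul_le_mul_of_nonneg_left ?_ (abs_nonneg _)
  have h1 := hle u α
  have h2 := hle v β
  rw [← sq_abs] at h1 h2
  simp only [dotProduct] at h1 h2
  nlinarith [sq_nonneg (|u α| - |v β|)]

theorem exists_dominates {D : Fin N → Matrix (Fin d) (Fin d) ℝ} {ε : ℝ} (hε : 0 < ε)
    (hD : ∀ i v, ε * (v ⬝ᵥ v) ≤ v ⬝ᵥ D i *ᵥ v) (S : Fin N → Matrix (Fin d) (Fin d) ℝ) :
    ∃ c : ℝ, Dominates (c • D) S := by
  set b := ∑ i, ∑ α, ∑ β, |S i α β| with hb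
  have hb0 : 0 ≤ b := Finset.sum_nonneg fun i _ => Finset.sum_nonneg fun α _ =>
    Finset.sum_nonneg fun β _ => abs_nonneg _
  refine ⟨b / ε, fun i u v => (abs_dot_mulVec_le_sum (S i) u v).trans ?_⟩
  have h1 : ∑ α, ∑ β, |S i α β| ≤ b :=
    Finset.single_le_sum (f := fun i => ∑ α, ∑ β, |S i α β|)
      (fun i _ => Finset.sum_nonneg fun α _ => Finset.sum_nonneg fun β _ => abs_nonneg _)
      (Finset.mem_univ i)
  have hu := dotProduct_self_nonneg_real u
  have hv := dotProduct_self_nonneg_real v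
  refine (mul_le_mul_of_nonneg_right h1 (by positivity)).trans ?_
  simp only [Pi.smul_apply, smul_mulVec, dotProduct_smul, smul_eq_mul]
  have h2 := mul_le_mul_of_nonneg_left (hD i u) (div_nonneg hb0 hε.le)
  have h3 := mul_le_mul_of_nonneg_left (hD i v) (div_nonneg hb0 hε.le)
  rw [← mul_assoc, div_mul_cancel₀ _ hε.ne'] at h2 h3
  linarith

/-- If the total trace of the correlations started in some uniformly positive definite tuple
tends to zero, then all correlations do. -/
theorem tendsto_opTadj_pow_of_trace {D : Fin N → Matrix (Fin d) (Fin d) ℝ} {ε : ℝ} (hε : 0 < ε)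
    (hD : ∀ i v, ε * (v ⬝ᵥ v) ≤ v ⬝ᵥ D i *ᵥ v) (hps : ∀ i, (D i).PosSemidef)
    (ht : Tendsto (fun t => pair 1 ((M.opTadj K ^ t) D)) atTop (𝓝 0))
    (S : Fin N → Matrix (Fin d) (Fin d) ℝ) (i : Fin N) (α β : Fin d) :
    Tendsto (fun t => (M.opTadj K ^ t) S i α β) atTop (𝓝 0) := by
  obtain ⟨c, hc⟩ := exists_dominates hε hD S
  -- Evaluated at basis vectors, domination bounds an entry by diagonal entries of the dominating
  -- positive semidefinite tuple, hence by its total trace.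
  have hbound : ∀ t, |(M.opTadj K ^ t) S i α β| ≤ |c| * pair 1 ((M.opTadj K ^ t) D) := by
    intro t
    have h1 := hc.opTadj_pow M K t i (Pi.single α 1) (Pi.single β 1)
    simp only [mulVec_single_one, single_one_dotProduct, col_apply, map_smul, Pi.smul_apply,
      Matrix.smul_apply, smul_eq_mul] at h1
    have hp := M.opTadj_pow_posSemidef K hps t
    have hle : ∀ γ, (M.opTadj K ^ t) D i γ γ ≤ pair 1 ((M.opTadj K ^ t) D) := fun γ => by
      rw [pair_one]
      refine (le_abs_self _).trans ((abs_apply_le_trace (hp i) γ γ).trans ?_)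
      exact Finset.single_le_sum (f := fun i => ((M.opTadj K ^ t) D i).trace)
        (fun i _ => (hp i).trace_nonneg) (Finset.mem_univ i)
    have h0 : ∀ γ, 0 ≤ (M.opTadj K ^ t) D i γ γ := fun γ => (hp i).diag_nonneg
    have h2 : ∀ γ, c * (M.opTadj K ^ t) D i γ γ ≤ |c| * pair 1 ((M.opTadj K ^ t) D) := fun γ =>
      mul_le_mul (le_abs_self c) (hle γ) (h0 γ) (abs_nonneg c)
    linarith [h2 α, h2 β]
  refine squeeze_zero_norm hbound ?_
  simpa using ht.const_mul |c|

theorem isMSS_of_tendsto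
    (h : ∀ S i α β, Tendsto (fun t => (M.opTadj K ^ t) S i α β) atTop (𝓝 0)) : M.IsMSS K := by
  rw [isMSS_iff]
  intro x i α β
  simpa using tendsto_finsetSum Finset.univ fun j _ => h (Pi.single i (vecMulVec x x)) j α β

variable {M K}

/-- Stability controls only starts of rank one in a single mode, summed over the final modes. The
identity tuple is a sum of such starts, so its total trace tends to zero, and it dominates multiples
of every tuple. -/
theorem IsMSS.tendsto (hK : M.IsMSS K) (S : Fin N → Matrix (Fin d) (Fin d) ℝ) (i : Fin N)
    (α β : Fin d) : Tendsto (fun t => (M.opTadj K ^ t) S i α β) atTop (𝓝 0) := by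
  rw [isMSS_iff] at hK
  refine M.tendsto_opTadj_pow_of_trace K (D := 1) one_pos (fun i v => by simp)
    (fun i => .one) ?_ S i α β
  have e : (1 : Fin N → Matrix (Fin d) (Fin d) ℝ) =
      ∑ i, ∑ γ, Pi.single i (vecMulVec (Pi.single γ 1) (Pi.single γ 1)) := by
    ext i α β
    simp only [Pi.one_apply, one_apply, Finset.sum_apply, Matrix.sum_apply]
    rw [Finset.sum_eq_single i]
    · simp only [Pi.single_eq_same, vecMulVec_apply, Pi.single_apply]
      by_cases h : α = β <;> simp [h]
    · intro j _ hj
      simp [Ne.symm hj]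
    · simp
  have h := tendsto_finsetSum Finset.univ fun i _ => tendsto_finsetSum Finset.univ fun γ _ =>
    tendsto_finsetSum Finset.univ fun α _ => hK (Pi.single γ 1) i α α
  simp only [Finset.sum_const_zero] at h
  refine h.congr fun t => ?_
  rw [pair_one, e, map_sum]
  simp only [map_sum, Finset.sum_apply, trace_sum]
  symm
  rw [Finset.sum_comm]
  refine Finset.sum_congr rfl fun i _ => ?_
  rw [Finset.sum_comm]
  exact Finset.sum_congr rfl fun γ _ => Finset.sum_comm

theorem IsMSS.tendsto_pair (hK : M.IsMSS K) (P S : Fin N → Matrix (Fin d) (Fin d) ℝ) :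
    Tendsto (fun t => pair P ((M.opTadj K ^ t) S)) atTop (𝓝 0) := by
  have := MJLS.tendsto_pair (S₀ := 0) P (fun i α β => by simpa using hK.tendsto S i α β)
  simpa [pair] using this

theorem pair_eq_zero {H : Fin N → Matrix (Fin d) (Fin d) ℝ} (h : ∀ S, pair H S = 0) : H = 0 := by
  ext i α β
  have := h (Pi.single i (Matrix.single β α 1))
  rw [pair_single] at this
  simpa [trace_mul_single] using this

/-- If `opT K P = P`, then the pairing of `P` with the iterates of `opTadj K` is constant in time
and tends to zero. So `1 - opT K` is injective, hence surjective in finite dimension. -/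
theorem IsMSS.exists_eq_add_opT (hK : M.IsMSS K) (H : Fin N → Matrix (Fin d) (Fin d) ℝ) :
    ∃ P, P = H + M.opT K P := by
  have hinj : Function.Injective ⇑(1 - M.opT K) := by
    rw [injective_iff_map_eq_zero]
    intro P hP
    have hP : M.opT K P = P := by
      rw [LinearMap.sub_apply, Module.End.one_apply, sub_eq_zero] at hP
      exact hP.symm
    refine pair_eq_zero fun S => ?_
    have hc : ∀ t, pair P ((M.opTadj K ^ t) S) = pair P S := by
      intro t
      induction t with
      | zero => simp
      | succ t ih => rw [pow_succ', Module.End.mul_apply, ← pair_opT, hP, ih]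
    have := hK.tendsto_pair P S
    simp_rw [hc] at this
    exact tendsto_nhds_unique tendsto_const_nhds this
  obtain ⟨P, hP⟩ := LinearMap.injective_iff_surjective.1 hinj H
  refine ⟨P, ?_⟩
  rw [← hP, LinearMap.sub_apply, Module.End.one_apply, sub_add_cancel]

theorem IsMSS.injective_one_sub_opTadj (hK : M.IsMSS K) :
    Function.Injective ⇑(1 - M.opTadj K) := by
  rw [injective_iff_map_eq_zero]
  intro S hS
  rw [LinearMap.sub_apply, Module.End.one_apply, sub_eq_zero] at hS
  have hc : ∀ t, (M.opTadj K ^ t) S = S := by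
    intro t
    induction t with
    | zero => simp
    | succ t ih => rw [pow_succ', Module.End.mul_apply, ih, ← hS]
  ext i α β
  have := hK.tendsto S i α β
  simp_rw [hc] at this
  exact tendsto_nhds_unique tendsto_const_nhds this

theorem IsMSS.exists_eq_add_opTadj (hK : M.IsMSS K) (S : Fin N → Matrix (Fin d) (Fin d) ℝ) :
    ∃ X, X = S + M.opTadj K X := by
  obtain ⟨X, hX⟩ := LinearMap.injective_iff_surjective.1 hK.injective_one_sub_opTadj S
  refine ⟨X, ?_⟩
  rw [← hX, LinearMap.sub_apply, Module.End.one_apply, sub_add_cancel]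

/-- The duality `⟨(1 - T)⁻¹ H, S⟩ = ⟨H, (1 - T*)⁻¹ S⟩`, with `T*` the adjoint of `T`. -/
theorem pair_eq_pair_of_fixed {P H X S : Fin N → Matrix (Fin d) (Fin d) ℝ}
    (hP : P = H + M.opT K P) (hX : X = S + M.opTadj K X) : pair P S = pair H X := by
  have h1 : pair P X = pair H X + pair (M.opT K P) X := by rw [← pair_add_left, ← hP]
  have h2 : pair P X = pair P S + pair P (M.opTadj K X) := by rw [← pair_add_right, ← hX]
  rw [pair_opT] at h1
  linarith

theorem IsMSS.eq_of_fixed (hK : M.IsMSS K) {P P' H : Fin N → Matrix (Fin d) (Fin d) ℝ}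
    (hP : P = H + M.opT K P) (hP' : P' = H + M.opT K P') : P = P' := by
  rw [← sub_eq_zero]
  refine pair_eq_zero fun S => ?_
  obtain ⟨X, hX⟩ := hK.exists_eq_add_opTadj S
  rw [pair_sub_left, pair_eq_pair_of_fixed hP hX, pair_eq_pair_of_fixed hP' hX, sub_self]

/-- Comparison principle: formally `P = ∑ Tᵗ H` and every term is nonnegative. It gives positivity
of `P^K` and later the bound on its derivative. -/
theorem IsMSS.quadForm_le (hK : M.IsMSS K) {P H : Fin N → Matrix (Fin d) (Fin d) ℝ}
    (hP : P = H + M.opT K P) (hH : ∀ i v, 0 ≤ v ⬝ᵥ H i *ᵥ v) (i : Fin N) (v : Fin d → ℝ) :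
    v ⬝ᵥ H i *ᵥ v ≤ v ⬝ᵥ P i *ᵥ v := by
  set S : Fin N → Matrix (Fin d) (Fin d) ℝ := Pi.single i (vecMulVec v v) with hS
  have hps : ∀ j, (S j).PosSemidef := by
    intro j
    by_cases hj : j = i
    · subst hj; simpa [hS] using posSemidef_vecMulVec v
    · simpa [hS, hj] using PosSemidef.zero
  have hstep : ∀ t, pair P ((M.opTadj K ^ t) S) =
      pair H ((M.opTadj K ^ t) S) + pair P ((M.opTadj K ^ (t + 1)) S) := by
    intro t
    rw [pow_succ', Module.End.mul_apply, ← pair_opT, ← pair_add_left, ← hP]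
  have hanti : Antitone fun t => pair P ((M.opTadj K ^ t) S) := antitone_nat_of_succ_le fun t => by
    rw [hstep t]
    linarith [pair_nonneg hH (M.opTadj_pow_posSemidef K hps t)]
  -- The pairings decrease to zero, so the one at time `1` is nonnegative; it is the form of `opT K
  -- P` at `v`.
  have h0 := hanti.le_of_tendsto (hK.tendsto_pair P S) 1
  have h1 := hstep 0
  rw [pow_zero, Module.End.one_apply, hS, pair_single_vecMulVec, pair_single_vecMulVec, ← hS] at h1
  simp only [zero_add] at h1
  linarith

variable (M K)

theorem opE_transpose (P : Fin N → Matrix (Fin d) (Fin d) ℝ) (i : Fin N) :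
    (M.opE P i)ᵀ = M.opE (fun i => (P i)ᵀ) i := by
  simp [opE, transpose_sum]

theorem opT_transpose (P : Fin N → Matrix (Fin d) (Fin d) ℝ) :
    M.opT K (fun i => (P i)ᵀ) = fun i => (M.opT K P i)ᵀ := by
  ext1 i
  simp [opT_apply, opE_transpose, mul_assoc]

variable {M K}

/-- The transposed tuple solves the same equation, and the solution is unique. -/
theorem IsMSS.transpose_eq (hK : M.IsMSS K) {P H : Fin N → Matrix (Fin d) (Fin d) ℝ}
    (hP : P = H + M.opT K P) (hH : ∀ i, (H i)ᵀ = H i) (i : Fin N) : (P i)ᵀ = P i := by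
  refine congrFun (hK.eq_of_fixed (P := fun i => (P i)ᵀ) (P' := P) (H := H) ?_ hP) i
  rw [opT_transpose]
  ext1 i
  conv_lhs => rw [hP]
  simp [hH]

variable (M K)

theorem isLyapunov_iff {P : Fin N → Matrix (Fin d) (Fin d) ℝ} :
    M.IsLyapunov K P ↔ P = M.stageMat K + M.opT K P :=
  funext_iff.symm

theorem stageMat_transpose (i : Fin N) : (M.stageMat K i)ᵀ = M.stageMat K i := by
  simp [stageMat, (M.Q_posDef i).posSemidef.transpose_eq, (M.R_posDef i).posSemidef.transpose_eq,
    Matrix.mul_assoc]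

theorem stageMat_nonneg (i : Fin N) (v : Fin d → ℝ) : 0 ≤ v ⬝ᵥ M.stageMat K i *ᵥ v :=
  ((M.Q_posDef i).posSemidef.quadForm_nonneg v).trans (M.Q_le_stageMat K i v)

theorem cov0_posDef : M.cov0.PosDef := M.x0_cov_posDef

theorem X0_posSemidef (i : Fin N) : (M.X0 i).PosSemidef :=
  M.cov0_posDef.posSemidef.smul (M.π_pos i).le

theorem mu_mul_le (i : Fin N) (v : Fin d → ℝ) : M.mu * (v ⬝ᵥ v) ≤ v ⬝ᵥ M.X0 i *ᵥ v := by
  have h1 := sigmaMin_mul_le_of_posSemidef M.cov0_posDef.posSemidef v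
  have h2 : ⨅ i, M.π i ≤ M.π i := ciInf_le (Set.finite_range _).bddBelow i
  have h3 := mul_nonneg (sigmaMin_nonneg M.cov0) (dotProduct_self_nonneg_real v)
  rw [X0, smul_mulVec, dotProduct_smul, smul_eq_mul, mu, mul_assoc]
  exact (mul_le_mul_of_nonneg_right h2 h3).trans
    (mul_le_mul_of_nonneg_left h1 (M.π_pos i).le)

theorem neZero_modes {N d k : ℕ} {Ω : Type*} [MeasurableSpace Ω] (M : MJLS N d k Ω) : NeZero N := by
  refine ⟨fun h => ?_⟩
  subst h
  simpa using M.π_sum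

theorem mu_pos [NeZero d] : 0 < M.mu := by
  have := M.neZero_modes
  obtain ⟨j, hj⟩ := exists_eq_ciInf_of_finite (f := M.π)
  rw [mu, ← hj]
  exact mul_pos (M.π_pos j) (sigmaMin_pos M.cov0_posDef)

theorem lamMin_Q_pos [NeZero d] : 0 < lamMin M.Q :=
  have := M.neZero_modes
  lamMin_pos M.Q_posDef

theorem lamMin_R_pos [NeZero k] : 0 < lamMin M.R :=
  have := M.neZero_modes
  lamMin_pos M.R_posDef

end Operators

end MJLS

end

noncomputable section

namespace MJLS

open Matrix

/-! ### Closed formulas for the cost; finite cost and Lyapunov criteria for stability. -/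

section Cost

variable {N d k : ℕ} {Ω : Type*} [MeasurableSpace Ω] {M : MJLS N d k Ω} {K : Policy N k d}

theorem sum_range_opTadj_pow {X S : Fin N → Matrix (Fin d) (Fin d) ℝ}
    (hX : X = S + M.opTadj K X) (n : ℕ) :
    ∑ t ∈ Finset.range n, (M.opTadj K ^ t) S = X - (M.opTadj K ^ n) X := by
  induction n with
  | zero => simp
  | succ n ih =>
    have h : (M.opTadj K ^ n) X = (M.opTadj K ^ n) S + (M.opTadj K ^ (n + 1)) X := by
      rw [pow_succ, Module.End.mul_apply, ← map_add, ← hX]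
    rw [Finset.sum_range_succ, ih, h]
    abel

/-- The partial sums telescope to `X - (opTadj K)ⁿ X`, and the remainder vanishes by stability. -/
theorem IsMSS.hasSum_of_fixed (hK : M.IsMSS K) {X S : Fin N → Matrix (Fin d) (Fin d) ℝ}
    (hX : X = S + M.opTadj K X) (hS : ∀ i, (S i).PosSemidef) (i : Fin N) (α β : Fin d) :
    HasSum (fun t => (M.opTadj K ^ t) S i α β) (X i α β) := by
  have hps := M.opTadj_pow_posSemidef K hS
  have htend : ∀ α β, Tendsto
      (fun n => ∑ t ∈ Finset.range n, (M.opTadj K ^ t) S i α β) atTop (𝓝 (X i α β)) := by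
    intro α β
    have h1 : ∀ n, ∑ t ∈ Finset.range n, (M.opTadj K ^ t) S i α β =
        X i α β - (M.opTadj K ^ n) X i α β := by
      intro n
      have := congrFun (congrFun (congrFun (sum_range_opTadj_pow hX n) i) α) β
      simpa [Finset.sum_apply, Matrix.sum_apply] using this
    simp_rw [h1]
    simpa using (hK.tendsto X i α β).const_sub (X i α β)
  -- Convergence of partial sums is not yet summability. Diagonal entries are nonnegative, so the
  -- traces are summable, and these dominate all entries.
  have htr : Summable fun t => ((M.opTadj K ^ t) S i).trace := by
    simp only [trace, diag_apply]
    refine summable_sum fun γ _ => ?_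
    exact ((hasSum_iff_tendsto_nat_of_nonneg (fun t => (hps t i).diag_nonneg) _).2
      (htend γ γ)).summable
  have hsum : Summable fun t => (M.opTadj K ^ t) S i α β :=
    .of_norm_bounded htr fun t => abs_apply_le_trace (hps t i) α β
  have := hsum.hasSum.tendsto_sum_nat
  rw [tendsto_nhds_unique (htend α β) this]
  exact hsum.hasSum

theorem IsMSS.summable_corr (hK : M.IsMSS K) (i : Fin N) (α β : Fin d) :
    Summable fun t => M.corr K t i α β := by
  obtain ⟨X, hX⟩ := hK.exists_eq_add_opTadj M.X0
  simp_rw [corr_eq]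
  exact (hK.hasSum_of_fixed hX M.X0_posSemidef i α β).summable

theorem IsMSS.XK_fixed (hK : M.IsMSS K) : M.XK K = M.X0 + M.opTadj K (M.XK K) := by
  obtain ⟨X, hX⟩ := hK.exists_eq_add_opTadj M.X0
  have : M.XK K = X := by
    ext i α β
    simp only [XK, of_apply, corr_eq]
    exact (hK.hasSum_of_fixed hX M.X0_posSemidef i α β).tsum_eq
  rw [this]
  exact hX

theorem XK_transpose (i : Fin N) : (M.XK K i)ᵀ = M.XK K i := by
  ext α β
  simp only [XK, transpose_apply, of_apply]
  exact tsum_congr fun t => M.corr_symm K t i β α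

theorem IsMSS.X0_le_XK (hK : M.IsMSS K) (i : Fin N) (v : Fin d → ℝ) :
    v ⬝ᵥ M.X0 i *ᵥ v ≤ v ⬝ᵥ M.XK K i *ᵥ v := by
  have hps := M.opTadj_pow_posSemidef K M.X0_posSemidef
  have hs : HasSum (fun t => v ⬝ᵥ (M.opTadj K ^ t) M.X0 i *ᵥ v) (v ⬝ᵥ M.XK K i *ᵥ v) := by
    simp only [dotProduct, mulVec]
    exact hasSum_sum fun α _ => (hasSum_sum fun β _ =>
      (hK.hasSum_of_fixed hK.XK_fixed M.X0_posSemidef i α β).mul_right _).mul_left _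
  have := le_hasSum hs 0 fun t _ => (hps t i).quadForm_nonneg v
  simpa using this

theorem IsMSS.XK_posSemidef (hK : M.IsMSS K) (i : Fin N) : (M.XK K i).PosSemidef :=
  posSemidef_of_quadForm (XK_transpose i) fun v =>
    ((M.X0_posSemidef i).quadForm_nonneg v).trans (hK.X0_le_XK i v)

theorem IsMSS.mu_le_XK (hK : M.IsMSS K) (i : Fin N) (v : Fin d → ℝ) :
    M.mu * (v ⬝ᵥ v) ≤ v ⬝ᵥ M.XK K i *ᵥ v :=
  (M.mu_mul_le i v).trans (hK.X0_le_XK i v)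

theorem IsMSS.existsUnique_isLyapunov (hK : M.IsMSS K) : ∃! P, M.IsLyapunov K P := by
  obtain ⟨P, hP⟩ := hK.exists_eq_add_opT (M.stageMat K)
  exact ⟨P, (M.isLyapunov_iff K).2 hP, fun P' hP' =>
    hK.eq_of_fixed ((M.isLyapunov_iff K).1 hP') hP⟩

theorem IsMSS.PK_fixed (hK : M.IsMSS K) : M.PK K = M.stageMat K + M.opT K (M.PK K) :=
  (M.isLyapunov_iff K).1 (Classical.epsilon_spec hK.existsUnique_isLyapunov.exists)

theorem IsMSS.PK_transpose (hK : M.IsMSS K) (i : Fin N) : (M.PK K i)ᵀ = M.PK K i :=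
  hK.transpose_eq hK.PK_fixed (M.stageMat_transpose K) i

theorem IsMSS.PK_posSemidef (hK : M.IsMSS K) (i : Fin N) : (M.PK K i).PosSemidef :=
  posSemidef_of_quadForm (hK.PK_transpose i) fun v =>
    (M.stageMat_nonneg K i v).trans (hK.quadForm_le hK.PK_fixed (M.stageMat_nonneg K) i v)

theorem opE_posSemidef {P : Fin N → Matrix (Fin d) (Fin d) ℝ} (hP : ∀ i, (P i).PosSemidef)
    (i : Fin N) : (M.opE P i).PosSemidef :=
  posSemidef_sum _ fun j _ => (hP j).smul (M.p_nonneg i j)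

theorem stage_nonneg (t : ℕ) : 0 ≤ pair (M.stageMat K) ((M.opTadj K ^ t) M.X0) :=
  pair_nonneg (M.stageMat_nonneg K) (M.opTadj_pow_posSemidef K M.X0_posSemidef t)

theorem IsMSS.hasSum_stage (hK : M.IsMSS K) :
    HasSum (fun t => pair (M.stageMat K) ((M.opTadj K ^ t) M.X0))
      (pair (M.stageMat K) (M.XK K)) := by
  simp only [pair, trace, diag_apply, mul_apply]
  exact hasSum_sum fun i _ => hasSum_sum fun α _ => hasSum_sum fun β _ =>
      (hK.hasSum_of_fixed hK.XK_fixed M.X0_posSemidef i β α).mul_left _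

theorem IsMSS.extCost_eq_ofReal (hK : M.IsMSS K) :
    M.extCost K = ENNReal.ofReal (pair (M.stageMat K) (M.XK K)) := by
  rw [extCost_eq, ← ENNReal.ofReal_tsum_of_nonneg stage_nonneg hK.hasSum_stage.summable,
    hK.hasSum_stage.tsum_eq]

theorem IsMSS.extCost_ne_top (hK : M.IsMSS K) : M.extCost K ≠ ⊤ := by
  rw [hK.extCost_eq_ofReal]
  exact ENNReal.ofReal_ne_top

theorem IsMSS.cost_eq_pair (hK : M.IsMSS K) : M.cost K = pair (M.stageMat K) (M.XK K) := by
  rw [cost, hK.extCost_eq_ofReal, ENNReal.toReal_ofReal]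
  exact pair_nonneg (M.stageMat_nonneg K) hK.XK_posSemidef

theorem IsMSS.cost_eq_pair_X0 (hK : M.IsMSS K) : M.cost K = pair (M.PK K) M.X0 := by
  rw [hK.cost_eq_pair, pair_eq_pair_of_fixed hK.PK_fixed hK.XK_fixed]

theorem integral_quadForm (H : Matrix (Fin d) (Fin d) ℝ) :
    ∫ a, M.x0 a ⬝ᵥ H *ᵥ M.x0 a ∂M.Pr = (H * M.cov0).trace := by
  have hint := fun α β => (M.isInitialState_x0.integrable_mul α β).const_mul (H α β)
  have e : ∀ a, M.x0 a ⬝ᵥ H *ᵥ M.x0 a = ∑ α, ∑ β, H α β * (M.x0 a α * M.x0 a β) := by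
    intro a
    simp only [dotProduct, mulVec, Finset.mul_sum]
    exact Finset.sum_congr rfl fun α _ => Finset.sum_congr rfl fun β _ => by ring
  simp_rw [e]
  rw [integral_finsetSum _ fun α _ => integrable_finsetSum _ fun β _ => hint α β, trace]
  refine Finset.sum_congr rfl fun α _ => ?_
  rw [integral_finsetSum _ fun β _ => hint α β, diag_apply, mul_apply]
  refine Finset.sum_congr rfl fun β _ => ?_
  rw [integral_const_mul, cov0, of_apply]
  simp only [mul_comm]

theorem IsMSS.cost_eq_integral (hK : M.IsMSS K) :
    M.cost K = ∫ a, M.x0 a ⬝ᵥ ((∑ i, M.π i • M.PK K i) *ᵥ M.x0 a) ∂M.Pr := by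
  rw [integral_quadForm, hK.cost_eq_pair_X0, pair, Finset.sum_mul, trace_sum]
  refine Finset.sum_congr rfl fun i _ => ?_
  rw [X0, Matrix.mul_smul, Matrix.smul_mul]

/-- Finite cost implies mean-square stability. -/
theorem isMSS_of_extCost_ne_top [NeZero d] (h : M.extCost K ≠ ⊤) : M.IsMSS K := by
  rw [extCost_eq] at h
  have ht := (ENNReal.tendsto_atTop_zero_of_tsum_ne_top h)
  have ht' : Tendsto (fun t => pair (M.stageMat K) ((M.opTadj K ^ t) M.X0)) atTop (𝓝 0) := by
    have := (ENNReal.tendsto_toReal ENNReal.zero_ne_top).comp ht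
    refine (this.congr fun t => ?_)
    exact ENNReal.toReal_ofReal (stage_nonneg t)
  refine M.isMSS_of_tendsto K (M.tendsto_opTadj_pow_of_trace K M.mu_pos M.mu_mul_le
    M.X0_posSemidef ?_)
  have hps := M.opTadj_pow_posSemidef K M.X0_posSemidef
  have hl := M.lamMin_Q_pos
  refine squeeze_zero (fun t => ?_) (fun t => ?_)
    (by simpa using ht'.const_mul (lamMin M.Q)⁻¹)
  · exact pair_nonneg (fun i v => by simpa using dotProduct_self_nonneg_real v) (hps t)
  -- The stage cost is at least `Λ_min(Q)` times the total trace of the correlations.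
  · rw [← div_eq_inv_mul, le_div_iff₀ hl, mul_comm, ← pair_smul_left]
    refine pair_le_pair (fun i v => ?_) (hps t)
    simpa [smul_mulVec] using
      (lamMin_mul_le M.Q_posDef i v).trans (M.Q_le_stageMat K i v)

/-- A Lyapunov function certifies mean-square stability. -/
theorem isMSS_of_lyapunov {P : Fin N → Matrix (Fin d) (Fin d) ℝ}
    (hP : ∀ i v, 0 ≤ v ⬝ᵥ P i *ᵥ v) {ε : ℝ} (hε : 0 < ε)
    (h : ∀ i v, ε * (v ⬝ᵥ v) ≤ v ⬝ᵥ (P - M.opT K P) i *ᵥ v) : M.IsMSS K := by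
  refine M.isMSS_of_tendsto K (M.tendsto_opTadj_pow_of_trace K (D := 1) one_pos
    (fun i v => by simp) (fun i => .one) ?_)
  have hps := M.opTadj_pow_posSemidef K
    (S := (1 : Fin N → Matrix (Fin d) (Fin d) ℝ)) fun i => .one
  set S := fun t => (M.opTadj K ^ t) (1 : Fin N → Matrix (Fin d) (Fin d) ℝ) with hS
  have hnn : ∀ t, 0 ≤ pair 1 (S t) := fun t =>
    pair_nonneg (fun i v => by simpa using dotProduct_self_nonneg_real v) (hps t)
  have hstep : ∀ t, ε * pair 1 (S t) ≤ pair P (S t) - pair P (S (t + 1)) := by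
    intro t
    have e : S (t + 1) = M.opTadj K (S t) := by
      simp only [hS]; rw [pow_succ', Module.End.mul_apply]
    rw [e, ← pair_opT, ← pair_sub_left, ← pair_smul_left]
    exact pair_le_pair (fun i v => by simpa [smul_mulVec] using h i v) (hps t)
  -- The decrease of the Lyapunov function telescopes, so the traces of the iterates have bounded
  -- sums and tend to zero.
  refine (summable_of_sum_range_le (c := ε⁻¹ * pair P (S 0)) hnn fun n => ?_).tendsto_atTop_zero
  rw [← div_eq_inv_mul, le_div_iff₀ hε, mul_comm, Finset.mul_sum]
  refine (Finset.sum_le_sum fun t _ => hstep t).trans ?_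
  rw [Finset.sum_range_sub']
  linarith [pair_nonneg hP (hps n)]

end Cost

/-! ### Openness of the stabilizing set, compact sublevel sets, coercivity. -/

section Topology

variable {N d k : ℕ} {Ω : Type*} [MeasurableSpace Ω] (M : MJLS N d k Ω)

theorem continuous_mat (i : Fin N) : Continuous fun K : Policy N k d => K.mat i := by
  refine continuous_matrix fun a b => ?_
  simp only [Policy.mat, of_apply]
  fun_prop

theorem continuous_Γ (i : Fin N) : Continuous fun K => M.Γ K i :=
  continuous_const.sub (continuous_const.matrix_mul (continuous_mat i))

theorem continuous_opT (P : Fin N → Matrix (Fin d) (Fin d) ℝ) (i : Fin N) :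
    Continuous fun K => M.opT K P i :=
  (((M.continuous_Γ i).matrix_transpose).matrix_mul continuous_const).matrix_mul
    (M.continuous_Γ i)

theorem continuous_opTadj_pow (S : Fin N → Matrix (Fin d) (Fin d) ℝ) (t : ℕ) (j : Fin N) :
    Continuous fun K => (M.opTadj K ^ t) S j := by
  induction t generalizing j with
  | zero => exact continuous_const
  | succ t ih =>
    simp_rw [pow_succ', Module.End.mul_apply, opTadj_apply]
    refine continuous_finsetSum _ fun i _ => Continuous.fun_const_smul ?_ _
    exact ((M.continuous_Γ i).matrix_mul (ih i)).matrix_mul (M.continuous_Γ i).matrix_transpose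

theorem continuous_stageMat (i : Fin N) : Continuous fun K => M.stageMat K i :=
  continuous_const.add
    ((((continuous_mat i).matrix_transpose).matrix_mul continuous_const).matrix_mul
      (continuous_mat i))

theorem continuous_stage (t : ℕ) :
    Continuous fun K => pair (M.stageMat K) ((M.opTadj K ^ t) M.X0) :=
  continuous_finsetSum _ fun i _ =>
    ((M.continuous_stageMat i).matrix_mul (M.continuous_opTadj_pow M.X0 t i)).matrix_trace

/-- For `K'` close to `K`, the tuple `P^K` is still a strict Lyapunov function, with half of the
margin `Λ_min(Q)`. -/
theorem isOpen_stabSet [NeZero d] : IsOpen M.stabSet := by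
  rw [isOpen_iff_mem_nhds]
  intro K hK
  have hK : M.IsMSS K := hK
  set P := M.PK K
  have hl := M.lamMin_Q_pos
  have hev : ∀ i, ∀ᶠ K' in 𝓝 K, ∑ α, ∑ β, |(M.opT K' P i - M.opT K P i) α β| < lamMin M.Q / 2 := by
    intro i
    have hc : Continuous fun K' => ∑ α, ∑ β, |(M.opT K' P i - M.opT K P i) α β| :=
      continuous_finsetSum _ fun α _ => continuous_finsetSum _ fun β _ =>
        (((M.continuous_opT P i).sub continuous_const).matrix_elem α β).abs
    refine hc.continuousAt.eventually_lt continuousAt_const ?_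
    simp [hl]
  filter_upwards [eventually_all.2 hev] with K' h
  refine isMSS_of_lyapunov (P := P) (fun i => (hK.PK_posSemidef i).quadForm_nonneg)
    (half_pos hl) fun i v => ?_
  have h1 : v ⬝ᵥ (P - M.opT K' P) i *ᵥ v = v ⬝ᵥ M.stageMat K i *ᵥ v -
      v ⬝ᵥ (M.opT K' P i - M.opT K P i) *ᵥ v := by
    have e : (P - M.opT K' P) i = M.stageMat K i - (M.opT K' P i - M.opT K P i) := by
      have : P i = M.stageMat K i + M.opT K P i := congrFun hK.PK_fixed i
      rw [Pi.sub_apply, sub_eq_iff_eq_add, this]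
      abel
    rw [e, sub_mulVec, dotProduct_sub]
  have h2 := (le_abs_self _).trans (abs_dot_mulVec_le_sum (M.opT K' P i - M.opT K P i) v v)
  have h3 := (lamMin_mul_le M.Q_posDef i v).trans (M.Q_le_stageMat K i v)
  have h4 := mul_le_mul_of_nonneg_right (h i).le (dotProduct_self_nonneg_real v)
  rw [h1]
  linarith

variable {M}

theorem IsMSS.sum_range_stage_le {K : Policy N k d} (hK : M.IsMSS K) (n : ℕ) :
    ∑ t ∈ Finset.range n, pair (M.stageMat K) ((M.opTadj K ^ t) M.X0) ≤ M.cost K := by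
  rw [hK.cost_eq_pair]
  exact sum_le_hasSum _ (fun t _ => stage_nonneg t) hK.hasSum_stage

variable (M)

/-- Each partial sum of the cost series is continuous on the whole policy space, so its bound by `α`
survives in the closure. The limit policy then has finite cost and is therefore stable. -/
theorem isClosed_sublevel [NeZero d] (α : ℝ) : IsClosed (M.sublevel α) := by
  refine isClosed_of_closure_subset fun K hK => ?_
  have hpart : ∀ n, ∑ t ∈ Finset.range n, pair (M.stageMat K) ((M.opTadj K ^ t) M.X0) ≤ α := by
    intro n
    have hc : Continuous fun K => ∑ t ∈ Finset.range n,
        pair (M.stageMat K) ((M.opTadj K ^ t) M.X0) :=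
      continuous_finsetSum _ fun t _ => M.continuous_stage t
    have hcl : IsClosed {K | ∑ t ∈ Finset.range n,
        pair (M.stageMat K) ((M.opTadj K ^ t) M.X0) ≤ α} := isClosed_le hc continuous_const
    exact closure_minimal (fun K' hK' => (IsMSS.sum_range_stage_le hK'.1 n).trans hK'.2) hcl hK
  have hsum := summable_of_sum_range_le (fun t => stage_nonneg (M := M) (K := K) t) hpart
  have hstab : M.IsMSS K := by
    refine isMSS_of_extCost_ne_top ?_
    rw [extCost_eq, ← ENNReal.ofReal_tsum_of_nonneg stage_nonneg hsum]
    exact ENNReal.ofReal_ne_top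
  refine ⟨hstab, ?_⟩
  rw [hstab.cost_eq_pair, ← hstab.hasSum_stage.tsum_eq]
  exact hsum.tsum_le_of_sum_range_le hpart

theorem norm_sq_eq (K : Policy N k d) : ‖K‖ ^ 2 = ∑ i, ((K.mat i)ᵀ * K.mat i).trace := by
  rw [EuclideanSpace.norm_sq_eq, Fintype.sum_prod_type]
  refine Finset.sum_congr rfl fun i _ => ?_
  rw [Fintype.sum_prod_type, Finset.sum_comm]
  simp [trace, mul_apply, Policy.mat, pow_two]

variable {M}

/-- Only the stage at time `0` is kept, with `X(0) ≥ μ` and `W_i ≥ Λ_min(R) K_iᵀ K_i`. -/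
theorem IsMSS.norm_sq_le_cost [NeZero d] {K : Policy N k d} (hK : M.IsMSS K) :
    M.mu * lamMin M.R * ‖K‖ ^ 2 ≤ M.cost K := by
  have h1 : pair (M.stageMat K) M.X0 ≤ M.cost K := by simpa using hK.sum_range_stage_le 1
  refine le_trans ?_ h1
  have h2 : M.mu * pair (M.stageMat K) 1 ≤ pair (M.stageMat K) M.X0 := by
    rw [pair_comm, ← pair_smul_left, pair_comm _ M.X0]
    exact pair_le_pair (fun i v => by simpa [smul_mulVec] using M.mu_mul_le i v) fun i =>
      posSemidef_of_quadForm (M.stageMat_transpose K i) (M.stageMat_nonneg K i)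
  refine le_trans ?_ h2
  rw [mul_assoc]
  refine mul_le_mul_of_nonneg_left ?_ M.mu_pos.le
  have h3 : pair (fun i => lamMin M.R • ((K.mat i)ᵀ * K.mat i)) 1 ≤ pair (M.stageMat K) 1 := by
    refine pair_le_pair (fun i v => ?_) fun i => .one
    have h4 := transpose_mul_mul_quadForm (K.mat i) 1 v
    rw [Matrix.mul_one, one_mulVec] at h4
    rw [smul_mulVec, dotProduct_smul, smul_eq_mul, h4, stageMat, add_mulVec, dotProduct_add,
      transpose_mul_mul_quadForm]
    linarith [lamMin_mul_le M.R_posDef i (K.mat i *ᵥ v),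
      (M.Q_posDef i).posSemidef.quadForm_nonneg v]
  refine le_trans (le_of_eq ?_) h3
  simp [norm_sq_eq, pair, Finset.mul_sum]

variable (M)

theorem isCompact_sublevel [NeZero d] [NeZero k] (α : ℝ) : IsCompact (M.sublevel α) := by
  refine Metric.isCompact_of_isClosed_isBounded (M.isClosed_sublevel α) ?_
  have hc : 0 < M.mu * lamMin M.R := mul_pos M.mu_pos M.lamMin_R_pos
  refine isBounded_iff_forall_norm_le.2 ⟨√(α / (M.mu * lamMin M.R)), fun K hK => ?_⟩
  refine Real.le_sqrt_of_sq_le ?_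
  rw [le_div_iff₀ hc, mul_comm]
  exact (IsMSS.norm_sq_le_cost hK.1).trans hK.2

theorem tendsto_cost_of_norm [NeZero d] [NeZero k] {Kseq : ℕ → Policy N k d}
    (hK : ∀ l, Kseq l ∈ M.stabSet) (h : Tendsto (fun l => ‖Kseq l‖) atTop atTop) :
    Tendsto (fun l => M.cost (Kseq l)) atTop atTop := by
  have hc : 0 < M.mu * lamMin M.R := mul_pos M.mu_pos M.lamMin_R_pos
  refine tendsto_atTop_mono (fun l => IsMSS.norm_sq_le_cost (hK l)) ?_
  exact ((tendsto_pow_atTop two_ne_zero).comp h).const_mul_atTop hc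

/-- If the cost were frequently below `b`, the limit would lie in a closed sublevel set and be
stable; but an open set misses its frontier. -/
theorem tendsto_cost_of_frontier [NeZero d] {Kseq : ℕ → Policy N k d}
    (hK : ∀ l, Kseq l ∈ M.stabSet) {K : Policy N k d} (hf : K ∈ frontier M.stabSet)
    (h : Tendsto Kseq atTop (𝓝 K)) : Tendsto (fun l => M.cost (Kseq l)) atTop atTop := by
  have hns : ¬ M.IsMSS K := fun hs => by
    rw [frontier, M.isOpen_stabSet.interior_eq] at hf
    exact hf.2 hs
  rw [tendsto_atTop]
  intro b
  by_contra hb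
  rw [not_eventually] at hb
  have hfreq : ∃ᶠ l in atTop, Kseq l ∈ M.sublevel b :=
    hb.mono fun l hl => ⟨hK l, (not_le.1 hl).le⟩
  exact hns ((M.isClosed_sublevel b).mem_of_frequently_of_tendsto hfreq h).1

end Topology

end MJLS

end

noncomputable section

namespace MJLS

open Matrix

/-! ### The exact cost difference and gradient dominance. -/

section Difference

variable {N d k : ℕ} {Ω : Type*} [MeasurableSpace Ω] {M : MJLS N d k Ω} {K K' : Policy N k d}

theorem mat_sub (K K' : Policy N k d) (i : Fin N) : (K - K').mat i = K.mat i - K'.mat i := rfl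

theorem mat_add (K K' : Policy N k d) (i : Fin N) : (K + K').mat i = K.mat i + K'.mat i := rfl

theorem mat_smul (s : ℝ) (K : Policy N k d) (i : Fin N) : (s • K).mat i = s • K.mat i := rfl

/-- Expansion of `KᵀRK + (A - BK)ᵀE(A - BK)` around `K`. -/
theorem riccati_expand {A E : Matrix (Fin d) (Fin d) ℝ} {B : Matrix (Fin d) (Fin k) ℝ}
    {R : Matrix (Fin k) (Fin k) ℝ} (hE : Eᵀ = E) (hR : Rᵀ = R)
    (F D : Matrix (Fin k) (Fin d) ℝ) :
    (F - D)ᵀ * R * (F - D) + (A - B * (F - D))ᵀ * E * (A - B * (F - D)) =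
      Fᵀ * R * F + (A - B * F)ᵀ * E * (A - B * F) -
        (Dᵀ * ((R + Bᵀ * E * B) * F - Bᵀ * E * A) +
          (Dᵀ * ((R + Bᵀ * E * B) * F - Bᵀ * E * A))ᵀ) + Dᵀ * (R + Bᵀ * E * B) * D := by
  simp only [transpose_sub, transpose_mul, transpose_add, transpose_transpose, Matrix.mul_sub,
    Matrix.sub_mul, Matrix.mul_add, Matrix.add_mul, Matrix.mul_assoc, hE, hR]
  abel

theorem IsMSS.opE_PK_transpose (hK : M.IsMSS K) (i : Fin N) :
    (M.opE (M.PK K) i)ᵀ = M.opE (M.PK K) i :=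
  (opE_posSemidef hK.PK_posSemidef i).transpose_eq

/-- The residual left when `P^K` is put into the Lyapunov equation of another policy; `K'` need not
be stabilizing. -/
theorem IsMSS.stageMat_add_opT (hK : M.IsMSS K) (K' : Policy N k d) :
    M.stageMat K' + M.opT K' (M.PK K) = M.PK K + fun i =>
      -(((K - K').mat i)ᵀ * M.LK K i + (((K - K').mat i)ᵀ * M.LK K i)ᵀ) +
        ((K - K').mat i)ᵀ * M.Psi K i * (K - K').mat i := by
  ext1 i
  have h1 := riccati_expand (A := M.A i) (B := M.B i) (hK.opE_PK_transpose i)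
    (M.R_posDef i).posSemidef.transpose_eq (K.mat i) ((K - K').mat i)
  have h2 : K.mat i - (K - K').mat i = K'.mat i := by rw [mat_sub]; abel
  rw [h2] at h1
  have h3 : M.PK K i = M.Q i + (K.mat i)ᵀ * M.R i * K.mat i +
      (M.Γ K i)ᵀ * M.opE (M.PK K) i * M.Γ K i := congrFun hK.PK_fixed i
  simp only [Pi.add_apply, stageMat, opT_apply]
  rw [h3, add_assoc, Γ, h1]
  simp only [LK, Psi, Γ]
  abel

/-- The cost difference of two stabilizing policies. -/
theorem IsMSS.cost_sub_cost (hK : M.IsMSS K) (hK' : M.IsMSS K') :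
    M.cost K' - M.cost K = -2 * pair (fun i => ((K - K').mat i)ᵀ * M.LK K i) (M.XK K') +
      pair (fun i => ((K - K').mat i)ᵀ * M.Psi K i * (K - K').mat i) (M.XK K') := by
  have h1 : M.cost K = pair (M.PK K) (M.XK K') - pair (M.opT K' (M.PK K)) (M.XK K') := by
    have h : pair (M.PK K) (M.XK K') =
        pair (M.PK K) M.X0 + pair (M.PK K) (M.opTadj K' (M.XK K')) := by
      rw [← pair_add_right, ← hK'.XK_fixed]
    rw [hK.cost_eq_pair_X0, pair_opT, h]
    ring
  have h2 : M.cost K' + pair (M.opT K' (M.PK K)) (M.XK K') =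
      pair (M.PK K) (M.XK K') + pair (fun i =>
        -(((K - K').mat i)ᵀ * M.LK K i + (((K - K').mat i)ᵀ * M.LK K i)ᵀ) +
        ((K - K').mat i)ᵀ * M.Psi K i * (K - K').mat i) (M.XK K') := by
    rw [hK'.cost_eq_pair, ← pair_add_left, ← pair_add_left, hK.stageMat_add_opT K']
  -- As `𝐗^{K'}` is symmetric, the two transposed linear terms contribute equally; hence the factor
  -- `2`.
  have h3 := pair_transpose (P := fun i => ((K - K').mat i)ᵀ * M.LK K i)
    (XK_transpose (M := M) (K := K'))
  have h4 : pair (fun i => -(((K - K').mat i)ᵀ * M.LK K i +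
      (((K - K').mat i)ᵀ * M.LK K i)ᵀ) + ((K - K').mat i)ᵀ * M.Psi K i * (K - K').mat i)
      (M.XK K') = -(pair (fun i => ((K - K').mat i)ᵀ * M.LK K i) (M.XK K') +
        pair (fun i => (((K - K').mat i)ᵀ * M.LK K i)ᵀ) (M.XK K')) +
      pair (fun i => ((K - K').mat i)ᵀ * M.Psi K i * (K - K').mat i) (M.XK K') := by
    simp only [pair, Matrix.add_mul, Matrix.neg_mul, trace_add, trace_neg,
      Finset.sum_add_distrib, Finset.sum_neg_distrib]
  rw [h4, h3] at h2
  linarith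

theorem tupleInner_eq_pair (H S : Fin N → Matrix (Fin d) (Fin d) ℝ) (hS : ∀ i, (S i)ᵀ = S i) :
    tupleInner H S = pair H S := by
  rw [← pair_transpose hS]
  rfl

theorem IsMSS.cost_sub_cost_tupleInner (hK : M.IsMSS K) (hK' : M.IsMSS K') :
    M.cost K' - M.cost K = -2 * tupleInner (fun i => ((K - K').mat i)ᵀ * M.LK K i) (M.XK K') +
      tupleInner (fun i => ((K - K').mat i)ᵀ * M.Psi K i * (K - K').mat i) (M.XK K') := by
  rw [tupleInner_eq_pair _ _ XK_transpose, tupleInner_eq_pair _ _ XK_transpose,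
    hK.cost_sub_cost hK']

theorem IsMSS.cost_sub_cost_trace (hK : M.IsMSS K) (hK' : M.IsMSS K') :
    M.cost K' - M.cost K = ∑ i, (-2 * (M.XK K' i * ((K - K').mat i)ᵀ * M.LK K i).trace +
      (M.XK K' i * ((K - K').mat i)ᵀ * M.Psi K i * (K - K').mat i).trace) := by
  rw [hK.cost_sub_cost hK', Finset.sum_add_distrib, ← Finset.mul_sum, pair_comm,
    pair_comm _ (M.XK K')]
  simp only [pair, Matrix.mul_assoc]

theorem IsMSS.R_le_Psi (hK : M.IsMSS K) (i : Fin N) (w : Fin k → ℝ) :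
    w ⬝ᵥ M.R i *ᵥ w ≤ w ⬝ᵥ M.Psi K i *ᵥ w := by
  rw [Psi, add_mulVec, dotProduct_add, transpose_mul_mul_quadForm]
  linarith [(opE_posSemidef (M := M) hK.PK_posSemidef i).quadForm_nonneg (M.B i *ᵥ w)]

theorem IsMSS.Psi_transpose (hK : M.IsMSS K) (i : Fin N) : (M.Psi K i)ᵀ = M.Psi K i := by
  simp only [Psi, transpose_add, transpose_mul, transpose_transpose, hK.opE_PK_transpose,
    (M.R_posDef i).posSemidef.transpose_eq, Matrix.mul_assoc]

theorem IsMSS.Psi_posDef (hK : M.IsMSS K) (i : Fin N) : (M.Psi K i).PosDef := by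
  refine .of_dotProduct_mulVec_pos (by simpa [IsHermitian] using hK.Psi_transpose i) ?_
  intro w hw
  have := (M.R_posDef i).dotProduct_mulVec_pos hw
  simp only [star_trivial] at this ⊢
  exact this.trans_le (hK.R_le_Psi i w)

theorem IsMSS.Psi_mul_inv (hK : M.IsMSS K) (i : Fin N) : M.Psi K i * (M.Psi K i)⁻¹ = 1 :=
  mul_nonsing_inv _ (isUnit_iff_isUnit_det _ |>.1 (hK.Psi_posDef i).isUnit)

theorem IsMSS.Psi_inv_transpose (hK : M.IsMSS K) (i : Fin N) :
    ((M.Psi K i)⁻¹)ᵀ = (M.Psi K i)⁻¹ := by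
  rw [transpose_nonsing_inv, hK.Psi_transpose]

theorem dot_mulVec_comm_of_symm {n : ℕ} {H : Matrix (Fin n) (Fin n) ℝ} (hH : Hᵀ = H)
    (u w : Fin n → ℝ) : w ⬝ᵥ H *ᵥ u = u ⬝ᵥ H *ᵥ w := by
  rw [dotProduct_mulVec, ← mulVec_transpose, hH, dotProduct_comm]

theorem dot_transpose_mul_mulVec {m : ℕ} (E F : Matrix (Fin m) (Fin d) ℝ) (v w : Fin d → ℝ) :
    v ⬝ᵥ (Eᵀ * F) *ᵥ w = (E *ᵥ v) ⬝ᵥ (F *ᵥ w) := by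
  rw [← mulVec_mulVec, dotProduct_mulVec, vecMul_transpose]

/-- Complete the square: the form `Ψ` is nonnegative at `u - Ψ⁻¹ l`. -/
theorem IsMSS.two_mul_sub_le_inv (hK : M.IsMSS K) (i : Fin N) (u l : Fin k → ℝ) :
    2 * (u ⬝ᵥ l) - u ⬝ᵥ M.Psi K i *ᵥ u ≤ l ⬝ᵥ (M.Psi K i)⁻¹ *ᵥ l := by
  set w := (M.Psi K i)⁻¹ *ᵥ l with hw
  have hl : M.Psi K i *ᵥ w = l := by
    rw [hw, mulVec_mulVec, hK.Psi_mul_inv, one_mulVec]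
  have h := (hK.Psi_posDef i).posSemidef.quadForm_nonneg (u - w)
  rw [mulVec_sub, dotProduct_sub, sub_dotProduct, sub_dotProduct, hl,
    dot_mulVec_comm_of_symm (hK.Psi_transpose i) u w, hl, dotProduct_comm w l] at h
  linarith

theorem IsMSS.inv_quadForm_nonneg (hK : M.IsMSS K) (i : Fin N) (l : Fin k → ℝ) :
    0 ≤ l ⬝ᵥ (M.Psi K i)⁻¹ *ᵥ l := by
  simpa using hK.two_mul_sub_le_inv i 0 l

/-- With `w = Ψ⁻¹ l` and `λ = Λ_min(R)` one has `λ |w|² ≤ w ⬝ᵥ l`; combine this with `|l - λ w|² ≥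
0`. -/
theorem IsMSS.lamMin_mul_inv_le (hK : M.IsMSS K) (i : Fin N) (l : Fin k → ℝ) :
    lamMin M.R * (l ⬝ᵥ (M.Psi K i)⁻¹ *ᵥ l) ≤ l ⬝ᵥ l := by
  set w := (M.Psi K i)⁻¹ *ᵥ l with hw
  have hl : M.Psi K i *ᵥ w = l := by
    rw [hw, mulVec_mulVec, hK.Psi_mul_inv, one_mulVec]
  have h1 := (lamMin_mul_le M.R_posDef i w).trans (hK.R_le_Psi i w)
  rw [hl, dotProduct_comm w l] at h1
  have h0 : 0 ≤ lamMin M.R := Real.iInf_nonneg fun i => sigmaMin_nonneg _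
  have h2 := dotProduct_self_nonneg_real (l - lamMin M.R • w)
  simp only [sub_dotProduct, dotProduct_sub, smul_dotProduct, dotProduct_smul, smul_eq_mul,
    dotProduct_comm w l] at h2
  nlinarith

theorem tupleInner_inv_eq (hK : M.IsMSS K) :
    tupleInner (fun i => (M.Psi K i)⁻¹ * M.LK K i) (M.LK K) =
      pair (fun i => (M.LK K i)ᵀ * (M.Psi K i)⁻¹ * M.LK K i) 1 := by
  simp only [tupleInner, pair, Pi.one_apply, Matrix.mul_one, transpose_mul,
    hK.Psi_inv_transpose]

theorem tupleInner_self_eq {m : ℕ} (V : Fin N → Matrix (Fin m) (Fin d) ℝ) :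
    tupleInner V V = pair (fun i => (V i)ᵀ * V i) 1 := by
  simp [tupleInner, pair]

/-- The square is completed pointwise under the pairing with `𝐗^{K'}`, which removes `K - K'`;
afterwards `𝐗^{K'}` is bounded by its maximal norm. -/
theorem IsMSS.cost_sub_le (hK : M.IsMSS K) (hK' : M.IsMSS K') :
    M.cost K - M.cost K' ≤
      normMax (M.XK K') * tupleInner (fun i => (M.Psi K i)⁻¹ * M.LK K i) (M.LK K) := by
  have h := hK.cost_sub_cost hK'
  set D := K - K'
  set G : Fin N → Matrix (Fin d) (Fin d) ℝ := fun i =>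
    (M.LK K i)ᵀ * (M.Psi K i)⁻¹ * M.LK K i with hG
  have hGq : ∀ i v, v ⬝ᵥ G i *ᵥ v =
      (M.LK K i *ᵥ v) ⬝ᵥ (M.Psi K i)⁻¹ *ᵥ (M.LK K i *ᵥ v) := fun i v =>
    transpose_mul_mul_quadForm _ _ _
  have h1 : pair ((2 : ℝ) • (fun i => (D.mat i)ᵀ * M.LK K i) -
      fun i => (D.mat i)ᵀ * M.Psi K i * D.mat i) (M.XK K') ≤ pair G (M.XK K') := by
    refine pair_le_pair (fun i v => ?_) hK'.XK_posSemidef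
    rw [hGq, Pi.sub_apply, Pi.smul_apply, sub_mulVec, dotProduct_sub, smul_mulVec,
      dotProduct_smul, smul_eq_mul, transpose_mul_mul_quadForm, dot_transpose_mul_mulVec]
    exact hK.two_mul_sub_le_inv i _ _
  have h2 : pair G (M.XK K') ≤ normMax (M.XK K') * pair G 1 := by
    rw [pair_comm G 1, ← pair_smul_left, pair_comm]
    refine pair_le_pair (fun i v => ?_) fun i => posSemidef_of_quadForm ?_ fun v => ?_
    · simpa [smul_mulVec] using dot_mulVec_le_normMax (M.XK K') i v
    · simp only [hG, transpose_mul, transpose_transpose, hK.Psi_inv_transpose, Matrix.mul_assoc]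
    · rw [hGq]
      exact hK.inv_quadForm_nonneg i _
  rw [pair_sub_left, pair_smul_left] at h1
  rw [tupleInner_inv_eq hK]
  linarith

theorem IsMSS.inv_le_self (hK : M.IsMSS K) :
    lamMin M.R * tupleInner (fun i => (M.Psi K i)⁻¹ * M.LK K i) (M.LK K) ≤
      tupleInner (M.LK K) (M.LK K) := by
  rw [tupleInner_inv_eq hK, tupleInner_self_eq, ← pair_smul_left]
  refine pair_le_pair (fun i v => ?_) fun i => .one
  rw [Pi.smul_apply, smul_mulVec, dotProduct_smul, smul_eq_mul, transpose_mul_mul_quadForm,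
    dot_transpose_mul_mulVec]
  exact hK.lamMin_mul_inv_le i _

/-- From `𝐗 ≥ μ` and `|𝐗 v - μ v|² ≥ 0`. -/
theorem IsMSS.mu_sq_mul_le (hK : M.IsMSS K) [NeZero d] (i : Fin N) (v : Fin d → ℝ) :
    M.mu ^ 2 * (v ⬝ᵥ v) ≤ (M.XK K i *ᵥ v) ⬝ᵥ (M.XK K i *ᵥ v) := by
  have h1 := hK.mu_le_XK i v
  have h2 := M.mu_pos
  have h3 := dotProduct_self_nonneg_real (M.XK K i *ᵥ v - M.mu • v)
  simp only [sub_dotProduct, dotProduct_sub, smul_dotProduct, dotProduct_smul, smul_eq_mul,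
    dotProduct_comm (M.XK K i *ᵥ v) v] at h3
  nlinarith

theorem IsMSS.mu_sq_mul_tupleInner_le (hK : M.IsMSS K) [NeZero d]
    (V : Fin N → Matrix (Fin k) (Fin d) ℝ) :
    M.mu ^ 2 * tupleInner V V ≤
      tupleInner (fun i => V i * M.XK K i) fun i => V i * M.XK K i := by
  have e1 : tupleInner V V = pair 1 fun i => (V i)ᵀ * V i := by
    rw [tupleInner_self_eq, pair_comm]
  have e2 : tupleInner (fun i => V i * M.XK K i) (fun i => V i * M.XK K i) =
      pair (fun i => M.XK K i * M.XK K i) fun i => (V i)ᵀ * V i := by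
    refine Finset.sum_congr rfl fun i _ => ?_
    rw [transpose_mul, XK_transpose, ← Matrix.mul_assoc, trace_mul_comm]
    simp only [Matrix.mul_assoc]
  rw [e1, e2, ← pair_smul_left]
  refine pair_le_pair (fun i v => ?_) fun i => ?_
  · have h := dot_transpose_mul_mulVec (M.XK K i) (M.XK K i) v v
    rw [XK_transpose] at h
    rw [h]
    simpa [smul_mulVec] using hK.mu_sq_mul_le i v
  · simpa using posSemidef_conjTranspose_mul_self (V i)

end Difference

end MJLS

end

noncomputable section

namespace MJLS

open Matrix

/-! ### Smooth dependence of the correlations and of the cost on the policy. -/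

section Smooth

variable {N d k : ℕ} {Ω : Type*} [MeasurableSpace Ω] (M : MJLS N d k Ω)

theorem contDiff_mat {n : WithTop ℕ∞} (i : Fin N) (a : Fin k) (b : Fin d) :
    ContDiff ℝ n fun K : Policy N k d => K.mat i a b := by
  simp only [Policy.mat, of_apply]
  fun_prop

theorem contDiff_Γ {n : WithTop ℕ∞} (i : Fin N) (α β : Fin d) :
    ContDiff ℝ n fun K => M.Γ K i α β := by
  simp only [Γ, Matrix.sub_apply, mul_apply]
  exact contDiff_const.sub (ContDiff.sum fun a _ => contDiff_const.mul (contDiff_mat i a β))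

theorem contDiff_stageMat {n : WithTop ℕ∞} (i : Fin N) (α β : Fin d) :
    ContDiff ℝ n fun K => M.stageMat K i α β := by
  simp only [stageMat, Matrix.add_apply, mul_apply, transpose_apply]
  exact contDiff_const.add (ContDiff.sum fun a _ =>
    (ContDiff.sum fun b _ => (contDiff_mat i b α).mul contDiff_const).mul (contDiff_mat i a β))

section

attribute [local instance] Matrix.normedAddCommGroup Matrix.normedSpace

theorem contDiff_opTadj {n : WithTop ℕ∞} : ContDiff ℝ n fun K =>
    Module.End.toContinuousLinearMap (𝕜 := ℝ) (Fin N → Matrix (Fin d) (Fin d) ℝ) (M.opTadj K) := by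
  rw [contDiff_clm_apply_iff]
  intro S
  refine contDiff_pi.2 fun j => contDiff_pi.2 fun α => contDiff_pi.2 fun β => ?_
  have e : (fun K => M.opTadj K S j α β) = fun K =>
      ∑ i, M.p i j * ∑ γ, (∑ δ, M.Γ K i α δ * S i δ γ) * M.Γ K i β γ := by
    ext K
    simp [opTadj_apply, Matrix.sum_apply, mul_apply]
  suffices h : ContDiff ℝ n fun K => M.opTadj K S j α β from h
  rw [e]
  exact ContDiff.sum fun i _ => contDiff_const.mul <| ContDiff.sum fun γ _ =>
    (ContDiff.sum fun δ _ => (M.contDiff_Γ i α δ).mul contDiff_const).mul (M.contDiff_Γ i β γ)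

variable {M}

theorem IsMSS.isUnit_one_sub {K : Policy N k d} (hK : M.IsMSS K) :
    IsUnit (1 - Module.End.toContinuousLinearMap (𝕜 := ℝ)
      (Fin N → Matrix (Fin d) (Fin d) ℝ) (M.opTadj K)) := by
  have h : IsUnit (1 - M.opTadj K) := by
    rw [LinearMap.isUnit_iff_ker_eq_bot]
    exact LinearMap.ker_eq_bot.2 hK.injective_one_sub_opTadj
  have := h.map (Module.End.toContinuousLinearMap (𝕜 := ℝ) (Fin N → Matrix (Fin d) (Fin d) ℝ))
  rwa [map_sub, map_one] at this

/-- Near `K` all policies are stabilizing, so `𝐗` is the inverse of `1 - opTadj` applied to `X(0)`.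
The operator is polynomial in the policy, and inversion is smooth at units. -/
theorem IsMSS.contDiffAt_XK [NeZero d] {n : WithTop ℕ∞} {K : Policy N k d} (hK : M.IsMSS K)
    (i : Fin N) (α β : Fin d) : ContDiffAt ℝ n (fun K => M.XK K i α β) K := by
  let A := fun K => 1 - Module.End.toContinuousLinearMap (𝕜 := ℝ)
    (Fin N → Matrix (Fin d) (Fin d) ℝ) (M.opTadj K)
  have hA : ContDiff ℝ n A := contDiff_const.sub M.contDiff_opTadj
  have hinv : ContDiffAt ℝ n (fun K => Ring.inverse (A K)) K := by
    obtain ⟨u, hu⟩ := hK.isUnit_one_sub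
    have h := contDiffAt_ringInverse (n := n) ℝ u
    rw [hu] at h
    exact h.comp K hA.contDiffAt
  have hX : ContDiffAt ℝ n (fun K => Ring.inverse (A K) M.X0) K :=
    hinv.clm_apply contDiffAt_const
  have he : M.XK =ᶠ[𝓝 K] fun K => Ring.inverse (A K) M.X0 := by
    filter_upwards [M.isOpen_stabSet.mem_nhds hK] with K' (hK' : M.IsMSS K')
    have h0 : A K' (M.XK K') = M.X0 := by
      have h := hK'.XK_fixed
      exact sub_eq_iff_eq_add.2 h
    have h1 := Ring.inverse_mul_cancel _ hK'.isUnit_one_sub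
    have h2 := DFunLike.congr_fun h1 (M.XK K')
    rw [← h0]
    exact h2.symm
  have := hX.congr_of_eventuallyEq he
  exact contDiffAt_pi.1 (contDiffAt_pi.1 (contDiffAt_pi.1 this i) α) β

end

variable {M}

theorem IsMSS.eventually [NeZero d] {K : Policy N k d} (hK : M.IsMSS K) :
    ∀ᶠ K' in 𝓝 K, M.IsMSS K' :=
  M.isOpen_stabSet.mem_nhds hK

theorem IsMSS.contDiffAt_cost [NeZero d] {n : WithTop ℕ∞} {K : Policy N k d} (hK : M.IsMSS K) :
    ContDiffAt ℝ n M.cost K := by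
  have he : M.cost =ᶠ[𝓝 K] fun K => pair (M.stageMat K) (M.XK K) := by
    filter_upwards [hK.eventually] with K' hK' using hK'.cost_eq_pair
  refine ContDiffAt.congr_of_eventuallyEq ?_ he
  simp only [pair, trace, diag_apply, mul_apply]
  exact ContDiffAt.sum fun i _ => ContDiffAt.sum fun α _ => ContDiffAt.sum fun β _ =>
    (M.contDiff_stageMat i α β).contDiffAt.mul (hK.contDiffAt_XK i β α)

theorem IsMSS.continuousAt_XK [NeZero d] {K : Policy N k d} (hK : M.IsMSS K)
    (i : Fin N) (α β : Fin d) : ContinuousAt (fun K => M.XK K i α β) K :=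
  (hK.contDiffAt_XK (n := 0) i α β).continuousAt

end Smooth

/-! ### Expansion along lines and the gradient. -/

section Expansion

variable {N d k : ℕ} {Ω : Type*} [MeasurableSpace Ω] {M : MJLS N d k Ω} {K : Policy N k d}

/-- An exact identity: the coefficients of `s` and `s ^ 2` still contain `𝐗` at the moved policy.
Continuity of `𝐗` then gives the first derivative, and its first-order variation the second. -/
theorem IsMSS.cost_line (hK : M.IsMSS K) {E : Policy N k d} {s : ℝ}
    (hs : M.IsMSS (K + s • E)) :
    M.cost (K + s • E) - M.cost K =
      s * (2 * pair (fun i => (E.mat i)ᵀ * M.LK K i) (M.XK (K + s • E))) +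
      s ^ 2 * pair (fun i => (E.mat i)ᵀ * M.Psi K i * E.mat i) (M.XK (K + s • E)) := by
  rw [hK.cost_sub_cost hs]
  have e : ∀ i, (K - (K + s • E)).mat i = -s • E.mat i := by
    intro i
    rw [sub_add_cancel_left, ← neg_smul, mat_smul]
  simp only [e]
  have e1 : pair (fun i => (-s • E.mat i)ᵀ * M.LK K i) (M.XK (K + s • E)) =
      -s * pair (fun i => (E.mat i)ᵀ * M.LK K i) (M.XK (K + s • E)) := by
    rw [← pair_smul_left]
    congr 1
    ext1 i
    rw [transpose_smul, Matrix.smul_mul, Pi.smul_apply]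
  have e2 : pair (fun i => (-s • E.mat i)ᵀ * M.Psi K i * (-s • E.mat i)) (M.XK (K + s • E)) =
      s ^ 2 * pair (fun i => (E.mat i)ᵀ * M.Psi K i * E.mat i) (M.XK (K + s • E)) := by
    rw [← pair_smul_left]
    congr 1
    ext1 i
    rw [transpose_smul, Matrix.smul_mul, Matrix.smul_mul, Matrix.mul_smul, Pi.smul_apply, smul_smul]
    congr 1
    ring
  rw [e1, e2]
  ring

theorem tendsto_line (K E : Policy N k d) :
    Tendsto (fun s : ℝ => K + s • E) (𝓝[≠] 0) (𝓝 K) := by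
  have : Tendsto (fun s : ℝ => K + s • E) (𝓝 0) (𝓝 (K + (0 : ℝ) • E)) :=
    (Continuous.tendsto (by fun_prop) 0)
  rw [zero_smul, add_zero] at this
  exact this.mono_left nhdsWithin_le_nhds

theorem IsMSS.tendsto_pair_line [NeZero d] (hK : M.IsMSS K) (E : Policy N k d)
    (H : Fin N → Matrix (Fin d) (Fin d) ℝ) :
    Tendsto (fun s : ℝ => pair H (M.XK (K + s • E))) (𝓝[≠] 0) (𝓝 (pair H (M.XK K))) :=
  MJLS.tendsto_pair H fun i α β => (hK.continuousAt_XK i α β).tendsto.comp (tendsto_line K E)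

theorem tendsto_id_nhdsNE_zero : Tendsto (fun s : ℝ => s) (𝓝[≠] 0) (𝓝 0) :=
  tendsto_id.mono_left nhdsWithin_le_nhds

theorem hasDerivAt_line {f : Policy N k d → ℝ} {K E : Policy N k d} {s : ℝ}
    (hf : DifferentiableAt ℝ f (K + s • E)) :
    HasDerivAt (fun s : ℝ => f (K + s • E)) (fderiv ℝ f (K + s • E) E) s := by
  have h : HasDerivAt (fun s : ℝ => K + s • E) E s := by
    simpa using ((hasDerivAt_id s).smul_const E).const_add K
  exact hf.hasFDerivAt.comp_hasDerivAt s h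

theorem IsMSS.fderiv_cost [NeZero d] (hK : M.IsMSS K) (E : Policy N k d) :
    fderiv ℝ M.cost K E = 2 * pair (fun i => (E.mat i)ᵀ * M.LK K i) (M.XK K) := by
  have hd : DifferentiableAt ℝ M.cost K := (hK.contDiffAt_cost (n := 1)).differentiableAt one_ne_zero
  have h1 := hasDerivAt_line (f := M.cost) (K := K) (E := E) (s := 0) (by simpa using hd)
  rw [hasDerivAt_iff_tendsto_slope_zero] at h1
  simp only [zero_smul, add_zero, zero_add] at h1
  refine tendsto_nhds_unique h1 ?_
  have h2 := ((hK.tendsto_pair_line E fun i => (E.mat i)ᵀ * M.LK K i).const_mul 2).add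
    (tendsto_id_nhdsNE_zero.mul
      (hK.tendsto_pair_line E fun i => (E.mat i)ᵀ * M.Psi K i * E.mat i))
  rw [zero_mul, add_zero] at h2
  refine h2.congr' ?_
  filter_upwards [(tendsto_line K E).eventually hK.eventually, self_mem_nhdsWithin] with s hs hs0
  have hs0 : s ≠ 0 := hs0
  rw [hK.cost_line hs, smul_eq_mul]
  field_simp

/-- The policy with gain matrices `V i`. -/
def ofMat (V : Fin N → Matrix (Fin k) (Fin d) ℝ) : Policy N k d :=
  WithLp.toLp 2 fun x => V x.1 x.2.1 x.2.2

theorem mat_ofMat (V : Fin N → Matrix (Fin k) (Fin d) ℝ) (i : Fin N) : (ofMat V).mat i = V i := rfl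

theorem inner_eq_tupleInner (K E : Policy N k d) :
    inner ℝ K E = tupleInner K.mat E.mat := by
  rw [PiLp.inner_apply, Fintype.sum_prod_type]
  refine Finset.sum_congr rfl fun i _ => ?_
  rw [Fintype.sum_prod_type, Finset.sum_comm]
  simp [trace, mul_apply, Policy.mat, mul_comm]

theorem inner_gradient (f : Policy N k d → ℝ) (K E : Policy N k d) :
    inner ℝ (∇ f K) E = fderiv ℝ f K E := by
  rw [← toDual_gradient, InnerProductSpace.toDual_apply_apply]

theorem IsMSS.gradient_cost [NeZero d] (hK : M.IsMSS K) :
    ∇ M.cost K = (2 : ℝ) • ofMat fun i => M.LK K i * M.XK K i := by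
  refine ext_inner_right ℝ fun E => ?_
  rw [inner_gradient, hK.fderiv_cost, real_inner_smul_left, real_inner_comm, inner_eq_tupleInner]
  simp only [tupleInner, pair, mat_ofMat, Matrix.mul_assoc]

theorem IsMSS.norm_gradient_sq [NeZero d] (hK : M.IsMSS K) :
    ‖∇ M.cost K‖ ^ 2 = 4 * tupleInner (fun i => M.LK K i * M.XK K i)
      fun i => M.LK K i * M.XK K i := by
  rw [← real_inner_self_eq_norm_sq, hK.gradient_cost, real_inner_smul_left,
    real_inner_smul_right, inner_eq_tupleInner, ← mul_assoc]
  norm_num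
  rfl

end Expansion

end MJLS

end

noncomputable section

namespace MJLS

open Matrix

/-! ### The quadratic form of the Hessian. -/

section Hessian

variable {N d k : ℕ} {Ω : Type*} [MeasurableSpace Ω] {M : MJLS N d k Ω} {K : Policy N k d}

/-- Second-order expansion of a function of one variable. -/
theorem tendsto_second_order {φ φ' : ℝ → ℝ} {c : ℝ} (h1 : ∀ᶠ s in 𝓝 0, HasDerivAt φ (φ' s) s)
    (h2 : HasDerivAt φ' c 0) :
    Tendsto (fun s => (φ s - φ 0 - s * φ' 0) / s ^ 2) (𝓝[≠] 0) (𝓝 (c / 2)) := by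
  have hne : ∀ᶠ s : ℝ in 𝓝[≠] 0, s ≠ 0 := self_mem_nhdsWithin
  have hcont : Tendsto φ (𝓝[≠] 0) (𝓝 (φ 0)) :=
    h1.self_of_nhds.continuousAt.tendsto.mono_left nhdsWithin_le_nhds
  -- One use of L'Hôpital's rule leaves `(φ' s - φ' 0) / (2 s)`, half a difference quotient of `φ'`.
  refine HasDerivAt.lhopital_zero_nhdsNE (f' := fun s => φ' s - φ' 0) (g' := fun s => 2 * s)
    ?_ ?_ ?_ ?_ ?_ ?_
  · filter_upwards [h1.filter_mono nhdsWithin_le_nhds] with s hs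
    simpa using (hs.sub_const (φ 0)).fun_sub ((hasDerivAt_id s).mul_const (φ' 0))
  · exact .of_forall fun s => by simpa using hasDerivAt_pow 2 s
  · filter_upwards [hne] with s hs using by simpa using hs
  · simpa using (hcont.sub_const (φ 0)).sub (tendsto_id_nhdsNE_zero.mul_const (φ' 0))
  · simpa using tendsto_id_nhdsNE_zero.pow 2
  · rw [hasDerivAt_iff_tendsto_slope_zero] at h2
    refine (h2.div_const 2).congr' ?_
    filter_upwards [hne] with s hs
    simp only [zero_add, smul_eq_mul]
    field_simp

theorem ContDiffAt.differentiableAt_fderiv {f : Policy N k d → ℝ} (hf : ContDiffAt ℝ 2 f K) :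
    DifferentiableAt ℝ (fderiv ℝ f) K :=
  (hf.fderiv_right (m := 1) (by norm_num)).differentiableAt one_ne_zero

theorem inner_fderiv_gradient {f : Policy N k d → ℝ} (hf : ContDiffAt ℝ 2 f K)
    (E F : Policy N k d) :
    inner ℝ (fderiv ℝ (∇ f) K E) F = fderiv ℝ (fderiv ℝ f) K E F := by
  have h := ContDiffAt.differentiableAt_fderiv hf
  have hg : DifferentiableAt ℝ (∇ f) K := by
    rw [differentiableAt_euclidean]
    intro x
    have e : (fun K => ∇ f K x) = fun K => fderiv ℝ f K (EuclideanSpace.single x 1) := by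
      ext K
      rw [← inner_gradient, real_inner_comm, EuclideanSpace.inner_single_left]
      simp
    rw [e]
    exact h.clm_apply (differentiableAt_const _)
  have h1 := fderiv_inner_apply ℝ hg (differentiableAt_const F) E
  simp only [inner_gradient, fderiv_fun_const, Pi.zero_apply, _root_.zero_apply,
    inner_zero_right, zero_add] at h1
  rw [← h1, fderiv_clm_apply h (differentiableAt_const F)]
  simp

theorem hasDerivAt_fderiv_line {f : Policy N k d → ℝ} {E : Policy N k d} {s : ℝ}
    (hf : ContDiffAt ℝ 2 f (K + s • E)) :
    HasDerivAt (fun s : ℝ => fderiv ℝ f (K + s • E) E)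
      (inner ℝ (fderiv ℝ (∇ f) (K + s • E) E) E) s := by
  rw [inner_fderiv_gradient hf]
  have h : HasDerivAt (fun s : ℝ => K + s • E) E s := by
    simpa using ((hasDerivAt_id s).smul_const E).const_add K
  have h2 := (ContDiffAt.differentiableAt_fderiv hf).hasFDerivAt.comp_hasDerivAt s h
  simpa using h2.clm_apply (hasDerivAt_const s E)

theorem IsMSS.tendsto_cost_second_order [NeZero d] (hK : M.IsMSS K) (E : Policy N k d) :
    Tendsto (fun s : ℝ => (M.cost (K + s • E) - M.cost K - s * fderiv ℝ M.cost K E) / s ^ 2)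
      (𝓝[≠] 0) (𝓝 (inner ℝ (fderiv ℝ (∇ M.cost) K E) E / 2)) := by
  have hl : Tendsto (fun s : ℝ => K + s • E) (𝓝 0) (𝓝 K) := by
    have : Tendsto (fun s : ℝ => K + s • E) (𝓝 0) (𝓝 (K + (0 : ℝ) • E)) :=
      Continuous.tendsto (by fun_prop) 0
    simpa using this
  have h1 : ∀ᶠ s : ℝ in 𝓝 0, HasDerivAt (fun s : ℝ => M.cost (K + s • E))
      (fderiv ℝ M.cost (K + s • E) E) s := by
    filter_upwards [hl.eventually hK.eventually] with s hs
    exact hasDerivAt_line ((hs.contDiffAt_cost (n := 1)).differentiableAt one_ne_zero)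
  have h2 := hasDerivAt_fderiv_line (f := M.cost) (K := K) (E := E) (s := 0)
    (by simpa using hK.contDiffAt_cost)
  have := tendsto_second_order h1 h2
  simpa using this

theorem Γ_line (K E : Policy N k d) (s : ℝ) (i : Fin N) :
    M.Γ (K + s • E) i = M.Γ K i - s • (M.B i * E.mat i) := by
  rw [Γ, Γ, mat_add, mat_smul, Matrix.mul_add, Matrix.mul_smul]
  abel

theorem opT_line (K E : Policy N k d) (s : ℝ) (P : Fin N → Matrix (Fin d) (Fin d) ℝ) :
    M.opT (K + s • E) P - M.opT K P =
      (-s) • (fun i => (M.B i * E.mat i)ᵀ * M.opE P i * M.Γ K i +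
        (M.Γ K i)ᵀ * M.opE P i * (M.B i * E.mat i)) +
      s ^ 2 • fun i => (M.B i * E.mat i)ᵀ * M.opE P i * (M.B i * E.mat i) := by
  ext1 i
  simp only [Pi.sub_apply, Pi.add_apply, Pi.smul_apply, opT_apply, Γ_line]
  generalize M.B i * E.mat i = D
  simp only [transpose_sub, transpose_smul, Matrix.sub_mul, Matrix.mul_sub, Matrix.smul_mul,
    Matrix.mul_smul, smul_smul, smul_sub, smul_add, neg_smul, pow_two]
  abel

/-- The symmetrized direction `Eᵀ L + Lᵀ E`. -/
def symDir (M : MJLS N d k Ω) (K E : Policy N k d) (i : Fin N) : Matrix (Fin d) (Fin d) ℝ :=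
  (E.mat i)ᵀ * M.LK K i + ((E.mat i)ᵀ * M.LK K i)ᵀ

theorem symDir_transpose (E : Policy N k d) (i : Fin N) :
    (symDir M K E i)ᵀ = symDir M K E i := by
  rw [symDir, transpose_add, transpose_transpose, add_comm]

theorem pair_symDir (E : Policy N k d) {S : Fin N → Matrix (Fin d) (Fin d) ℝ}
    (hS : ∀ i, (S i)ᵀ = S i) :
    pair (symDir M K E) S = 2 * pair (fun i => (E.mat i)ᵀ * M.LK K i) S := by
  have h := pair_transpose (P := fun i => (E.mat i)ᵀ * M.LK K i) hS
  have h2 : pair (symDir M K E) S = pair (fun i => (E.mat i)ᵀ * M.LK K i) S +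
      pair (fun i => ((E.mat i)ᵀ * M.LK K i)ᵀ) S := by
    rw [← pair_add_left]
    rfl
  rw [h2, h]
  ring

/-- Adjoint method: the variation of `𝐗` tested against `H` becomes an explicit variation of `opT`
applied to the dual solution `P`, so that `𝐗` itself need not be differentiated. -/
theorem IsMSS.pair_XK_sub (hK : M.IsMSS K) {K' : Policy N k d} (hK' : M.IsMSS K')
    {P H : Fin N → Matrix (Fin d) (Fin d) ℝ} (hP : P = H + M.opT K P) :
    pair H (M.XK K') - pair H (M.XK K) = pair (M.opT K' P - M.opT K P) (M.XK K') := by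
  have h1 : pair P M.X0 = pair H (M.XK K) := pair_eq_pair_of_fixed hP hK.XK_fixed
  have h2 : pair P (M.XK K') = pair P M.X0 + pair P (M.opTadj K' (M.XK K')) := by
    rw [← pair_add_right, ← hK'.XK_fixed]
  have h3 : pair P (M.XK K') = pair H (M.XK K') + pair (M.opT K P) (M.XK K') := by
    rw [← pair_add_left, ← hP]
  rw [pair_sub_left, pair_opT]
  linarith

/-- Dividing the exact second-order remainder by `s ^ 2` leaves a limit that only needs continuity
of `𝐗`; it is compared with the Taylor limit, which is half the Hessian form. -/
theorem IsMSS.hessian_quadForm [NeZero d] (hK : M.IsMSS K) (E : Policy N k d)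
    {P : Fin N → Matrix (Fin d) (Fin d) ℝ} (hP : P = symDir M K E + M.opT K P) :
    inner ℝ (fderiv ℝ (∇ M.cost) K E) E =
      2 * pair (fun i => (E.mat i)ᵀ * M.Psi K i * E.mat i) (M.XK K) -
      4 * pair (fun i => (M.B i * E.mat i)ᵀ * M.opE P i * M.Γ K i) (M.XK K) := by
  set G : Fin N → Matrix (Fin d) (Fin d) ℝ := fun i => (M.B i * E.mat i)ᵀ * M.opE P i * M.Γ K i
    with hG
  set G' : Fin N → Matrix (Fin d) (Fin d) ℝ := fun i =>
    (M.B i * E.mat i)ᵀ * M.opE P i * M.Γ K i + (M.Γ K i)ᵀ * M.opE P i * (M.B i * E.mat i)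
  set G'' : Fin N → Matrix (Fin d) (Fin d) ℝ := fun i =>
    (M.B i * E.mat i)ᵀ * M.opE P i * (M.B i * E.mat i)
  set H : Fin N → Matrix (Fin d) (Fin d) ℝ := fun i => (E.mat i)ᵀ * M.Psi K i * E.mat i
  have hPt : ∀ i, (P i)ᵀ = P i := hK.transpose_eq hP (symDir_transpose E)
  have hEt : ∀ i, (M.opE P i)ᵀ = M.opE P i := by
    intro i
    rw [opE_transpose]
    simp only [hPt]
  have hG' : pair G' (M.XK K) = 2 * pair G (M.XK K) := by
    have h := pair_transpose (P := G) (XK_transpose (M := M) (K := K))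
    have h2 : pair G' (M.XK K) = pair G (M.XK K) + pair (fun i => (G i)ᵀ) (M.XK K) := by
      rw [← pair_add_left]
      congr 1
      ext1 i
      simp only [hG, G', Pi.add_apply, transpose_mul, transpose_transpose, hEt, Matrix.mul_assoc]
    rw [h2, h]
    ring
  have hlim := hK.tendsto_cost_second_order E
  have hlim2 : Tendsto (fun s : ℝ => -pair G' (M.XK (K + s • E)) +
      s * pair G'' (M.XK (K + s • E)) + pair H (M.XK (K + s • E))) (𝓝[≠] 0)
      (𝓝 (-pair G' (M.XK K) + 0 * pair G'' (M.XK K) + pair H (M.XK K))) :=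
    (((hK.tendsto_pair_line E G').neg).add
      (tendsto_id_nhdsNE_zero.mul (hK.tendsto_pair_line E G''))).add (hK.tendsto_pair_line E H)
  have := tendsto_nhds_unique hlim (hlim2.congr' ?_)
  · rw [hG'] at this
    linarith
  · filter_upwards [(tendsto_line K E).eventually hK.eventually, self_mem_nhdsWithin] with s hs hs0
    have hs0 : s ≠ 0 := hs0
    -- The remainder contains `2 s` times the variation of `⟨EᵀL, 𝐗⟩`. By this identity that
    -- variation is itself of order `s`, so a factor `s ^ 2` splits off.
    have h1 := hK.pair_XK_sub hs hP
    rw [opT_line, pair_add_left, pair_smul_left, pair_smul_left, pair_symDir _ XK_transpose,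
      pair_symDir _ XK_transpose] at h1
    rw [hK.cost_line hs, hK.fderiv_cost, eq_div_iff (pow_ne_zero 2 hs0)]
    linear_combination (-s) * h1

end Hessian

/-! ### Bounds on a sublevel set and the smoothness constant. -/

section Bounds

variable {N d k : ℕ} {Ω : Type*} [MeasurableSpace Ω] {M : MJLS N d k Ω} {K : Policy N k d}

theorem IsMSS.pair_one_XK_le [NeZero d] (hK : M.IsMSS K) {α : ℝ} (hα : M.cost K ≤ α) :
    pair 1 (M.XK K) ≤ α / lamMin M.Q := by
  rw [le_div_iff₀ M.lamMin_Q_pos, mul_comm, ← pair_smul_left]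
  refine le_trans ?_ (hK.cost_eq_pair ▸ hα)
  refine pair_le_pair (fun i v => ?_) hK.XK_posSemidef
  simpa [smul_mulVec] using
      (lamMin_mul_le M.Q_posDef i v).trans (M.Q_le_stageMat K i v)

/-- `P_i ≤ tr P_i`, and `μ ∑ tr P_i ≤ ⟨P, X(0)⟩`, which is the cost. -/
theorem IsMSS.PK_quadForm_le [NeZero d] (hK : M.IsMSS K) {α : ℝ} (hα : M.cost K ≤ α)
    (i : Fin N) (v : Fin d → ℝ) : v ⬝ᵥ M.PK K i *ᵥ v ≤ α / M.mu * (v ⬝ᵥ v) := by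
  refine (dot_mulVec_le_trace (hK.PK_posSemidef i) v).trans ?_
  refine mul_le_mul_of_nonneg_right ?_ (dotProduct_self_nonneg_real v)
  rw [le_div_iff₀ M.mu_pos, mul_comm]
  have h1 : M.mu * pair 1 (M.PK K) ≤ M.cost K := by
    rw [hK.cost_eq_pair_X0, pair_comm _ M.X0, ← pair_smul_left]
    exact pair_le_pair (fun i v => by simpa [smul_mulVec] using M.mu_mul_le i v) hK.PK_posSemidef
  have h2 : (M.PK K i).trace ≤ pair 1 (M.PK K) := by
    rw [pair_one]
    exact Finset.single_le_sum (f := fun i => (M.PK K i).trace)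
      (fun i _ => (hK.PK_posSemidef i).trace_nonneg) (Finset.mem_univ i)
  exact (mul_le_mul_of_nonneg_left h2 M.mu_pos.le).trans (h1.trans hα)

theorem dot_opE (P : Fin N → Matrix (Fin d) (Fin d) ℝ) (i : Fin N) (u v : Fin d → ℝ) :
    u ⬝ᵥ M.opE P i *ᵥ v = ∑ j, M.p i j * (u ⬝ᵥ P j *ᵥ v) := by
  rw [opE, sum_mulVec, dotProduct_sum]
  exact Finset.sum_congr rfl fun j _ => by rw [smul_mulVec, dotProduct_smul, smul_eq_mul]

theorem opE_quadForm_le {P : Fin N → Matrix (Fin d) (Fin d) ℝ} {c : ℝ}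
    (h : ∀ i v, v ⬝ᵥ P i *ᵥ v ≤ c * (v ⬝ᵥ v)) (i : Fin N) (v : Fin d → ℝ) :
    v ⬝ᵥ M.opE P i *ᵥ v ≤ c * (v ⬝ᵥ v) := by
  rw [dot_opE]
  refine (Finset.sum_le_sum fun j _ => mul_le_mul_of_nonneg_left (h j v) (M.p_nonneg i j)).trans ?_
  rw [← Finset.sum_mul, M.p_sum, one_mul]

theorem opE_abs_quadForm_le {P : Fin N → Matrix (Fin d) (Fin d) ℝ} {c : ℝ}
    (h : ∀ i v, |v ⬝ᵥ P i *ᵥ v| ≤ c * (v ⬝ᵥ v)) (i : Fin N) (v : Fin d → ℝ) :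
    |v ⬝ᵥ M.opE P i *ᵥ v| ≤ c * (v ⬝ᵥ v) := by
  rw [abs_le]
  refine ⟨?_, opE_quadForm_le (fun i v => (le_abs_self _).trans (h i v)) i v⟩
  have := opE_quadForm_le (M := M) (P := -P) (c := c)
    (fun i v => by
      rw [Pi.neg_apply, neg_mulVec, dotProduct_neg]
      exact (neg_le_abs _).trans (h i v)) i v
  rw [dot_opE] at this ⊢
  simp only [Pi.neg_apply, neg_mulVec, dotProduct_neg, mul_neg, Finset.sum_neg_distrib] at this
  linarith

theorem mat_mulVec_dot_le {E : Policy N k d} (hE : ‖E‖ ≤ 1) (i : Fin N) (v : Fin d → ℝ) :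
    (E.mat i *ᵥ v) ⬝ᵥ (E.mat i *ᵥ v) ≤ v ⬝ᵥ v := by
  have hps : ∀ i, ((E.mat i)ᵀ * E.mat i).PosSemidef := fun i => by
    simpa using posSemidef_conjTranspose_mul_self (E.mat i)
  rw [← dot_transpose_mul_mulVec]
  refine (dot_mulVec_le_trace (hps i) v).trans ?_
  have h1 : ((E.mat i)ᵀ * E.mat i).trace ≤ ‖E‖ ^ 2 := by
    rw [norm_sq_eq]
    exact Finset.single_le_sum (f := fun i => ((E.mat i)ᵀ * E.mat i).trace)
      (fun i _ => (hps i).trace_nonneg) (Finset.mem_univ i)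
  have h2 : ‖E‖ ^ 2 ≤ 1 := pow_le_one₀ (norm_nonneg _) hE
  exact mul_le_of_le_one_left (dotProduct_self_nonneg_real v) (h1.trans h2)

theorem IsMSS.Psi_quadForm_le [NeZero d] (hK : M.IsMSS K) {α : ℝ} (hα : M.cost K ≤ α)
    (i : Fin N) (w : Fin k → ℝ) :
    w ⬝ᵥ M.Psi K i *ᵥ w ≤ (normMax M.R + normMax M.B ^ 2 * (α / M.mu)) * (w ⬝ᵥ w) := by
  rw [Psi, add_mulVec, dotProduct_add, transpose_mul_mul_quadForm]
  have h1 := dot_mulVec_le_normMax M.R i w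
  have h2 := opE_quadForm_le (M := M) (hK.PK_quadForm_le hα) i (M.B i *ᵥ w)
  have h3 := mulVec_dot_mulVec_le_normMax M.B i w
  have h0 : 0 ≤ α / M.mu := div_nonneg (ENNReal.toReal_nonneg.trans hα) M.mu_pos.le
  have h4 := mul_le_mul_of_nonneg_left h3 h0
  linarith

theorem cost_nonneg (K : Policy N k d) : 0 ≤ M.cost K := ENNReal.toReal_nonneg

/-- In this form the source `EᵀL + LᵀE` splits into a term weighted by `R` and a term weighted by
`E(P)`, each accessible to the arithmetic–geometric inequality. -/
theorem LK_eq (K : Policy N k d) (i : Fin N) :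
    M.LK K i = M.R i * K.mat i - (M.B i)ᵀ * M.opE (M.PK K) i * M.Γ K i := by
  simp only [LK, Psi, Γ, Matrix.add_mul, Matrix.mul_sub, Matrix.mul_assoc]
  abel

theorem abs_two_mul_dot_le {n : ℕ} {H : Matrix (Fin n) (Fin n) ℝ} (hH : H.PosSemidef)
    (u w : Fin n → ℝ) : |2 * (u ⬝ᵥ H *ᵥ w)| ≤ u ⬝ᵥ H *ᵥ u + w ⬝ᵥ H *ᵥ w := by
  have h1 := hH.quadForm_nonneg (u + w)
  have h2 := hH.quadForm_nonneg (u - w)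
  simp only [mulVec_add, mulVec_sub, dotProduct_add, dotProduct_sub, add_dotProduct,
    sub_dotProduct, dot_mulVec_comm_of_symm hH.transpose_eq u w] at h1 h2
  rw [abs_le]
  constructor <;> linarith

/-- The origin of `ξ`. The arithmetic–geometric inequality bounds the form by `eᵀΨe + vᵀP^K v -
vᵀQv` with `e = E_i v`, since the squares not involving `e` are what the Lyapunov equation adds to
`Q`. The first two terms are at most `c |v|²`, hence at most `c / Λ_min(Q)` times `vᵀQv`; the last
one is the `-1` in `ξ`. -/
theorem IsMSS.abs_symDir_le [NeZero d] (hK : M.IsMSS K) {α : ℝ} (hα : M.cost K ≤ α)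
    {E : Policy N k d} (hE : ‖E‖ ≤ 1) (i : Fin N) (v : Fin d → ℝ) :
    |v ⬝ᵥ symDir M K E i *ᵥ v| ≤ M.xi α * (v ⬝ᵥ M.Q i *ᵥ v) := by
  set e := E.mat i *ᵥ v with he
  set f := K.mat i *ᵥ v with hf
  set g := M.Γ K i *ᵥ v with hg
  set O := M.opE (M.PK K) i with hO
  have hOp : O.PosSemidef := opE_posSemidef hK.PK_posSemidef i
  have h1 : v ⬝ᵥ symDir M K E i *ᵥ v = 2 * (e ⬝ᵥ M.R i *ᵥ f) - 2 * ((M.B i *ᵥ e) ⬝ᵥ O *ᵥ g) := by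
    have h : v ⬝ᵥ ((E.mat i)ᵀ * M.LK K i)ᵀ *ᵥ v = v ⬝ᵥ ((E.mat i)ᵀ * M.LK K i) *ᵥ v := by
      rw [mulVec_transpose, dotProduct_comm, ← dotProduct_mulVec]
    rw [symDir, add_mulVec, dotProduct_add, h, dot_transpose_mul_mulVec, LK_eq, sub_mulVec,
      dotProduct_sub, ← mulVec_mulVec, ← mulVec_mulVec, ← mulVec_mulVec, dotProduct_mulVec _ (M.B i)ᵀ,
      vecMul_transpose]
    ring
  have h2 := abs_le.1 (abs_two_mul_dot_le (M.R_posDef i).posSemidef e f)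
  have h3 := abs_le.1 (abs_two_mul_dot_le hOp (M.B i *ᵥ e) g)
  have h4 : v ⬝ᵥ M.PK K i *ᵥ v = v ⬝ᵥ M.Q i *ᵥ v + f ⬝ᵥ M.R i *ᵥ f + g ⬝ᵥ O *ᵥ g := by
    conv_lhs => rw [hK.PK_fixed]
    rw [Pi.add_apply, opT_apply, stageMat, add_mulVec, add_mulVec, dotProduct_add, dotProduct_add,
      transpose_mul_mul_quadForm, transpose_mul_mul_quadForm]
  have h5 := hK.PK_quadForm_le hα i v
  have h6 := hK.Psi_quadForm_le hα i e
  rw [Psi, add_mulVec, dotProduct_add, transpose_mul_mul_quadForm, ← hO] at h6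
  have h7 : e ⬝ᵥ e ≤ v ⬝ᵥ v := mat_mulVec_dot_le hE i v
  have hmu := M.mu_pos
  have hα0 : 0 ≤ α := (cost_nonneg K).trans hα
  have hR0 := normMax_nonneg M.R
  have hψ : 0 ≤ normMax M.R + normMax M.B ^ 2 * (α / M.mu) := by positivity
  have h8 := mul_le_mul_of_nonneg_left h7 hψ
  have h9 := lamMin_mul_le M.Q_posDef i v
  have hl := M.lamMin_Q_pos
  set c := (1 + normMax M.B ^ 2) / M.mu * α + normMax M.R with hc
  have hc0 : 0 ≤ c := by positivity
  have hcc : c = (normMax M.R + normMax M.B ^ 2 * (α / M.mu)) + α / M.mu := by rw [hc]; ring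
  have h10 : c * (v ⬝ᵥ v) ≤ c / lamMin M.Q * (v ⬝ᵥ M.Q i *ᵥ v) := by
    rw [div_mul_eq_mul_div, le_div_iff₀ hl]
    have := mul_le_mul_of_nonneg_left h9 hc0
    linarith
  have h11 : M.xi α = c / lamMin M.Q - 1 := by rw [xi, hc]; ring
  have hle : ∀ x, x ≤ e ⬝ᵥ M.R i *ᵥ e + f ⬝ᵥ M.R i *ᵥ f + ((M.B i *ᵥ e) ⬝ᵥ O *ᵥ (M.B i *ᵥ e) +
      g ⬝ᵥ O *ᵥ g) → x ≤ M.xi α * (v ⬝ᵥ M.Q i *ᵥ v) := by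
    intro x hx
    rw [h11, sub_mul, one_mul]
    have h12 : (normMax M.R + normMax M.B ^ 2 * (α / M.mu)) * (v ⬝ᵥ v) + α / M.mu * (v ⬝ᵥ v) ≤
        c / lamMin M.Q * (v ⬝ᵥ M.Q i *ᵥ v) := by
      rw [← add_mul, ← hcc]
      exact h10
    linarith
  rw [h1, abs_le']
  exact ⟨hle _ (by linarith), hle _ (by linarith)⟩

theorem IsMSS.xi_nonneg [NeZero d] (hK : M.IsMSS K) {α : ℝ} (hα : M.cost K ≤ α) :
    0 ≤ M.xi α := by
  have := M.neZero_modes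
  -- Direction `E = 0` at a basis vector, where the form `Q` is positive.
  have h := (abs_nonneg _).trans (hK.abs_symDir_le hα (E := 0) (by simp) 0 (Pi.single 0 1))
  have hq := (M.Q_posDef 0).dotProduct_mulVec_pos (x := Pi.single 0 1) (by simp)
  simp only [star_trivial] at hq
  exact nonneg_of_mul_nonneg_left h hq

/-- For both signs `σ` the tuple `ξ P^K - σ P` solves the Lyapunov equation with source `ξ W - σ
(EᵀL + LᵀE) ≥ 0`, so the comparison principle makes it nonnegative. -/
theorem IsMSS.abs_quadForm_le [NeZero d] (hK : M.IsMSS K) {α : ℝ} (hα : M.cost K ≤ α)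
    {E : Policy N k d} (hE : ‖E‖ ≤ 1) {P : Fin N → Matrix (Fin d) (Fin d) ℝ}
    (hP : P = symDir M K E + M.opT K P) (i : Fin N) (v : Fin d → ℝ) :
    |v ⬝ᵥ P i *ᵥ v| ≤ M.xi α * (α / M.mu) * (v ⬝ᵥ v) := by
  have hξ := hK.xi_nonneg hα
  have hsgn : ∀ σ : ℝ, |σ| = 1 → σ * (v ⬝ᵥ P i *ᵥ v) ≤ M.xi α * (v ⬝ᵥ M.PK K i *ᵥ v) := by
    intro σ hσ
    have hfix : M.xi α • M.PK K - σ • P = (M.xi α • M.stageMat K - σ • symDir M K E) +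
        M.opT K (M.xi α • M.PK K - σ • P) := by
      rw [map_sub, map_smul, map_smul]
      conv_lhs => rw [hK.PK_fixed, hP]
      rw [smul_add, smul_add]
      abel
    have hnn : ∀ i v, 0 ≤ v ⬝ᵥ (M.xi α • M.stageMat K - σ • symDir M K E) i *ᵥ v := by
      intro i v
      rw [Pi.sub_apply, Pi.smul_apply, Pi.smul_apply, sub_mulVec, dotProduct_sub, smul_mulVec,
        smul_mulVec, dotProduct_smul, dotProduct_smul, smul_eq_mul, smul_eq_mul]
      have h1 := hK.abs_symDir_le hα hE i v
      have h2 := mul_le_mul_of_nonneg_left (M.Q_le_stageMat K i v) hξ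
      have h3 : σ * (v ⬝ᵥ symDir M K E i *ᵥ v) ≤ |v ⬝ᵥ symDir M K E i *ᵥ v| := by
        refine (le_abs_self _).trans_eq ?_
        rw [abs_mul, hσ, one_mul]
      linarith
    have h := (hnn i v).trans (hK.quadForm_le hfix hnn i v)
    rw [Pi.sub_apply, Pi.smul_apply, Pi.smul_apply, sub_mulVec, dotProduct_sub, smul_mulVec,
      smul_mulVec, dotProduct_smul, dotProduct_smul, smul_eq_mul, smul_eq_mul] at h
    linarith
  have h1 := hsgn 1 (by simp)
  have h2 := hsgn (-1) (by simp)
  have h3 := mul_le_mul_of_nonneg_left (hK.PK_quadForm_le hα i v) hξ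
  rw [abs_le]
  constructor <;> linarith

theorem IsMSS.pair_Γ_le (hK : M.IsMSS K) :
    pair (fun i => (M.Γ K i)ᵀ * M.Γ K i) (M.XK K) ≤ pair 1 (M.XK K) := by
  -- Rows of `p` sum to one, so `E(1) = 1`. By duality the claim is then `tr X(0) ≥ 0`.
  have h1 : (fun i => (M.Γ K i)ᵀ * M.Γ K i) = M.opT K 1 := by
    ext1 i
    simp [opT_apply, opE, ← Finset.sum_smul, M.p_sum]
  have h2 : pair 1 (M.XK K) = pair 1 M.X0 + pair 1 (M.opTadj K (M.XK K)) := by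
    rw [← pair_add_right, ← hK.XK_fixed]
  rw [h1, pair_opT, h2]
  have := pair_nonneg (H := 1) (fun i v => by simpa using dotProduct_self_nonneg_real v)
    M.X0_posSemidef
  linarith

theorem IsMSS.abs_cross_le [NeZero d] (hK : M.IsMSS K) {α : ℝ} (hα : M.cost K ≤ α)
    {E : Policy N k d} (hE : ‖E‖ ≤ 1) {P : Fin N → Matrix (Fin d) (Fin d) ℝ}
    (hP : P = symDir M K E + M.opT K P) (i : Fin N) (v : Fin d → ℝ) :
    |v ⬝ᵥ ((M.B i * E.mat i)ᵀ * M.opE P i * M.Γ K i) *ᵥ v| ≤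
      normMax M.B * (M.xi α * (α / M.mu)) / 2 * (v ⬝ᵥ v + (M.Γ K i *ᵥ v) ⬝ᵥ (M.Γ K i *ᵥ v)) := by
  set c := M.xi α * (α / M.mu) with hc
  set b := normMax M.B with hb
  have hPt : ∀ i, (P i)ᵀ = P i := hK.transpose_eq hP (symDir_transpose E)
  have hEt : (M.opE P i)ᵀ = M.opE P i := by
    rw [opE_transpose]
    simp only [hPt]
  have hc0 : 0 ≤ c := mul_nonneg (hK.xi_nonneg hα)
    (div_nonneg ((cost_nonneg K).trans hα) M.mu_pos.le)
  have h1 : v ⬝ᵥ ((M.B i * E.mat i)ᵀ * M.opE P i * M.Γ K i) *ᵥ v =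
      (M.B i *ᵥ E.mat i *ᵥ v) ⬝ᵥ M.opE P i *ᵥ (M.Γ K i *ᵥ v) := by
    rw [Matrix.mul_assoc, dot_transpose_mul_mulVec, mulVec_mulVec, mulVec_mulVec]
  rw [h1]
  have h2 := mulVec_dot_mulVec_le_normMax M.B i (E.mat i *ᵥ v)
  have h3 := mat_mulVec_dot_le hE i v
  have hb0 : 0 ≤ b := normMax_nonneg M.B
  set u := M.B i *ᵥ E.mat i *ᵥ v
  set w := M.Γ K i *ᵥ v
  have h4 : u ⬝ᵥ u ≤ b ^ 2 * (v ⬝ᵥ v) := h2.trans (mul_le_mul_of_nonneg_left h3 (by positivity))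
  -- For `b > 0` the vector `u` is rescaled by `1 / b`, which makes its squared length at most `v ⬝ᵥ
  -- v` and the final bound linear in `b`. For `b = 0` it vanishes.
  rcases hb0.eq_or_lt with h0 | h0
  · have hu : u = 0 := by
      rw [← h0] at h4
      exact dotProduct_self_eq_zero.1 (le_antisymm (by simpa using h4)
        (dotProduct_self_nonneg_real u))
    rw [hu, ← h0]
    simp
  · have h5 := abs_dot_mulVec_le_of_symm hEt
      (opE_abs_quadForm_le (M := M) (hK.abs_quadForm_le hα hE hP) i) (b⁻¹ • u) w
    rw [smul_dotProduct, smul_dotProduct, dotProduct_smul, smul_eq_mul, smul_eq_mul, smul_eq_mul,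
      abs_mul, abs_of_pos (inv_pos.2 h0), ← hc, inv_mul_le_iff₀ h0] at h5
    refine h5.trans ?_
    have h6 : b⁻¹ * (b⁻¹ * (u ⬝ᵥ u)) ≤ v ⬝ᵥ v := by
      rw [← mul_assoc, ← mul_inv, inv_mul_le_iff₀ (by positivity)]
      linarith
    have h7 := mul_le_mul_of_nonneg_left (add_le_add_left h6 (w ⬝ᵥ w)) (mul_nonneg hb0 hc0)
    linarith

theorem IsMSS.abs_hessian_le [NeZero d] (hK : M.IsMSS K) {α : ℝ} (hα : M.cost K ≤ α)
    {E : Policy N k d} (hE : ‖E‖ ≤ 1) :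
    |inner ℝ (fderiv ℝ (∇ M.cost) K E) E| ≤ M.smoothConst α := by
  obtain ⟨P, hP⟩ := hK.exists_eq_add_opT (symDir M K E)
  rw [hK.hessian_quadForm E hP]
  set H : Fin N → Matrix (Fin d) (Fin d) ℝ := fun i => (E.mat i)ᵀ * M.Psi K i * E.mat i
  set G : Fin N → Matrix (Fin d) (Fin d) ℝ := fun i => (M.B i * E.mat i)ᵀ * M.opE P i * M.Γ K i
  set T := pair 1 (M.XK K) with hT
  set c := M.xi α * (α / M.mu) with hc
  set b := normMax M.B with hb
  set ψ := normMax M.R + b ^ 2 * (α / M.mu) with hψ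
  have hX := hK.XK_posSemidef
  have hα0 : 0 ≤ α := (cost_nonneg K).trans hα
  have hmu := M.mu_pos
  have hb0 : 0 ≤ b := normMax_nonneg M.B
  have hc0 : 0 ≤ c := mul_nonneg (hK.xi_nonneg hα) (by positivity)
  have hψ0 : 0 ≤ ψ := add_nonneg (normMax_nonneg M.R) (by positivity)
  have hTle : T ≤ α / lamMin M.Q := hK.pair_one_XK_le hα
  have hH0 : 0 ≤ pair H (M.XK K) := pair_nonneg (fun i v => by
    rw [transpose_mul_mul_quadForm]
    exact (hK.Psi_posDef i).posSemidef.quadForm_nonneg _) hX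
  have hH : pair H (M.XK K) ≤ ψ * T := by
    rw [hT, ← pair_smul_left]
    refine pair_le_pair (fun i v => ?_) hX
    rw [transpose_mul_mul_quadForm]
    refine (hK.Psi_quadForm_le hα i _).trans ?_
    simpa [smul_mulVec] using mul_le_mul_of_nonneg_left (mat_mulVec_dot_le hE i v) hψ0
  set D : Fin N → Matrix (Fin d) (Fin d) ℝ :=
    (b * c / 2) • (1 + fun i => (M.Γ K i)ᵀ * M.Γ K i) with hD
  have hDq : ∀ i v, v ⬝ᵥ D i *ᵥ v =
      b * c / 2 * (v ⬝ᵥ v + (M.Γ K i *ᵥ v) ⬝ᵥ (M.Γ K i *ᵥ v)) := by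
    intro i v
    rw [hD, Pi.smul_apply, smul_mulVec, dotProduct_smul, smul_eq_mul, Pi.add_apply, add_mulVec,
      dotProduct_add, dot_transpose_mul_mulVec, Pi.one_apply, one_mulVec]
  have hDle : pair D (M.XK K) ≤ b * c * T := by
    rw [hD, pair_smul_left, pair_add_left]
    have h := mul_le_mul_of_nonneg_left hK.pair_Γ_le (mul_nonneg hb0 hc0)
    linarith
  have hcross := fun i v => abs_le.1 ((hK.abs_cross_le hα hE hP i v).trans_eq (hDq i v).symm)
  have hG1 : pair G (M.XK K) ≤ pair D (M.XK K) := pair_le_pair (fun i v => (hcross i v).2) hX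
  have hG2 : -pair D (M.XK K) ≤ pair G (M.XK K) := by
    have h : pair ((-1 : ℝ) • D) (M.XK K) ≤ pair G (M.XK K) := pair_le_pair (fun i v => by
      have := (hcross i v).1
      rw [Pi.smul_apply, smul_mulVec, dotProduct_smul, smul_eq_mul]
      linarith) hX
    rw [pair_smul_left] at h
    linarith
  have hfin : M.smoothConst α = (2 * ψ + 4 * (b * c)) * (α / lamMin M.Q) := by
    -- When `b = 0` the quotient is `0` by convention and both sides vanish.
    have hbb : b ^ 2 * (1 + 2 * M.xi α / b) = b ^ 2 + 2 * M.xi α * b := by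
      rcases eq_or_ne b 0 with h | h
      · simp [h]
      · field_simp
    rw [smoothConst, ← hb, hbb, hψ, hc]
    ring
  have hmain : (2 * ψ + 4 * (b * c)) * T ≤ M.smoothConst α := by
    rw [hfin]
    exact mul_le_mul_of_nonneg_left hTle (by positivity)
  rw [abs_le]
  -- From below, the `Ψ` term is nonnegative and only the cross term counts; from above, both bounds
  -- add up.
  constructor
  · have : 0 ≤ ψ * T := hH0.trans hH
    linarith
  · linarith

end Bounds

end MJLS

end

noncomputable section

namespace MJLS

open Matrix

/-! ### Operator norm of the Hessian, descent inequality, the unique minimizer. -/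

section Main

variable {N d k : ℕ} {Ω : Type*} [MeasurableSpace Ω] {M : MJLS N d k Ω} {K : Policy N k d}

/-- A symmetric operator whose quadratic form is bounded by `c` on the unit ball has norm at most
`c`. -/
theorem opNorm_le_of_abs_inner_le {F : Type*} [NormedAddCommGroup F] [InnerProductSpace ℝ F]
    {T : F →L[ℝ] F} (hT : ∀ x y, inner ℝ (T x) y = inner ℝ (T y) x) {c : ℝ} (hc : 0 ≤ c)
    (h : ∀ x, |inner ℝ (T x) x| ≤ c * ‖x‖ ^ 2) : ‖T‖ ≤ c := by
  have hb : ∀ x y, inner ℝ (T x) y ≤ c * (‖x‖ ^ 2 + ‖y‖ ^ 2) / 2 := by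
    intro x y
    have h1 := abs_le.1 (h (x + y))
    have h2 := abs_le.1 (h (x - y))
    have h3 := parallelogram_law_with_norm ℝ x y
    have h4 := hT x y
    simp only [map_add, map_sub, inner_add_left, inner_add_right, inner_sub_left,
      inner_sub_right] at h1 h2
    have h5 : c * (‖x + y‖ ^ 2 + ‖x - y‖ ^ 2) = c * (2 * (‖x‖ ^ 2 + ‖y‖ ^ 2)) := by
      rw [← h3]
    linarith
  refine T.opNorm_le_bound hc fun x => ?_
  rcases eq_or_ne x 0 with rfl | hx
  · simp
  rcases eq_or_ne (T x) 0 with h0 | h0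
  · rw [h0, norm_zero]; positivity
  have hx' : 0 < ‖x‖ := norm_pos_iff.2 hx
  have ht' : 0 < ‖T x‖ := norm_pos_iff.2 h0
  -- The test vector is `T x` rescaled to the length of `x`, which balances the two squares in `hb`.
  have h1 := hb x ((‖x‖ / ‖T x‖) • T x)
  rw [inner_smul_right, real_inner_self_eq_norm_sq, norm_smul, Real.norm_of_nonneg (by positivity),
    div_mul_cancel₀ _ ht'.ne'] at h1
  have h2 : ‖x‖ / ‖T x‖ * ‖T x‖ ^ 2 = ‖x‖ * ‖T x‖ := by field_simp
  rw [h2] at h1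
  have h3 : ‖x‖ * ‖T x‖ ≤ ‖x‖ * (c * ‖x‖) := by nlinarith
  exact le_of_mul_le_mul_left h3 hx'

theorem IsMSS.abs_hessian_le_mul [NeZero d] (hK : M.IsMSS K) {α : ℝ} (hα : M.cost K ≤ α)
    (E : Policy N k d) :
    |inner ℝ (fderiv ℝ (∇ M.cost) K E) E| ≤ M.smoothConst α * ‖E‖ ^ 2 := by
  rcases eq_or_ne E 0 with rfl | hE
  · simp
  have hE' : 0 < ‖E‖ := norm_pos_iff.2 hE
  have h := hK.abs_hessian_le hα (E := ‖E‖⁻¹ • E) (by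
    rw [norm_smul, norm_inv, norm_norm, inv_mul_cancel₀ hE'.ne'])
  rw [map_smul, inner_smul_left, inner_smul_right, abs_mul, abs_mul] at h
  simp only [conj_trivial, abs_inv, abs_norm] at h
  rw [← mul_assoc, ← mul_inv, inv_mul_le_iff₀ (by positivity)] at h
  linarith

theorem IsMSS.norm_hessian_le [NeZero d] (hK : M.IsMSS K) {α : ℝ} (hα : M.cost K ≤ α) :
    ‖fderiv ℝ (∇ M.cost) K‖ ≤ M.smoothConst α := by
  refine opNorm_le_of_abs_inner_le (fun E F => ?_)
    ((abs_nonneg _).trans (hK.abs_hessian_le hα (E := 0) (by simp))) (hK.abs_hessian_le_mul hα)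
  have hf : ContDiffAt ℝ 2 M.cost K := hK.contDiffAt_cost
  rw [inner_fderiv_gradient hf, inner_fderiv_gradient hf]
  exact hf.isSymmSndFDerivAt (by simp) E F

/-- Second-order upper bound for a function of one variable on `[0, 1]`. -/
theorem le_of_second_deriv_le {φ φ' φ'' : ℝ → ℝ} {c : ℝ}
    (h1 : ∀ t ∈ Set.Icc (0 : ℝ) 1, HasDerivAt φ (φ' t) t)
    (h2 : ∀ t ∈ Set.Icc (0 : ℝ) 1, HasDerivAt φ' (φ'' t) t)
    (h3 : ∀ t ∈ Set.Icc (0 : ℝ) 1, φ'' t ≤ c) : φ 1 ≤ φ 0 + φ' 0 + c / 2 := by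
  -- Two monotonicity arguments: `φ' - c t` is antitone, hence so is `φ - φ'(0) t - c t² / 2`.
  have hd1 : ∀ t ∈ Set.Icc (0 : ℝ) 1, HasDerivAt (fun t => φ' t - c * t) (φ'' t - c) t := by
    intro t ht
    simpa using (h2 t ht).fun_sub ((hasDerivAt_id t).const_mul c)
  have ha1 : AntitoneOn (fun t => φ' t - c * t) (Set.Icc 0 1) := by
    refine antitoneOn_of_deriv_nonpos (convex_Icc 0 1)
      (fun t ht => (hd1 t ht).continuousAt.continuousWithinAt)
      (fun t ht => (hd1 t (interior_subset ht)).differentiableAt.differentiableWithinAt)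
      fun t ht => ?_
    rw [(hd1 t (interior_subset ht)).deriv]
    linarith [h3 t (interior_subset ht)]
  have hd2 : ∀ t ∈ Set.Icc (0 : ℝ) 1,
      HasDerivAt (fun t => φ t - φ' 0 * t - c / 2 * t ^ 2) (φ' t - φ' 0 - c * t) t := by
    intro t ht
    have := ((h1 t ht).fun_sub ((hasDerivAt_id t).const_mul (φ' 0))).fun_sub
      ((hasDerivAt_pow 2 t).const_mul (c / 2))
    refine this.congr_deriv ?_
    norm_num
    ring
  have ha2 : AntitoneOn (fun t => φ t - φ' 0 * t - c / 2 * t ^ 2) (Set.Icc 0 1) := by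
    refine antitoneOn_of_deriv_nonpos (convex_Icc 0 1)
      (fun t ht => (hd2 t ht).continuousAt.continuousWithinAt)
      (fun t ht => (hd2 t (interior_subset ht)).differentiableAt.differentiableWithinAt)
      fun t ht => ?_
    have ht' := interior_subset ht
    rw [(hd2 t ht').deriv]
    have := ha1 (Set.left_mem_Icc.2 zero_le_one) ht' ht'.1
    simp only [mul_zero, sub_zero] at this
    linarith
  have := ha2 (Set.left_mem_Icc.2 zero_le_one) (Set.right_mem_Icc.2 zero_le_one) zero_le_one
  simp only [mul_zero, sub_zero, mul_one, one_pow] at this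
  norm_num at this
  linarith

theorem cost_le_of_segment [NeZero d] {α : ℝ} {K' : Policy N k d}
    (h : ∀ t ∈ Set.Icc (0 : ℝ) 1, t • K + (1 - t) • K' ∈ M.sublevel α) :
    M.cost K' ≤ M.cost K + inner ℝ (∇ M.cost K) (K' - K) +
      M.smoothConst α / 2 * ‖K' - K‖ ^ 2 := by
  have hmem : ∀ t ∈ Set.Icc (0 : ℝ) 1, K + t • (K' - K) ∈ M.sublevel α := by
    intro t ht
    -- The hypothesis runs through the segment from `K'` to `K`; the line used here starts at `K`.
    have := h (1 - t) ⟨by linarith [ht.2], by linarith [ht.1]⟩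
    convert this using 1
    module
  have := le_of_second_deriv_le (φ := fun t => M.cost (K + t • (K' - K)))
    (φ' := fun t => fderiv ℝ M.cost (K + t • (K' - K)) (K' - K))
    (φ'' := fun t => inner ℝ (fderiv ℝ (∇ M.cost) (K + t • (K' - K)) (K' - K)) (K' - K))
    (c := M.smoothConst α * ‖K' - K‖ ^ 2)
    (fun t ht => hasDerivAt_line
      ((IsMSS.contDiffAt_cost (n := 1) (hmem t ht).1).differentiableAt one_ne_zero))
    (fun t ht => hasDerivAt_fderiv_line (IsMSS.contDiffAt_cost (hmem t ht).1))
    (fun t ht => (le_abs_self _).trans (IsMSS.abs_hessian_le_mul (hmem t ht).1 (hmem t ht).2 _))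
  simp only [one_smul, zero_smul, add_zero, add_sub_cancel] at this
  rw [inner_gradient]
  linarith

variable (M)

/-- The cost attains its minimum on the compact sublevel set of any stabilizing `K₀`; policies
outside it cost more than `K₀`. -/
theorem exists_isOptimal [NeZero d] [NeZero k] (h : M.stabSet.Nonempty) :
    ∃ K, M.IsOptimal K := by
  obtain ⟨K₀, hK₀⟩ := h
  obtain ⟨K, hK, hmin⟩ := (M.isCompact_sublevel (M.cost K₀)).exists_isMinOn ⟨K₀, hK₀, le_rfl⟩
    (f := M.cost) fun K hK =>
      (IsMSS.contDiffAt_cost (n := 0) hK.1).continuousAt.continuousWithinAt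
  refine ⟨K, hK.1, fun K' hK' => ?_⟩
  rcases le_total (M.cost K') (M.cost K₀) with h | h
  · exact hmin ⟨hK', h⟩
  · exact hK.2.trans h

variable {M}

/-- The stabilizing set is open, so the gradient `2 L 𝐗` vanishes at a minimizer, and `𝐗 ≥ μ > 0`
can be cancelled. -/
theorem IsOptimal.LK_eq_zero [NeZero d] (hK : M.IsOptimal K) (i : Fin N) : M.LK K i = 0 := by
  have hs : M.IsMSS K := hK.1
  have hloc : IsLocalMin M.cost K := by
    filter_upwards [hs.eventually] with K' hK' using hK.2 K' hK'
  have hg : ∇ M.cost K = 0 := by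
    refine ext_inner_right ℝ fun E => ?_
    rw [inner_gradient, hloc.fderiv_eq_zero]
    simp
  have h1 := hs.norm_gradient_sq
  have h2 := hs.mu_sq_mul_tupleInner_le (M.LK K)
  rw [hg, norm_zero] at h1
  have hnn : ∀ i, 0 ≤ ((M.LK K i)ᵀ * M.LK K i).trace := fun i => by
    simpa using (posSemidef_conjTranspose_mul_self (M.LK K i)).trace_nonneg
  have h3 : ((M.LK K i)ᵀ * M.LK K i).trace ≤ tupleInner (M.LK K) (M.LK K) :=
    Finset.single_le_sum (f := fun i => ((M.LK K i)ᵀ * M.LK K i).trace) (fun i _ => hnn i)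
      (Finset.mem_univ i)
  have hmu : 0 < M.mu ^ 2 := pow_pos M.mu_pos 2
  have h4 : ((M.LK K i)ᵀ * M.LK K i).trace = 0 := by
    refine le_antisymm ?_ (hnn i)
    have h5 := mul_le_mul_of_nonneg_left h3 hmu.le
    by_contra hne
    have := mul_pos hmu (not_le.1 hne)
    linarith
  rw [← conjTranspose_eq_transpose_of_trivial] at h4
  exact trace_conjTranspose_mul_self_eq_zero_iff.1 h4

theorem IsMSS.norm_sq_le_pair_Psi [NeZero d] {K' : Policy N k d} (hK : M.IsMSS K)
    (hK' : M.IsMSS K') (E : Policy N k d) :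
    M.mu * lamMin M.R * ‖E‖ ^ 2 ≤
      pair (fun i => (E.mat i)ᵀ * M.Psi K i * E.mat i) (M.XK K') := by
  have hps : ∀ i, ((E.mat i)ᵀ * E.mat i).PosSemidef := fun i => by
    simpa using posSemidef_conjTranspose_mul_self (E.mat i)
  have h0 : 0 ≤ lamMin M.R := Real.iInf_nonneg fun i => sigmaMin_nonneg _
  have h1 : M.mu * pair 1 (fun i => (E.mat i)ᵀ * E.mat i) ≤
      pair (M.XK K') fun i => (E.mat i)ᵀ * E.mat i := by
    rw [← pair_smul_left]
    exact pair_le_pair (fun i v => by simpa [smul_mulVec] using hK'.mu_le_XK i v) hps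
  have h2 : pair (lamMin M.R • fun i => (E.mat i)ᵀ * E.mat i) (M.XK K') ≤
      pair (fun i => (E.mat i)ᵀ * M.Psi K i * E.mat i) (M.XK K') := by
    refine pair_le_pair (fun i v => ?_) hK'.XK_posSemidef
    rw [Pi.smul_apply, smul_mulVec, dotProduct_smul, smul_eq_mul, dot_transpose_mul_mulVec,
      transpose_mul_mul_quadForm]
    exact (lamMin_mul_le M.R_posDef i _).trans (hK.R_le_Psi i _)
  rw [pair_smul_left, pair_comm] at h2
  have h3 : ‖E‖ ^ 2 = pair 1 fun i => (E.mat i)ᵀ * E.mat i := by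
    rw [norm_sq_eq, pair_one]
  rw [h3]
  have := mul_le_mul_of_nonneg_left h1 h0
  linarith

/-- With `L^K = 0` the cost difference reduces to its quadratic term, which is at least `μ Λ_min(R)
‖K - K'‖²`. -/
theorem IsOptimal.eq [NeZero d] [NeZero k] {K' : Policy N k d} (hK : M.IsOptimal K)
    (hK' : M.IsOptimal K') : K' = K := by
  have h := IsMSS.cost_sub_cost hK.1 hK'.1
  have hL : pair (fun i => ((K - K').mat i)ᵀ * M.LK K i) (M.XK K') = 0 := by
    simp [pair, hK.LK_eq_zero]
  have h2 := IsMSS.norm_sq_le_pair_Psi hK.1 hK'.1 (K - K')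
  rw [hL] at h
  have h3 := hK'.2 K hK.1
  have hc : 0 < M.mu * lamMin M.R := mul_pos M.mu_pos M.lamMin_R_pos
  have h4 : ‖K - K'‖ ^ 2 ≤ 0 := by
    by_contra hne
    have := mul_pos hc (not_le.1 hne)
    linarith
  have h5 : K - K' = 0 := by
    rw [← norm_eq_zero]
    exact pow_eq_zero_iff two_ne_zero |>.1 (le_antisymm h4 (by positivity))
  exact (sub_eq_zero.1 h5).symm

end Main

end MJLS

end

theorem mainTheorem4 {N d k : ℕ} [NeZero d] [NeZero k] {Ω : Type*} [MeasurableSpace Ω]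
    (M : MJLS N d k Ω)
    -- the system is mean-square stabilizable
    (hstab : M.stabSet.Nonempty) :
    -- the objects in the statement are well defined on the stabilizing set
    (∀ K ∈ M.stabSet,
      M.extCost K ≠ ⊤ ∧
      (∃! P, M.IsLyapunov K P) ∧
      M.cost K = ∫ a, M.x0 a ⬝ᵥ ((∑ i, M.π i • M.PK K i) *ᵥ M.x0 a) ∂M.Pr ∧
      (∀ i α β, Summable fun t => M.corr K t i α β) ∧
      ContDiffAt ℝ 2 M.cost K) ∧
    (∃! Ks, M.IsOptimal Ks) ∧
    0 < M.mu ∧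
    -- coercivity
    (∀ Kseq : ℕ → MJLS.Policy N k d, (∀ l, Kseq l ∈ M.stabSet) →
      (Tendsto (fun l => ‖Kseq l‖) atTop atTop ∨
        ∃ K ∈ frontier M.stabSet, Tendsto Kseq atTop (𝓝 K)) →
      Tendsto (fun l => M.cost (Kseq l)) atTop atTop) ∧
    -- almost smoothness
    (∀ K ∈ M.stabSet, ∀ K' ∈ M.stabSet,
      M.cost K' - M.cost K =
        ∑ i, (-2 * (M.XK K' i * ((K - K').mat i)ᵀ * M.LK K i).trace +
          (M.XK K' i * ((K - K').mat i)ᵀ * M.Psi K i * (K - K').mat i).trace) ∧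
      M.cost K' - M.cost K =
        -2 * MJLS.tupleInner (fun i => ((K - K').mat i)ᵀ * M.LK K i) (M.XK K') +
          MJLS.tupleInner (fun i => ((K - K').mat i)ᵀ * M.Psi K i * (K - K').mat i) (M.XK K')) ∧
    -- gradient dominance
    (∀ Ks, M.IsOptimal Ks → ∀ K ∈ M.stabSet,
      M.cost K - M.cost Ks ≤
        MJLS.normMax (M.XK Ks) *
          MJLS.tupleInner (fun i => (M.Psi K i)⁻¹ * M.LK K i) (M.LK K) ∧
      MJLS.normMax (M.XK Ks) * MJLS.tupleInner (fun i => (M.Psi K i)⁻¹ * M.LK K i) (M.LK K) ≤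
        MJLS.normMax (M.XK Ks) / MJLS.lamMin M.R * MJLS.tupleInner (M.LK K) (M.LK K) ∧
      MJLS.normMax (M.XK Ks) / MJLS.lamMin M.R * MJLS.tupleInner (M.LK K) (M.LK K) ≤
        MJLS.normMax (M.XK Ks) / (4 * M.mu ^ 2 * MJLS.lamMin M.R) * ‖∇ M.cost K‖ ^ 2) ∧
    -- compactness of the sublevel sets
    (∀ Ks, M.IsOptimal Ks → ∀ α, M.cost Ks ≤ α → IsCompact (M.sublevel α)) ∧
    -- smoothness on the sublevel sets
    (∀ α : ℝ,
      (∀ K ∈ M.sublevel α, ‖fderiv ℝ (∇ M.cost) K‖ ≤ M.smoothConst α) ∧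
      (∀ K K' : MJLS.Policy N k d,
        (∀ t ∈ Set.Icc (0 : ℝ) 1, t • K + (1 - t) • K' ∈ M.sublevel α) →
        M.cost K' ≤ M.cost K + inner ℝ (∇ M.cost K) (K' - K) +
          M.smoothConst α / 2 * ‖K' - K‖ ^ 2)) := by
  refine ⟨fun K (hK : M.IsMSS K) => ⟨hK.extCost_ne_top, hK.existsUnique_isLyapunov,
    hK.cost_eq_integral, hK.summable_corr, hK.contDiffAt_cost⟩, ?_, M.mu_pos, ?_, ?_, ?_,
    fun _ _ α _ => M.isCompact_sublevel α,
    fun α => ⟨fun K hK => MJLS.IsMSS.norm_hessian_le hK.1 hK.2,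
      fun K K' h => MJLS.cost_le_of_segment h⟩⟩
  · obtain ⟨Ks, hKs⟩ := M.exists_isOptimal hstab
    exact ⟨Ks, hKs, fun K hK => hKs.eq hK⟩
  · rintro Kseq hKseq (h | ⟨K, hK, h⟩)
    · exact M.tendsto_cost_of_norm hKseq h
    · exact M.tendsto_cost_of_frontier hKseq hK h
  · intro K hK K' hK'
    exact ⟨MJLS.IsMSS.cost_sub_cost_trace hK hK', MJLS.IsMSS.cost_sub_cost_tupleInner hK hK'⟩
  · intro Ks hKs K (hK : M.IsMSS K)
    have hX := normMax_nonneg (M.XK Ks)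
    have hR := M.lamMin_R_pos
    have hmu := M.mu_pos
    refine ⟨hK.cost_sub_le hKs.1, ?_, ?_⟩
    · rw [div_mul_eq_mul_div, mul_div_assoc]
      refine mul_le_mul_of_nonneg_left ?_ hX
      rw [le_div_iff₀ hR, mul_comm]
      exact hK.inv_le_self
    -- The gradient is `2 L 𝐗`: its square supplies the `4`, and `𝐗² ≥ μ²` supplies the `μ²`.
    · rw [hK.norm_gradient_sq, div_mul_eq_mul_div, div_mul_eq_mul_div,
        div_le_div_iff₀ hR (by positivity)]
      have h := mul_le_mul_of_nonneg_left (hK.mu_sq_mul_tupleInner_le (M.LK K))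
        (mul_nonneg hX hR.le)
      linarith
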